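/- Let $n\ge 1$. For $p\ge 0$ put $c_p=2^{p/2}\Gamma(\tfrac p2+1)$ and, with the modified Bessel functions $I_\nu,K_\nu$, $\alpha_p(r)=c_p r^{-p/2}I_{p/2}(r)$ (so $\alpha_p(0)=1$ by continuity), $\beta_p(r)=c_p^{-1}r^{-p/2}K_{p/2}(r)$. Let $\varphi(r,s)=\alpha_n(r)\beta_n(s)$ and $\delta(r,s)=rs\,\varphi(r,s)$ for $s\ge r\ge 0$, $s>0$. Then: (1) $\delta$ is the Green kernel of $1-\Delta$ on radial vector fields of $\mathbb R^n$: for every continuous $f:[0,\infty)\to\mathbb R$ with $f(r)\to0$ as $r\to\infty$, the function $u(r)=\int_0^r\delta(s,r)s^{n-1}f(s)\,ds+\int_r^\infty\delta(r,s)s^{n-1}f(s)\,ds$ is the unique function on $[0,\infty)$ that is $C^2$ on $(0,\infty)$, satisfies $u-\big(u''+\tfrac{n-1}{r}u'-\tfrac{n-1}{r^2}u\big)=f$ on $(0,\infty)$, is continuous at $0$ with $u(0)=0$, and tends to $0$ at infinity. (2) The function $S(r)=\dfrac{r\,\partial_1\varphi(r,r)\,\varphi(0,r)-r\,\varphi(r,r)\,\partial_2\varphi(0,r)}{\varphi(0,r)^2}$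 equals $\dfrac{1}{r^n\beta_n(r)}$ for $r>0$, and there is $C>0$ with $S(r)\ge C$ for all $r>0$. (3) Let $\omega_0:[0,\infty)\to\mathbb R$ be continuous with $\omega_0(r)\to0$ as $r\to\infty$, $\omega_0\le 0$ and $\omega_0\not\equiv 0$, and put $z_0(s)=s^{n-1}\omega_0(s)$. Consider the Lagrangian form of the radial $H^1$ EPDiff ($n$-dimensional Camassa–Holm) equation with initial momentum $\omega_0$, $$\gamma_t(t,r)=\int_0^r\frac{\delta(\gamma(t,s),\gamma(t,r))}{\rho(t,s)}z_0(s)\,ds+\int_r^\infty\frac{\delta(\gamma(t,r),\gamma(t,s))}{\rho(t,s)}z_0(s)\,ds,$$ $$\rho_t(t,r)=\rho(t,r)\int_0^r\frac{\partial_2\delta(\gamma(t,s),\gamma(t,r))}{\rho(t,s)}z_0(s)\,ds+\rho(t,r)\int_r^\infty\frac{\partial_1\delta(\gamma(t,r),\gamma(t,s))}{\rho(t,s)}z_0(s)\,ds,$$ $$\rho=\gamma_r,\qquad \gamma(t,0)=0,\qquad \gamma(0,r)=r,\qquad \rho(0,r)=1\qquad(r\ge0).$$ A solution on $[0,T)$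 is a pair $(\gamma,\rho)$ satisfying these equations for $0\le t<T$, $r\ge0$, with each $\rho(t,\cdot)$ continuous on $[0,\infty)$, and with $\rho$ bounded above and below by positive constants on $[0,\tau]\times[0,\infty)$ for each $\tau<T$. Then there are a finite $T>0$ and a solution $(\gamma,\rho)$ on $[0,T)$ that is unique and maximal (any solution on an interval $[0,T')$ has $T'\le T$ and coincides with $(\gamma,\rho)$ on $[0,T')$), and there is $r_0\ge0$ such that $\gamma_r(t,r_0)=\rho(t,r_0)\to 0$ as $t\nearrow T$; that is, $\gamma_r$ reaches $0$ in finite time. -/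

import Mathlib

open Set Filter Topology MeasureTheory

noncomputable section

namespace RadialEPDiff

/-- Modified Bessel function of the first kind, `I_ν(x)`, for `x > 0`. -/
def besselI (ν x : ℝ) : ℝ :=
  ∑' m : ℕ, (x / 2) ^ (2 * (m : ℝ) + ν) / ((m.factorial : ℝ) * Real.Gamma ((m : ℝ) + ν + 1))

/-- Modified Bessel function of the second kind, `K_ν(x)`, for `x > 0`. -/
def besselK (ν x : ℝ) : ℝ :=
  ∫ t in Ioi (0 : ℝ), Real.exp (-x * Real.cosh t) * Real.cosh (ν * t)

/-- The constant `c_p = 2^{p/2} Γ(p/2 + 1)`. -/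
def besselConst (p : ℝ) : ℝ := (2 : ℝ) ^ (p / 2) * Real.Gamma (p / 2 + 1)

/-- `α_p(r) = c_p r^{-p/2} I_{p/2}(r)` for `r > 0`, with its limit `α_p(0) = 1` at the origin. -/
def alpha (p r : ℝ) : ℝ :=
  if r = 0 then 1 else besselConst p * r ^ (-(p / 2)) * besselI (p / 2) r

/-- `β_p(r) = c_p⁻¹ r^{-p/2} K_{p/2}(r)` for `r > 0`. -/
def beta (p r : ℝ) : ℝ := (besselConst p)⁻¹ * r ^ (-(p / 2)) * besselK (p / 2) r

/-- `φ(r,s) = α_n(r) β_n(s)`, used for `s ≥ r ≥ 0`, `s > 0`. -/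
def phi (n : ℕ) (r s : ℝ) : ℝ := alpha n r * beta n s

/-- `∂₁φ` (one-sided at the end point of `[0,∞)`). -/
def phi₁ (n : ℕ) (r s : ℝ) : ℝ := derivWithin (fun x => phi n x s) (Ici 0) r

/-- `∂₂φ`. -/
def phi₂ (n : ℕ) (r s : ℝ) : ℝ := derivWithin (fun y => phi n r y) (Ici 0) s

/-- `S(r) = (r ∂₁φ(r,r) φ(0,r) - r φ(r,r) ∂₂φ(0,r)) / φ(0,r)²`. -/
def S (n : ℕ) (r : ℝ) : ℝ :=
  (r * phi₁ n r r * phi n 0 r - r * phi n r r * phi₂ n 0 r) / phi n 0 r ^ 2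

/-- The kernel `δ(r,s) = r s φ(r,s)`, used for `s ≥ r ≥ 0`, `s > 0`. -/
def delta (n : ℕ) (r s : ℝ) : ℝ := r * s * phi n r s

/-- `∂₁δ` (one-sided at the end point of `[0,∞)`). -/
def delta₁ (n : ℕ) (r s : ℝ) : ℝ := derivWithin (fun x => delta n x s) (Ici 0) r

/-- `∂₂δ`. -/
def delta₂ (n : ℕ) (r s : ℝ) : ℝ := derivWithin (fun y => delta n r y) (Ici 0) s

/-- The radial component of the vector Laplacian of `u(r) ∂_r` on `ℝⁿ`:
`u'' + (n-1)/r u' - (n-1)/r² u`. -/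
def vectorLaplacian (n : ℕ) (u : ℝ → ℝ) (r : ℝ) : ℝ :=
  deriv (deriv u) r + ((n : ℝ) - 1) / r * deriv u r - ((n : ℝ) - 1) / r ^ 2 * u r

/-- `u` solves `(1 - Δ)(u ∂_r) = f ∂_r` on `(0,∞)`, vanishes at the origin and decays at
infinity. -/
structure IsInverse (n : ℕ) (f u : ℝ → ℝ) : Prop where
  contDiffOn : ContDiffOn ℝ 2 u (Ioi 0)
  equation : ∀ r, 0 < r → u r - vectorLaplacian n u r = f r
  zero : u 0 = 0
  tendsto_zero : Tendsto u (𝓝[>] 0) (𝓝 0)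
  tendsto_atTop : Tendsto u atTop (𝓝 0)

/-- `∫₀^r δ(s,r) s^{n-1} f(s) ds + ∫_r^∞ δ(r,s) s^{n-1} f(s) ds`. -/
def greenPotential (n : ℕ) (f : ℝ → ℝ) (r : ℝ) : ℝ :=
  (∫ s in Ioc 0 r, delta n s r * (s ^ (n - 1) * f s)) +
    ∫ s in Ioi r, delta n r s * (s ^ (n - 1) * f s)

/-- Right side of the equation for `γ` at fixed time, with `z₀(s) = s^{n-1} ω₀(s)`:
`∫₀^r δ(γ(s),γ(r)) z₀(s)/ρ(s) ds + ∫_r^∞ δ(γ(r),γ(s)) z₀(s)/ρ(s) ds`. -/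
def gammaField (n : ℕ) (ω₀ γ ρ : ℝ → ℝ) (r : ℝ) : ℝ :=
  (∫ s in Ioc 0 r, delta n (γ s) (γ r) / ρ s * (s ^ (n - 1) * ω₀ s)) +
    ∫ s in Ioi r, delta n (γ r) (γ s) / ρ s * (s ^ (n - 1) * ω₀ s)

/-- Right side of the equation for `ρ` at fixed time:
`ρ(r) ∫₀^r ∂₂δ(γ(s),γ(r)) z₀(s)/ρ(s) ds + ρ(r) ∫_r^∞ ∂₁δ(γ(r),γ(s)) z₀(s)/ρ(s) ds`. -/
def rhoField (n : ℕ) (ω₀ γ ρ : ℝ → ℝ) (r : ℝ) : ℝ :=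
  ρ r * (∫ s in Ioc 0 r, delta₂ n (γ s) (γ r) / ρ s * (s ^ (n - 1) * ω₀ s)) +
    ρ r * ∫ s in Ioi r, delta₁ n (γ r) (γ s) / ρ s * (s ^ (n - 1) * ω₀ s)

/-- `(γ, ρ)`, as functions of `(t, r)` with `ρ = γ_r`, is a solution on the time interval `[0,T)`
of the Lagrangian (particle-trajectory) form of the radial `H¹` EPDiff equation on `ℝⁿ` with
initial momentum `ω₀`. Each `γ(t,·)` is a `C¹` diffeomorphism of `[0,∞)` whose derivative lies
between two positive constants, locally uniformly in `t`. -/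
structure IsLagrangianSolution (n : ℕ) (ω₀ : ℝ → ℝ) (T : ℝ) (γ ρ : ℝ → ℝ → ℝ) : Prop where
  gamma_init : ∀ r, 0 ≤ r → γ 0 r = r
  rho_init : ∀ r, 0 ≤ r → ρ 0 r = 1
  gamma_zero : ∀ t ∈ Ico 0 T, γ t 0 = 0
  gamma_deriv : ∀ t ∈ Ico 0 T, ∀ r, 0 ≤ r → HasDerivWithinAt (γ t) (ρ t r) (Ici 0) r
  rho_continuous : ∀ t ∈ Ico 0 T, ContinuousOn (ρ t) (Ici 0)
  rho_bounds : ∀ τ ∈ Ico 0 T, ∃ a b : ℝ, 0 < a ∧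
    ∀ t ∈ Icc 0 τ, ∀ r, 0 ≤ r → a ≤ ρ t r ∧ ρ t r ≤ b
  gamma_equation : ∀ t ∈ Ico 0 T, ∀ r, 0 ≤ r →
    HasDerivWithinAt (fun τ => γ τ r) (gammaField n ω₀ (γ t) (ρ t) r) (Ico 0 T) t
  rho_equation : ∀ t ∈ Ico 0 T, ∀ r, 0 ≤ r →
    HasDerivWithinAt (fun τ => ρ τ r) (rhoField n ω₀ (γ t) (ρ t) r) (Ico 0 T) t

end RadialEPDiff

end

/-! Write p(x) = x α_n(x) and q(x) = x β_n(x), the solutions of u = Δu on radial fields that are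
regular at 0 and decaying at infinity. Since δ(r,s) = p(r) q(s), everything rests on the Wronskian
identity x^(n-1) (p' q - p q') = 1 (`kernel_wronskian`). It makes variation of parameters produce
the Green potential in (1); uniqueness there is the maximum principle (`IsInverse.le`). The same
identity gives (2), and S ≥ n because r^n β_n(r) is at most its limit 1/n at the origin.

For (3), the equations are an ODE y' = V(y) in the Banach space of bounded pairs (γ - id, ρ - 1)
tied by γ_r = ρ. The field V is locally Lipschitz where ρ lies between positive constants
(`field_lipschitz`), so solutions exist, are unique, and continue as long as ρ stays between such
constants. Pointwise solutions are exactly curves in this space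
(`IsLagrangianSolution.exists_isFlow`).

Breakdown: let P(t,r) = ∫_0^r p(γ)/ρ |z₀| and Q(t,r) = ∫_r^∞ q(γ)/ρ |z₀|. In ∂_t (q(γ)/ρ) the P
terms cancel and the Wronskian leaves Q/(γ^(n-1) ρ) = S(γ) Q q(γ)/ρ ≥ n Q q(γ)/ρ. Integration
against |z₀| yields the Riccati inequality ∂_t Q(t,0) ≥ (n/2) Q(t,0)², and Q(0,0) > 0, so lifetimes
are bounded (`IsFlow.lifetime_le`).

Place of breakdown: at the origin ρ_t = -Q ρ, so ρ(t,0) decreases. Suppose it stayed above some c >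
0. Then γ/r would be bounded below near the origin (`IsFlow.mul_exp_le_pos`), and far particles
would move by at most one unit, because the initial velocity vanishes at infinity
(`IsFlow.exists_deviation_le`). Monotonicity of p(γ)/ρ and a bound on the strain would then confine
ρ between positive constants (`IsFlow.exists_admissible_of_le_jac_zero`), and the solution could be
continued. Hence ρ(t,0) → 0 at the maximal time, with r₀ = 0. -/

noncomputable section

namespace RadialEPDiff

/-! ### The functions α_p as hypergeometric series. -/

/-- Coefficients of the hypergeometric series `₀F₁(b; y)`. -/
def hypCoeff (b : ℝ) (m : ℕ) : ℝ := Real.Gamma b / ((m.factorial : ℝ) * Real.Gamma ((m : ℝ) + b))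

/-- The hypergeometric function `₀F₁(b; y)`. -/
def hyp (b y : ℝ) : ℝ := ∑' m : ℕ, y ^ m * hypCoeff b m

lemma hypCoeff_zero {b : ℝ} (hb : 1 ≤ b) : hypCoeff b 0 = 1 := by
  have := (Real.Gamma_pos_of_pos (by linarith : 0 < b)).ne'
  simp [hypCoeff, this]

lemma hypCoeff_succ {b : ℝ} (hb : 1 ≤ b) (m : ℕ) :
    hypCoeff b (m + 1) = hypCoeff b m / ((m + 1) * (m + b)) := by
  have h0 : 0 < (m : ℝ) + b := by positivity
  have h1 := (Real.Gamma_pos_of_pos h0).ne'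
  have h2 : Real.Gamma (((m + 1 : ℕ) : ℝ) + b) = (m + b) * Real.Gamma (m + b) := by
    rw [← Real.Gamma_add_one h0.ne']; congr 1; push_cast; ring
  have h3 : ((m.factorial : ℕ) : ℝ) ≠ 0 := by positivity
  rw [hypCoeff, h2, hypCoeff, Nat.factorial_succ]
  push_cast
  have : (m : ℝ) + 1 ≠ 0 := by positivity
  field_simp

lemma hypCoeff_pos {b : ℝ} (hb : 1 ≤ b) (m : ℕ) : 0 < hypCoeff b m := by
  have h0 : 0 < (m : ℝ) + b := by positivity
  have h1 := Real.Gamma_pos_of_pos h0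
  have h2 := Real.Gamma_pos_of_pos (by linarith : 0 < b)
  unfold hypCoeff; positivity

lemma hypCoeff_le {b : ℝ} (hb : 1 ≤ b) (m : ℕ) : hypCoeff b m ≤ 1 / (m.factorial : ℝ) := by
  induction m with
  | zero => simp [hypCoeff_zero hb]
  | succ m ih =>
    rw [hypCoeff_succ hb, Nat.factorial_succ]
    have h1 : (1 : ℝ) ≤ m + b := by have : (0 : ℝ) ≤ m := by positivity
                                    linarith
    have h0 := hypCoeff_pos hb m
    push_cast
    rw [div_le_div_iff₀ (by positivity) (by positivity)]
    rw [le_div_iff₀ (by positivity)] at ih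
    have : hypCoeff b m * ((m + 1) * m.factorial) = (m + 1) * (hypCoeff b m * m.factorial) := by ring
    rw [this, one_mul]
    have : (m + 1 : ℝ) * (hypCoeff b m * m.factorial) ≤ (m + 1) * 1 := by gcongr
    have h3 : (0 : ℝ) ≤ m := by positivity
    nlinarith

/-- Both sides equal Γ(b) / (m! Γ(m+b+1)). This is why the termwise derivative of the series with
parameter b is the series with parameter b + 1, divided by b. -/
lemma hypCoeff_shift {b : ℝ} (hb : 1 ≤ b) (m : ℕ) :
    hypCoeff b m / (m + b) = hypCoeff (b + 1) m / b := by
  have h0 : 0 < (m : ℝ) + b := by positivity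
  have hb0 : b ≠ 0 := by linarith
  have h1 := (Real.Gamma_pos_of_pos h0).ne'
  have h2 : Real.Gamma ((m : ℝ) + (b + 1)) = (m + b) * Real.Gamma (m + b) := by
    rw [← Real.Gamma_add_one h0.ne']; congr 1; ring
  have h3 : ((m.factorial : ℕ) : ℝ) ≠ 0 := by positivity
  rw [hypCoeff, hypCoeff, h2, Real.Gamma_add_one hb0]
  field_simp

lemma summable_hyp {b : ℝ} (hb : 1 ≤ b) (y : ℝ) : Summable fun m : ℕ => y ^ m * hypCoeff b m := by
  refine Summable.of_norm_bounded (Real.summable_pow_div_factorial |y|) fun m => ?_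
  rw [norm_mul, norm_pow, Real.norm_eq_abs, Real.norm_eq_abs, abs_of_pos (hypCoeff_pos hb m),
    div_eq_mul_one_div]
  gcongr
  exact hypCoeff_le hb m

lemma hasDerivAt_hyp {b : ℝ} (hb : 1 ≤ b) (y : ℝ) :
    HasDerivAt (hyp b) (hyp (b + 1) y / b) y := by
  set R : ℝ := |y| + 1 with hR
  have hR0 : 0 < R := by positivity
  -- Since the coefficients are at most 1/m!, this series dominates the termwise derivatives on |x|
  -- < R = |y| + 1.
  have hu : Summable fun m : ℕ => (m : ℝ) * R ^ (m - 1) * (1 / (m.factorial : ℝ)) := by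
    rw [← summable_nat_add_iff 1]
    refine (Real.summable_pow_div_factorial R).congr fun m => ?_
    simp only [Nat.add_sub_cancel, Nat.factorial_succ]
    push_cast
    have h3 : ((m.factorial : ℕ) : ℝ) ≠ 0 := by positivity
    field_simp
  have key := hasDerivAt_tsum_of_isPreconnected (𝕜 := ℝ) (F := ℝ) hu (t := Ioo (-R) R)
    (g := fun m y => y ^ m * hypCoeff b m) (g' := fun m y => m * y ^ (m - 1) * hypCoeff b m)
    (y₀ := 0) (y := y) isOpen_Ioo isPreconnected_Ioo
    (fun m x _ => by simpa using (hasDerivAt_pow m x).mul_const (hypCoeff b m))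
    (fun m x hx => by
      have hx' : |x| ≤ R := (abs_lt.2 hx).le
      rw [norm_mul, norm_mul, norm_pow, Real.norm_eq_abs, Real.norm_eq_abs, Real.norm_eq_abs,
        abs_of_pos (hypCoeff_pos hb m), Nat.abs_cast]
      have h0 := (hypCoeff_pos hb m).le
      have h1 := hypCoeff_le hb m
      gcongr)
    ⟨by linarith, hR0⟩ (summable_hyp hb 0)
    (by rw [mem_Ioo, ← abs_lt]; linarith)
  have hval : ∑' m : ℕ, (m : ℝ) * y ^ (m - 1) * hypCoeff b m = hyp (b + 1) y / b := by
    have hs : Summable fun m : ℕ => ((m + 1 : ℕ) : ℝ) * y ^ (m + 1 - 1) * hypCoeff b (m + 1) := by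
      refine ((summable_hyp (by linarith : 1 ≤ b + 1) y).div_const b).congr fun m => ?_
      rw [mul_div_assoc, ← hypCoeff_shift hb, hypCoeff_succ hb]
      have : (m : ℝ) + 1 ≠ 0 := by positivity
      have h0 : (m : ℝ) + b ≠ 0 := by positivity
      rw [Nat.add_sub_cancel]
      push_cast
      field_simp
    rw [Summable.tsum_eq_zero_add ((summable_nat_add_iff
      (f := fun m : ℕ => (m : ℝ) * y ^ (m - 1) * hypCoeff b m) 1).1 hs)]
    rw [hyp, ← tsum_div_const]
    simp only [Nat.cast_zero, zero_mul, zero_add]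
    refine tsum_congr fun m => ?_
    rw [mul_div_assoc, ← hypCoeff_shift hb, hypCoeff_succ hb]
    have : (m : ℝ) + 1 ≠ 0 := by positivity
    have h0 : (m : ℝ) + b ≠ 0 := by positivity
    rw [Nat.add_sub_cancel]
    push_cast
    field_simp
  rw [hval] at key
  exact key

/-- In view of `hasDerivAt_hyp` this is the differential equation f = b f' + y f'' of f = ₀F₁(b; ·),
written without derivatives. -/
lemma hyp_contiguous {b : ℝ} (hb : 1 ≤ b) (y : ℝ) :
    hyp b y = hyp (b + 1) y + y * hyp (b + 2) y / (b * (b + 1)) := by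
  have hb1 : 1 ≤ b + 1 := by linarith
  have hb2 : 1 ≤ b + 2 := by linarith
  have hb0 : b ≠ 0 := by linarith
  have hb10 : b + 1 ≠ 0 := by linarith
  rw [hyp, Summable.tsum_eq_zero_add (summable_hyp hb y)]
  rw [hyp, Summable.tsum_eq_zero_add (summable_hyp hb1 y), hyp, hypCoeff_zero hb,
    hypCoeff_zero hb1, add_assoc]
  congr 1
  rw [← tsum_mul_left, ← tsum_div_const, ← Summable.tsum_add]
  · refine tsum_congr fun m => ?_
    have h0 : (m : ℝ) + b ≠ 0 := by positivity
    have h1 : (m : ℝ) + (b + 1) ≠ 0 := by positivity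
    have h2 : (m : ℝ) + 1 ≠ 0 := by positivity
    have e1 := hypCoeff_shift hb m
    have e2 := hypCoeff_shift hb1 m
    rw [show b + 1 + 1 = b + 2 by ring] at e2
    rw [div_eq_div_iff h0 hb0] at e1
    rw [div_eq_div_iff h1 hb10] at e2
    have e1' : hypCoeff b m = hypCoeff (b + 1) m * (m + b) / b := by
      rw [eq_div_iff hb0]; exact e1
    have e2' : hypCoeff (b + 2) m = hypCoeff (b + 1) m * (b + 1) / (m + (b + 1)) := by
      rw [eq_div_iff h1]; linarith
    rw [hypCoeff_succ hb, hypCoeff_succ hb1, e1', e2', pow_succ]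
    field_simp
    ring
  · exact (summable_nat_add_iff (f := fun m : ℕ => y ^ m * hypCoeff (b + 1) m) 1).2
      (summable_hyp hb1 y)
  · exact ((summable_hyp hb2 y).mul_left y).div_const _

lemma one_le_hyp {b y : ℝ} (hb : 1 ≤ b) (hy : 0 ≤ y) : 1 ≤ hyp b y := by
  have := (summable_hyp hb y).le_tsum 0 fun m _ => by
    have := (hypCoeff_pos hb m).le
    positivity
  simpa [hypCoeff_zero hb, hyp] using this

lemma hyp_zero {b : ℝ} (hb : 1 ≤ b) : hyp b 0 = 1 := by
  rw [hyp, Summable.tsum_eq_zero_add (summable_hyp hb 0)]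
  simp [hypCoeff_zero hb]

/-- The factor r^(-p/2) cancels the fractional power in the Bessel series, leaving a power series in
r²/4. It also covers the separately defined value at 0. -/
lemma alpha_eq_hyp {p r : ℝ} (hp : 0 ≤ p) (hr : 0 ≤ r) :
    alpha p r = hyp (p / 2 + 1) (r ^ 2 / 4) := by
  have hb : 1 ≤ p / 2 + 1 := by linarith
  rcases hr.eq_or_lt with rfl | hr
  · simp [alpha, hyp_zero hb]
  rw [alpha, if_neg hr.ne', besselI, hyp, ← tsum_mul_left]
  refine tsum_congr fun m => ?_
  have h2 : (0 : ℝ) < r / 2 := by positivity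
  rw [hypCoeff, besselConst, Real.rpow_add h2, Real.div_rpow hr.le (by norm_num) (p / 2),
    Real.rpow_neg hr.le, Real.rpow_mul h2.le, Real.rpow_natCast, add_assoc]
  have h3 := (Real.rpow_pos_of_pos hr (p / 2)).ne'
  have h4 := (Real.rpow_pos_of_pos (by norm_num : (0 : ℝ) < 2) (p / 2)).ne'
  have h5 : ((r / 2) ^ (2 : ℝ)) = r ^ 2 / 4 := by
    rw [Real.rpow_two]; ring
  rw [h5]
  field_simp

lemma hasDerivAt_alpha {p r : ℝ} (hp : 0 ≤ p) (hr : 0 < r) :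
    HasDerivAt (alpha p) (r * alpha (p + 2) r / (p + 2)) r := by
  have hb : 1 ≤ p / 2 + 1 := by linarith
  have h1 : HasDerivAt (fun r : ℝ => r ^ 2 / 4) (r / 2) r :=
    ((hasDerivAt_pow 2 r).div_const 4).congr_deriv (by push_cast; ring)
  have h2 := (hasDerivAt_hyp hb (r ^ 2 / 4)).comp r h1
  rw [alpha_eq_hyp (by linarith) hr.le, show (p + 2) / 2 + 1 = p / 2 + 1 + 1 by ring]
  have h3 : HasDerivAt (alpha p) (hyp (p / 2 + 1 + 1) (r ^ 2 / 4) / (p / 2 + 1) * (r / 2)) r := by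
    refine h2.congr_of_eventuallyEq ?_
    filter_upwards [lt_mem_nhds hr] with x hx
    exact alpha_eq_hyp hp hx.le
  convert h3 using 1
  have : p + 2 ≠ 0 := by linarith
  have : p / 2 + 1 ≠ 0 := by linarith
  field_simp

lemma continuousOn_alpha {p : ℝ} (hp : 0 ≤ p) : ContinuousOn (alpha p) (Ici 0) := by
  have hb : 1 ≤ p / 2 + 1 := by linarith
  have : Continuous (hyp (p / 2 + 1)) := by
    rw [continuous_iff_continuousAt]
    exact fun y => (hasDerivAt_hyp hb y).continuousAt
  exact (this.comp (by fun_prop : Continuous fun r : ℝ => r ^ 2 / 4)).continuousOn.congr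
    fun r hr => alpha_eq_hyp hp hr

lemma one_le_alpha {p r : ℝ} (hp : 0 ≤ p) (hr : 0 ≤ r) : 1 ≤ alpha p r := by
  rw [alpha_eq_hyp hp hr]; exact one_le_hyp (by linarith) (by positivity)

lemma alpha_zero (p : ℝ) : alpha p 0 = 1 := by simp [alpha]

lemma alpha_contiguous {p r : ℝ} (hp : 0 ≤ p) (hr : 0 ≤ r) :
    alpha p r = alpha (p + 2) r + r ^ 2 * alpha (p + 4) r / ((p + 2) * (p + 4)) := by
  rw [alpha_eq_hyp hp hr, alpha_eq_hyp (by linarith) hr, alpha_eq_hyp (by linarith) hr,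
    hyp_contiguous (by linarith), show (p + 2) / 2 + 1 = p / 2 + 1 + 1 by ring,
    show (p + 4) / 2 + 1 = p / 2 + 1 + 2 by ring]
  have : p + 2 ≠ 0 := by linarith
  have : p + 4 ≠ 0 := by linarith
  have : p / 2 + 1 ≠ 0 := by linarith
  have : p / 2 + 1 + 1 ≠ 0 := by linarith
  field_simp
  ring

end RadialEPDiff
end

/-! ### The functions β_p through an integral representation of K. -/

noncomputable section

namespace RadialEPDiff

/-- `∫_ℝ exp(-e^t - (r²/4) e^{-t} + μ t) dt`, which is `2 (r/2)^μ K_μ(r)` for `r > 0`. -/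
def besselM (μ r : ℝ) : ℝ :=
  ∫ t : ℝ, Real.exp (-Real.exp t - r ^ 2 / 4 * Real.exp (-t) + μ * t)

/-- The substitution x = e^t turns the case k = 1 into the Gamma integral; a translation of t by log
k absorbs a general k. -/
lemma integrable_exp_neg_exp {k μ : ℝ} (hk : 0 < k) (hμ : 0 < μ) :
    Integrable fun t : ℝ => Real.exp (-(k * Real.exp t) + μ * t) := by
  have h1 : IntegrableOn (fun x : ℝ => Real.exp (-x) * x ^ (μ - 1)) (Real.exp '' univ) := by
    rw [image_univ, Real.range_exp]
    exact Real.GammaIntegral_convergent hμ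
  rw [integrableOn_image_iff_integrableOn_abs_deriv_smul MeasurableSet.univ
    (fun x _ => (Real.hasDerivAt_exp x).hasDerivWithinAt) Real.exp_injective.injOn,
    integrableOn_univ] at h1
  have h2 : Integrable fun t : ℝ => Real.exp (-Real.exp t + μ * t) := by
    refine h1.congr (Eventually.of_forall fun t => ?_)
    simp only [smul_eq_mul, abs_of_pos (Real.exp_pos t)]
    rw [← Real.exp_mul, ← Real.exp_add, ← Real.exp_add]
    congr 1; ring
  have h3 := (h2.comp_add_right (Real.log k)).mul_const (Real.exp (-(μ * Real.log k)))
  refine h3.congr (Eventually.of_forall fun t => ?_)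
  simp only
  rw [← Real.exp_add, Real.exp_add t, Real.exp_log hk]
  congr 1; ring

lemma integral_exp_neg_exp {μ : ℝ} (hμ : 0 < μ) :
    ∫ t : ℝ, Real.exp (-Real.exp t + μ * t) = Real.Gamma μ := by
  rw [Real.Gamma_eq_integral hμ, ← Real.range_exp, ← image_univ,
    integral_image_eq_integral_abs_deriv_smul MeasurableSet.univ
      (fun x _ => (Real.hasDerivAt_exp x).hasDerivWithinAt) Real.exp_injective.injOn,
    setIntegral_univ]
  refine integral_congr_ae (Eventually.of_forall fun t => ?_)
  simp only [smul_eq_mul, abs_of_pos (Real.exp_pos t)]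
  rw [← Real.exp_mul, ← Real.exp_add, ← Real.exp_add]
  congr 1; ring

lemma integrable_besselM (μ : ℝ) {r : ℝ} (hr : 0 < r) :
    Integrable fun t : ℝ => Real.exp (-Real.exp t - r ^ 2 / 4 * Real.exp (-t) + μ * t) := by
  set c := r ^ 2 / 4 with hc
  have hc0 : 0 < c := by positivity
  have h1 : Integrable fun t : ℝ => Real.exp (-(1 * Real.exp t) + (|μ| + 1) * t) :=
    integrable_exp_neg_exp one_pos (by positivity)
  have h2 : Integrable fun t : ℝ => Real.exp (-(c * Real.exp t) + (|μ| + 1) * t) :=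
    integrable_exp_neg_exp hc0 (by positivity)
  have h3 := h1.add h2.comp_neg
  refine h3.mono' (by fun_prop) (Eventually.of_forall fun t => ?_)
  rw [Real.norm_eq_abs, Real.abs_exp]
  simp only [Pi.add_apply]
  rcases le_total 0 t with ht | ht
  · refine le_trans (Real.exp_le_exp.2 ?_) (le_add_of_nonneg_right (Real.exp_pos _).le)
    have := mul_pos hc0 (Real.exp_pos (-t))
    nlinarith [le_abs_self μ]
  · refine le_trans (Real.exp_le_exp.2 ?_) (le_add_of_nonneg_left (Real.exp_pos _).le)
    have := Real.exp_pos t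
    nlinarith [neg_abs_le μ]

lemma besselM_pos (μ : ℝ) {r : ℝ} (hr : 0 < r) : 0 < besselM μ r :=
  integral_exp_pos (integrable_besselM μ hr)

/-- Differentiation in r brings down -(r/2) e^(-t), which lowers the index by one. -/
lemma hasDerivAt_besselM (μ : ℝ) {r : ℝ} (hr : 0 < r) :
    HasDerivAt (besselM μ) (-(r / 2) * besselM (μ - 1) r) r := by
  have hs : Ioo (r / 2) (2 * r) ∈ 𝓝 r := Ioo_mem_nhds (by linarith) (by linarith)
  have key := hasDerivAt_integral_of_dominated_loc_of_deriv_le (μ := volume) (𝕜 := ℝ)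
    (F := fun x t : ℝ => Real.exp (-Real.exp t - x ^ 2 / 4 * Real.exp (-t) + μ * t))
    (F' := fun x t : ℝ => -(x / 2) *
      Real.exp (-Real.exp t - x ^ 2 / 4 * Real.exp (-t) + (μ - 1) * t))
    (bound := fun t : ℝ => r *
      Real.exp (-Real.exp t - (r / 2) ^ 2 / 4 * Real.exp (-t) + (μ - 1) * t))
    hs (Eventually.of_forall fun x => by fun_prop) (integrable_besselM μ hr) (by fun_prop)
    (Eventually.of_forall fun t x hx => ?_) ((integrable_besselM (μ - 1) (by linarith)).const_mul r)
    (Eventually.of_forall fun t x hx => ?_)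
  · have := key.2
    rw [integral_const_mul] at this
    exact this
  · have hx0 : 0 < x := by linarith [hx.1]
    rw [norm_mul, Real.norm_eq_abs, Real.norm_eq_abs, Real.abs_exp, abs_neg,
      abs_of_pos (by linarith : 0 < x / 2)]
    have : (r / 2) ^ 2 ≤ x ^ 2 := by gcongr; exact hx.1.le
    gcongr
    linarith [hx.2]
  · have h1 : HasDerivAt (fun x : ℝ => -Real.exp t - x ^ 2 / 4 * Real.exp (-t) + μ * t)
        (-(x / 2) * Real.exp (-t)) x := by
      have := ((((hasDerivAt_pow 2 x).div_const 4).mul_const (Real.exp (-t))).const_sub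
        (-Real.exp t)).add_const (μ * t)
      exact this.congr_deriv (by push_cast; ring)
    refine h1.exp.congr_deriv ?_
    rw [mul_left_comm, ← Real.exp_add]
    congr 2; ring

/-- The t-derivative of the integrand is integrable over ℝ and has integral zero; its three terms
are the three members of the recurrence. -/
lemma besselM_recurrence (μ : ℝ) {r : ℝ} (hr : 0 < r) :
    besselM (μ + 1) r = r ^ 2 / 4 * besselM (μ - 1) r + μ * besselM μ r := by
  have e : ∀ t : ℝ, Real.exp (-Real.exp t - r ^ 2 / 4 * Real.exp (-t) + μ * t) *
      (-Real.exp t + r ^ 2 / 4 * Real.exp (-t) + μ) =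
      -Real.exp (-Real.exp t - r ^ 2 / 4 * Real.exp (-t) + (μ + 1) * t)
      + r ^ 2 / 4 * Real.exp (-Real.exp t - r ^ 2 / 4 * Real.exp (-t) + (μ - 1) * t)
      + μ * Real.exp (-Real.exp t - r ^ 2 / 4 * Real.exp (-t) + μ * t) := by
    intro t
    rw [show (μ + 1) * t = μ * t + t by ring, show (μ - 1) * t = μ * t + -t by ring,
      ← add_assoc, ← add_assoc, Real.exp_add _ t, Real.exp_add _ (-t)]
    ring
  have hi := ((integrable_besselM (μ + 1) hr).neg.add
    ((integrable_besselM (μ - 1) hr).const_mul (r ^ 2 / 4))).add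
    ((integrable_besselM μ hr).const_mul μ)
  have h0 := integral_eq_zero_of_hasDerivAt_of_integrable
    (f := fun t : ℝ => Real.exp (-Real.exp t - r ^ 2 / 4 * Real.exp (-t) + μ * t))
    (f' := fun t : ℝ => Real.exp (-Real.exp t - r ^ 2 / 4 * Real.exp (-t) + μ * t) *
      (-Real.exp t + r ^ 2 / 4 * Real.exp (-t) + μ))
    (fun t => by
      refine HasDerivAt.exp ?_
      have := ((Real.hasDerivAt_exp t).neg.sub
        (((hasDerivAt_neg t).exp).const_mul (r ^ 2 / 4))).add ((hasDerivAt_id t).const_mul μ)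
      exact this.congr_deriv (by ring))
    (hi.congr (Eventually.of_forall fun t => (e t).symm))
    (integrable_besselM μ hr)
  simp only [e] at h0
  rw [integral_add, integral_add, integral_neg, integral_const_mul, integral_const_mul] at h0
  · simp only [besselM]; linarith
  · exact (integrable_besselM (μ + 1) hr).neg
  · exact (integrable_besselM (μ - 1) hr).const_mul (r ^ 2 / 4)
  · exact (integrable_besselM (μ + 1) hr).neg.add
      ((integrable_besselM (μ - 1) hr).const_mul (r ^ 2 / 4))
  · exact (integrable_besselM μ hr).const_mul μ

/-- Translating t by log(r/2) symmetrises e^t + (r²/4) e^(-t) into r cosh t. -/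
lemma besselM_eq_integral_cosh (μ : ℝ) {r : ℝ} (hr : 0 < r) :
    besselM μ r = (r / 2) ^ μ * ∫ t : ℝ, Real.exp (-r * Real.cosh t + μ * t) := by
  have h2 : 0 < r / 2 := by positivity
  rw [besselM, ← integral_add_right_eq_self _ (Real.log (r / 2)), ← integral_const_mul]
  refine integral_congr_ae (Eventually.of_forall fun t => ?_)
  simp only
  rw [Real.rpow_def_of_pos h2, ← Real.exp_add, neg_add, Real.exp_add t, Real.exp_add (-t),
    Real.exp_neg (Real.log _), Real.exp_log h2, Real.cosh_eq]
  congr 1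
  field_simp
  ring

lemma integrable_exp_cosh (μ : ℝ) {r : ℝ} (hr : 0 < r) :
    Integrable fun t : ℝ => Real.exp (-r * Real.cosh t + μ * t) := by
  by_contra h
  -- Without integrability the Bochner integral on the right would be 0 by convention, against the
  -- positivity of `besselM`.
  have h1 := besselM_pos μ hr
  rw [besselM_eq_integral_cosh μ hr, integral_undef h, mul_zero] at h1
  exact lt_irrefl _ h1

lemma integral_exp_cosh_neg (μ r : ℝ) :
    ∫ t : ℝ, Real.exp (-r * Real.cosh t + -μ * t) = ∫ t : ℝ, Real.exp (-r * Real.cosh t + μ * t) := by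
  rw [← integral_neg_eq_self]
  simp

lemma integral_exp_cosh_eq_besselK (μ : ℝ) {r : ℝ} (hr : 0 < r) :
    ∫ t : ℝ, Real.exp (-r * Real.cosh t + μ * t) = 2 * besselK μ r := by
  have h1 := integrable_exp_cosh μ hr
  have h2 : Integrable fun t : ℝ => Real.exp (-r * Real.cosh t + -μ * t) :=
    integrable_exp_cosh (-μ) hr
  rw [← integral_add_compl measurableSet_Ioi h1 (s := Ioi 0), compl_Ioi]
  have h3 := integral_comp_neg_Ioi 0 fun t : ℝ => Real.exp (-r * Real.cosh t + μ * t)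
  rw [neg_zero] at h3
  rw [← h3]
  simp only [Real.cosh_neg]
  have h4 : ∀ t : ℝ, Real.exp (-r * Real.cosh t + μ * -t) = Real.exp (-r * Real.cosh t + -μ * t) :=
    fun t => by ring_nf
  simp only [h4]
  rw [← integral_add h1.integrableOn h2.integrableOn, besselK, ← integral_const_mul]
  refine integral_congr_ae (Eventually.of_forall fun t => ?_)
  simp only
  rw [Real.cosh_eq (μ * t), Real.exp_add, Real.exp_add]
  ring_nf

lemma integrableOn_besselK (μ : ℝ) {r : ℝ} (hr : 0 < r) :
    IntegrableOn (fun t => Real.exp (-r * Real.cosh t) * Real.cosh (μ * t)) (Ioi 0) := by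
  have h := ((integrable_exp_cosh μ hr).add (integrable_exp_cosh (-μ) hr)).div_const 2
  refine (h.congr (Eventually.of_forall fun t => ?_)).integrableOn
  simp only [Pi.add_apply]
  rw [Real.cosh_eq (μ * t), Real.exp_add, Real.exp_add]
  ring_nf

lemma besselK_le_besselK {μ ν r : ℝ} (hr : 0 < r) (h : |μ| ≤ |ν|) : besselK μ r ≤ besselK ν r := by
  refine setIntegral_mono_on (integrableOn_besselK μ hr) (integrableOn_besselK ν hr)
    measurableSet_Ioi fun t ht => ?_
  refine mul_le_mul_of_nonneg_left (Real.cosh_le_cosh.2 ?_) (Real.exp_pos _).le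
  rw [abs_mul, abs_mul]
  gcongr

/-- As K is even in its index, β_p has two representations. This one, of negative index, suits
differentiation; that of positive index in `rpow_mul_beta_eq_besselM` suits size estimates, being
bounded up to the origin. -/
lemma beta_eq_besselM {p r : ℝ} (hr : 0 < r) :
    beta p r = (besselConst p)⁻¹ * (2 ^ (-(p / 2) - 1)) * besselM (-(p / 2)) r := by
  have h := integral_exp_cosh_eq_besselK (p / 2) hr
  rw [← integral_exp_cosh_neg] at h
  rw [besselM_eq_integral_cosh _ hr, h, beta, Real.div_rpow hr.le (by norm_num),
    Real.rpow_sub (by norm_num), Real.rpow_one]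
  have := (Real.rpow_pos_of_pos (by norm_num : (0 : ℝ) < 2) (-(p / 2))).ne'
  field_simp

lemma rpow_mul_beta_eq_besselM {p r : ℝ} (hr : 0 < r) :
    r ^ p * beta p r = (besselConst p)⁻¹ * (2 ^ (p / 2 - 1)) * besselM (p / 2) r := by
  have h := integral_exp_cosh_eq_besselK (p / 2) hr
  rw [besselM_eq_integral_cosh _ hr, h, beta, Real.div_rpow hr.le (by norm_num),
    Real.rpow_sub (by norm_num), Real.rpow_one]
  have h1 := (Real.rpow_pos_of_pos (by norm_num : (0 : ℝ) < 2) (p / 2)).ne'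
  have h2 : r ^ p = r ^ (p / 2) * r ^ (p / 2) := by rw [← Real.rpow_add hr]; congr 1; ring
  have h3 := (Real.rpow_pos_of_pos hr (p / 2)).ne'
  rw [h2, Real.rpow_neg hr.le]
  field_simp

lemma besselConst_pos {p : ℝ} (hp : 0 ≤ p) : 0 < besselConst p :=
  mul_pos (Real.rpow_pos_of_pos (by norm_num) _) (Real.Gamma_pos_of_pos (by linarith))

lemma besselConst_add_two {p : ℝ} (hp : 0 ≤ p) : besselConst (p + 2) = (p + 2) * besselConst p := by
  rw [besselConst, besselConst, show (p + 2) / 2 = p / 2 + 1 by ring,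
    Real.rpow_add (by norm_num), Real.rpow_one, Real.Gamma_add_one (by linarith : p / 2 + 1 ≠ 0)]
  ring

lemma beta_pos {p r : ℝ} (hp : 0 ≤ p) (hr : 0 < r) : 0 < beta p r := by
  rw [beta_eq_besselM hr]
  have := besselConst_pos hp
  have := besselM_pos (-(p / 2)) hr
  positivity

lemma hasDerivAt_beta {p r : ℝ} (hp : 0 ≤ p) (hr : 0 < r) :
    HasDerivAt (beta p) (-((p + 2) * r * beta (p + 2) r)) r := by
  have h := (hasDerivAt_besselM (-(p / 2)) hr).const_mul
    ((besselConst p)⁻¹ * (2 ^ (-(p / 2) - 1)))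
  have h2 : HasDerivAt (beta p) _ r := h.congr_of_eventuallyEq <| by
    filter_upwards [lt_mem_nhds hr] with x hx using beta_eq_besselM hx
  convert h2 using 1
  rw [beta_eq_besselM hr, besselConst_add_two hp, show -((p + 2) / 2) = -(p / 2) - 1 by ring,
    Real.rpow_sub (by norm_num) (-(p / 2) - 1), Real.rpow_one]
  have := (besselConst_pos hp).ne'
  have : p + 2 ≠ 0 := by linarith
  field_simp

lemma beta_contiguous {p r : ℝ} (hp : 0 ≤ p) (hr : 0 < r) :
    beta p r = (p + 2) * (p + 4) * r ^ 2 * beta (p + 4) r - (p + 2) ^ 2 * beta (p + 2) r := by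
  have h := besselM_recurrence (-(p / 2) - 1) hr
  rw [show -(p / 2) - 1 + 1 = -(p / 2) by ring] at h
  rw [beta_eq_besselM hr, beta_eq_besselM hr, beta_eq_besselM hr,
    show p + 4 = p + 2 + 2 by ring, besselConst_add_two (by linarith), besselConst_add_two hp,
    show -((p + 2 + 2) / 2) = -(p / 2) - 1 - 1 by ring,
    show -((p + 2) / 2) = -(p / 2) - 1 by ring, h,
    Real.rpow_sub (by norm_num) (-(p / 2) - 1 - 1), Real.rpow_sub (by norm_num) (-(p / 2) - 1),
    Real.rpow_one]
  have := (besselConst_pos hp).ne'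
  have : p + 2 ≠ 0 := by linarith
  have : p + 2 + 2 ≠ 0 := by linarith
  field_simp
  ring

/-- The middle quantity is -β_p'. The recurrence at index -p/2 writes it as (p/r) β_p plus a
positive multiple of K_{1-p/2}, and K_{1-p/2} ≤ K_{p/2} because |1 - p/2| ≤ p/2. This last
inequality is where p ≥ 1 enters. -/
lemma beta_deriv_bounds {p r : ℝ} (hp : 1 ≤ p) (hr : 0 < r) :
    p / r * beta p r ≤ (p + 2) * r * beta (p + 2) r ∧
      (p + 2) * r * beta (p + 2) r ≤ (1 + p / r) * beta p r := by
  have hp0 : 0 ≤ p := by linarith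
  have h := besselM_recurrence (-(p / 2)) hr
  have hK1 := integral_exp_cosh_eq_besselK (-(p / 2) + 1) hr
  have hK2 := integral_exp_cosh_eq_besselK (p / 2) hr
  rw [← integral_exp_cosh_neg] at hK2
  have hle : besselK (-(p / 2) + 1) r ≤ besselK (p / 2) r := by
    refine besselK_le_besselK hr ?_
    rw [abs_of_nonneg (by linarith : 0 ≤ p / 2), abs_le]
    constructor <;> linarith
  have hm1 : besselM (-(p / 2) + 1) r = (r / 2) ^ (-(p / 2)) * (r * besselK (-(p / 2) + 1) r) := by
    rw [besselM_eq_integral_cosh _ hr, hK1, Real.rpow_add (by positivity), Real.rpow_one]; ring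
  have hm2 : besselM (-(p / 2)) r = (r / 2) ^ (-(p / 2)) * (2 * besselK (p / 2) r) := by
    rw [besselM_eq_integral_cosh _ hr, hK2]
  have hx := Real.rpow_pos_of_pos (by positivity : 0 < r / 2) (-(p / 2))
  have hc := besselConst_pos hp0
  have hcc : 0 < (besselConst p)⁻¹ * (2 : ℝ) ^ (-(p / 2) - 1) := by positivity
  have e : (p + 2) * r * beta (p + 2) r =
      (besselConst p)⁻¹ * (2 ^ (-(p / 2) - 1)) * (r / 2 * besselM (-(p / 2) - 1) r) := by
    rw [beta_eq_besselM hr, besselConst_add_two hp0, show -((p + 2) / 2) = -(p / 2) - 1 by ring,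
      Real.rpow_sub (by norm_num) (-(p / 2) - 1), Real.rpow_one]
    have : p + 2 ≠ 0 := by linarith
    field_simp
  have hM : r / 2 * besselM (-(p / 2) - 1) r =
      2 / r * besselM (-(p / 2) + 1) r + p / r * besselM (-(p / 2)) r := by
    rw [h]; field_simp; ring
  have h1 : 0 < besselM (-(p / 2) + 1) r := besselM_pos _ hr
  have h2 : 2 / r * besselM (-(p / 2) + 1) r ≤ besselM (-(p / 2)) r := by
    rw [hm1, hm2]
    have : 2 / r * ((r / 2) ^ (-(p / 2)) * (r * besselK (-(p / 2) + 1) r)) =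
      (r / 2) ^ (-(p / 2)) * (2 * besselK (-(p / 2) + 1) r) := by field_simp
    rw [this]
    gcongr
  rw [e, hM, beta_eq_besselM hr]
  constructor
  · rw [mul_left_comm]
    have : 0 < 2 / r * besselM (-(p / 2) + 1) r := by positivity
    gcongr
    linarith
  · rw [mul_left_comm]
    gcongr
    linarith

lemma besselM_le_Gamma {μ : ℝ} (hμ : 0 < μ) {r : ℝ} (hr : 0 < r) :
    besselM μ r ≤ Real.Gamma μ := by
  rw [← integral_exp_neg_exp hμ]
  refine integral_mono (integrable_besselM μ hr)
    (by simpa using integrable_exp_neg_exp one_pos hμ) fun t => ?_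
  simp only
  have : 0 < r ^ 2 / 4 * Real.exp (-t) := by positivity
  gcongr
  linarith

lemma tendsto_besselM_zero {μ : ℝ} (hμ : 0 < μ) :
    Tendsto (besselM μ) (𝓝[>] 0) (𝓝 (Real.Gamma μ)) := by
  rw [← integral_exp_neg_exp hμ]
  refine tendsto_integral_filter_of_dominated_convergence
    (fun t => Real.exp (-Real.exp t + μ * t)) (Eventually.of_forall fun r => by fun_prop)
    (Eventually.of_forall fun r => Eventually.of_forall fun t => ?_)
    (by simpa using integrable_exp_neg_exp one_pos hμ) (Eventually.of_forall fun t => ?_)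
  · rw [Real.norm_eq_abs, Real.abs_exp]
    have : 0 ≤ r ^ 2 / 4 * Real.exp (-t) := by positivity
    gcongr
    linarith
  · have : Continuous fun r : ℝ => Real.exp (-Real.exp t - r ^ 2 / 4 * Real.exp (-t) + μ * t) := by
      fun_prop
    have := this.tendsto 0
    simp only [ne_eq, OfNat.ofNat_ne_zero, not_false_eq_true, zero_pow, zero_div, zero_mul,
      sub_zero] at this
    exact this.mono_left nhdsWithin_le_nhds

lemma besselM_le_exp {μ : ℝ} (hμ : 0 < μ) :
    ∃ C : ℝ, 0 < C ∧ ∀ r : ℝ, 0 < r → besselM μ r ≤ C * Real.exp (-r / 2) := by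
  have hi := integrable_exp_neg_exp (by norm_num : (0 : ℝ) < 1 / 2) hμ
  refine ⟨∫ t : ℝ, Real.exp (-(1 / 2 * Real.exp t) + μ * t), integral_exp_pos hi, fun r hr => ?_⟩
  rw [← integral_mul_const]
  refine integral_mono (integrable_besselM μ hr) (hi.mul_const _) fun t => ?_
  simp only
  rw [← Real.exp_add, Real.exp_le_exp]
  have h1 : Real.exp t * Real.exp (-t) = 1 := by rw [← Real.exp_add]; simp
  have h2 := Real.exp_pos t
  have h3 := Real.exp_pos (-t)
  -- By the arithmetic-geometric mean inequality. Half of the exponent yields the decay e^(-r/2),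
  -- the other half keeps the integral finite.
  have h4 : r ≤ Real.exp t + r ^ 2 / 4 * Real.exp (-t) := by
    have : Real.exp t + r ^ 2 / 4 * Real.exp (-t) - r
        = Real.exp (-t) * (Real.exp t - r / 2) ^ 2 := by
      have : Real.exp (-t) * (Real.exp t - r / 2) ^ 2 = (Real.exp t * Real.exp (-t)) * Real.exp t
        - (Real.exp t * Real.exp (-t)) * r + r ^ 2 / 4 * Real.exp (-t) := by ring
      rw [this, h1]; ring
    have : 0 ≤ Real.exp (-t) * (Real.exp t - r / 2) ^ 2 := by positivity
    linarith
  have h5 : 0 < r ^ 2 / 4 * Real.exp (-t) := by positivity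
  linarith

lemma besselConst_inv_mul {p : ℝ} (hp : 0 < p) :
    (besselConst p)⁻¹ * (2 ^ (p / 2 - 1)) * Real.Gamma (p / 2) = 1 / p := by
  rw [besselConst, Real.Gamma_add_one (by positivity), Real.rpow_sub (by norm_num), Real.rpow_one]
  have h1 := (Real.rpow_pos_of_pos (by norm_num : (0 : ℝ) < 2) (p / 2)).ne'
  have h2 := (Real.Gamma_pos_of_pos (by positivity : 0 < p / 2)).ne'
  field_simp

/-- Dropping the term (r²/4) e^(-t) from the exponent leaves a Gamma integral. The constant is
sharp, being the limit at 0, and becomes the lower bound n for S. -/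
lemma rpow_mul_beta_le {p r : ℝ} (hp : 0 < p) (hr : 0 < r) : r ^ p * beta p r ≤ 1 / p := by
  rw [rpow_mul_beta_eq_besselM hr, ← besselConst_inv_mul hp]
  have := besselConst_pos hp.le
  gcongr
  exact besselM_le_Gamma (by positivity) hr

lemma tendsto_rpow_mul_beta {p : ℝ} (hp : 0 < p) :
    Tendsto (fun r => r ^ p * beta p r) (𝓝[>] 0) (𝓝 (1 / p)) := by
  rw [← besselConst_inv_mul hp]
  refine ((tendsto_besselM_zero (by positivity : 0 < p / 2)).const_mul _).congr' ?_
  filter_upwards [self_mem_nhdsWithin] with r hr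
  rw [rpow_mul_beta_eq_besselM hr]

lemma rpow_mul_beta_le_exp {p : ℝ} (hp : 0 < p) :
    ∃ C : ℝ, 0 < C ∧ ∀ r : ℝ, 0 < r → r ^ p * beta p r ≤ C * Real.exp (-r / 2) := by
  obtain ⟨C, hC, h⟩ := besselM_le_exp (by positivity : 0 < p / 2)
  have := besselConst_pos hp.le
  refine ⟨(besselConst p)⁻¹ * (2 ^ (p / 2 - 1)) * C, by positivity, fun r hr => ?_⟩
  rw [rpow_mul_beta_eq_besselM hr, mul_assoc _ C]
  gcongr
  exact h r hr

end RadialEPDiff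
end

/-! ### The homogeneous solutions p and q: Wronskian and growth. -/

noncomputable section

namespace RadialEPDiff

/-- The solution `x α_n(x)` of `u = Δu` that is regular at the origin. -/
def kerP (n : ℕ) (x : ℝ) : ℝ := x * alpha n x

/-- The derivative of `kerP`. -/
def kerP' (n : ℕ) (x : ℝ) : ℝ := alpha n x + x * (x * alpha (n + 2) x / (n + 2))

/-- The solution `x β_n(x)` of `u = Δu` that decays at infinity. -/
def kerQ (n : ℕ) (x : ℝ) : ℝ := x * beta n x

/-- The derivative of `kerQ`. -/
def kerQ' (n : ℕ) (x : ℝ) : ℝ := beta n x - x * ((n + 2) * x * beta (n + 2) x)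

/-- The second derivative of a solution `u` of `u = Δu` in terms of `u` and `u'`. -/
def kerSecond (n : ℕ) (u u' x : ℝ) : ℝ := (1 + (n - 1) / x ^ 2) * u - (n - 1) / x * u'

variable {n : ℕ}

lemma hasDerivAt_kerP {x : ℝ} (hx : 0 < x) : HasDerivAt (kerP n) (kerP' n x) x := by
  have := (hasDerivAt_id x).mul (hasDerivAt_alpha (Nat.cast_nonneg n) hx)
  exact this.congr_deriv (by simp [kerP'])

lemma hasDerivAt_kerQ {x : ℝ} (hx : 0 < x) : HasDerivAt (kerQ n) (kerQ' n x) x := by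
  have := (hasDerivAt_id x).mul (hasDerivAt_beta (Nat.cast_nonneg n) hx)
  exact this.congr_deriv (by simp [kerQ']; ring)

lemma hasDerivAt_kerP' {x : ℝ} (hx : 0 < x) :
    HasDerivAt (kerP' n) (kerSecond n (kerP n x) (kerP' n x) x) x := by
  have hn : (0 : ℝ) ≤ n := Nat.cast_nonneg n
  have h1 := hasDerivAt_alpha hn hx
  have h2 := hasDerivAt_alpha (by linarith : (0 : ℝ) ≤ n + 2) hx
  have h3 := h1.add ((hasDerivAt_id x).mul (((hasDerivAt_id x).mul h2).div_const ((n : ℝ) + 2)))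
  refine h3.congr_deriv ?_
  have e := alpha_contiguous hn hx.le
  rw [kerSecond, kerP, kerP', e, show (n : ℝ) + 2 + 2 = n + 4 by ring]
  have : (n : ℝ) + 2 ≠ 0 := by positivity
  have : (n : ℝ) + 4 ≠ 0 := by positivity
  simp only [Pi.mul_apply, id]
  field_simp
  ring

lemma hasDerivAt_kerQ' {x : ℝ} (hx : 0 < x) :
    HasDerivAt (kerQ' n) (kerSecond n (kerQ n x) (kerQ' n x) x) x := by
  have hn : (0 : ℝ) ≤ n := Nat.cast_nonneg n
  have h1 := hasDerivAt_beta hn hx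
  have h2 := hasDerivAt_beta (by linarith : (0 : ℝ) ≤ n + 2) hx
  have h3 := h1.sub ((hasDerivAt_id x).mul (((hasDerivAt_id x).const_mul ((n : ℝ) + 2)).mul h2))
  refine h3.congr_deriv ?_
  have e := beta_contiguous hn hx
  rw [kerSecond, kerQ, kerQ', e, show (n : ℝ) + 2 + 2 = n + 4 by ring]
  simp only [Pi.mul_apply, id]
  field_simp
  ring

lemma continuousOn_kerP : ContinuousOn (kerP n) (Ici 0) :=
  continuousOn_id.mul (continuousOn_alpha (Nat.cast_nonneg n))

lemma continuousOn_kerP' : ContinuousOn (kerP' n) (Ici 0) :=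
  (continuousOn_alpha (Nat.cast_nonneg n)).add (continuousOn_id.mul
    ((continuousOn_id.mul (continuousOn_alpha (by positivity))).div_const _))

lemma continuousOn_kerQ : ContinuousOn (kerQ n) (Ioi 0) :=
  fun _ hx => (hasDerivAt_kerQ hx).continuousAt.continuousWithinAt

lemma kerP_zero : kerP n 0 = 0 := by simp [kerP]

lemma kerP'_zero : kerP' n 0 = 1 := by simp [kerP', alpha_zero]

lemma kerP_pos {x : ℝ} (hx : 0 < x) : 0 < kerP n x := by
  have := one_le_alpha (Nat.cast_nonneg n) hx.le
  unfold kerP; positivity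

lemma kerQ_pos {x : ℝ} (hx : 0 < x) : 0 < kerQ n x :=
  mul_pos hx (beta_pos (Nat.cast_nonneg n) hx)

/-- The quantity is x^(n+1) (α' β - α β'). The contiguous relations make its derivative vanish, so
it is constant, and its value is read off at the origin: the first term tends to 0, and (n+2)
x^(n+2) β_{n+2} tends to 1. -/
lemma alpha_wronskian {x : ℝ} (hn : 1 ≤ n) (hx : 0 < x) :
    x ^ (n + 1) * (x * alpha (n + 2) x / (n + 2) * beta n x +
      alpha n x * ((n + 2) * x * beta (n + 2) x)) = 1 := by
  have hn0 : (0 : ℝ) ≤ n := Nat.cast_nonneg n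
  have hn1 : (0 : ℝ) < n := by exact_mod_cast hn
  set W : ℝ → ℝ := fun x => x ^ (n + 1) * (x * alpha (n + 2) x / (n + 2) * beta n x +
      alpha n x * ((n + 2) * x * beta (n + 2) x)) with hW
  have hd : ∀ y ∈ Ioi (0 : ℝ), HasDerivAt W 0 y := by
    intro y hy
    have hy : 0 < y := hy
    have a0 := hasDerivAt_alpha hn0 hy
    have a1 := hasDerivAt_alpha (by linarith : (0 : ℝ) ≤ n + 2) hy
    have b0 := hasDerivAt_beta hn0 hy
    have b1 := hasDerivAt_beta (by linarith : (0 : ℝ) ≤ n + 2) hy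
    have h := (hasDerivAt_pow (n + 1) y).mul
      (((((hasDerivAt_id y).mul a1).div_const ((n : ℝ) + 2)).mul b0).add
        (a0.mul (((hasDerivAt_id y).const_mul ((n : ℝ) + 2)).mul b1)))
    refine h.congr_deriv ?_
    have ea := alpha_contiguous hn0 hy.le
    have eb := beta_contiguous hn0 hy
    rw [ea, eb, show (n : ℝ) + 2 + 2 = n + 4 by ring]
    have : (n : ℝ) + 2 ≠ 0 := by positivity
    have : (n : ℝ) + 4 ≠ 0 := by positivity
    simp only [id, Nat.add_sub_cancel, pow_succ]
    push_cast
    simp only [Pi.add_apply, Pi.mul_apply, id]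
    rw [ea, eb]
    field_simp
    ring
  have hconst : ∀ y ∈ Ioi (0 : ℝ), W y = W x := fun y hy =>
    (convex_Ioi (0 : ℝ)).is_const_of_fderivWithin_eq_zero
      (fun z hz => (hd z hz).differentiableAt.differentiableWithinAt)
      (fun z hz => by
        have := (hd z hz).hasFDerivAt.hasFDerivWithinAt (s := Ioi 0)
        rw [this.fderivWithin (isOpen_Ioi.uniqueDiffWithinAt hz)]
        ext; simp) hy hx
  have hlim : Tendsto W (𝓝[>] 0) (𝓝 1) := by
    have t1 := tendsto_rpow_mul_beta hn1
    have t2 := tendsto_rpow_mul_beta (by linarith : (0 : ℝ) < n + 2)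
    have ta : ∀ p : ℝ, 0 ≤ p → Tendsto (alpha p) (𝓝[>] 0) (𝓝 1) := fun p hp => by
      have := (continuousOn_alpha hp 0 self_mem_Ici).tendsto
      rw [alpha_zero] at this
      exact this.mono_left (nhdsWithin_mono _ Ioi_subset_Ici_self)
    have ti : Tendsto (fun x : ℝ => x) (𝓝[>] 0) (𝓝 0) := nhdsWithin_le_nhds
    have h := (((ti.mul ti).mul (ta (n + 2) (by linarith))).div_const ((n : ℝ) + 2)).mul t1
    have h' := ((ta n hn0).mul t2).const_mul ((n : ℝ) + 2)
    have h'' := h.add h'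
    have e : (0 * 0 * 1 / ((n : ℝ) + 2) * (1 / n) + (n + 2) * (1 * (1 / ((n : ℝ) + 2)))) = 1 := by
      field_simp
      ring
    rw [e] at h''
    refine h''.congr' ?_
    filter_upwards [self_mem_nhdsWithin] with y hy
    have hy : 0 < y := hy
    have e2 : y ^ ((n : ℝ) + 2) = y ^ n * y ^ 2 := by
      rw [Real.rpow_add hy, Real.rpow_natCast, Real.rpow_two]
    rw [e2, Real.rpow_natCast]
    simp only [hW]
    ring
  have hlim2 : Tendsto W (𝓝[>] 0) (𝓝 (W x)) := by
    refine tendsto_const_nhds.congr' ?_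
    filter_upwards [self_mem_nhdsWithin] with y hy using (hconst y hy).symm
  exact tendsto_nhds_unique hlim2 hlim

/-- With p = xα and q = xβ the terms αβ of the product rule cancel, which leaves `alpha_wronskian`.
-/
lemma kernel_wronskian {x : ℝ} (hn : 1 ≤ n) (hx : 0 < x) :
    x ^ (n - 1) * (kerP' n x * kerQ n x - kerP n x * kerQ' n x) = 1 := by
  rw [← alpha_wronskian hn hx, kerP', kerQ, kerP, kerQ']
  obtain ⟨m, rfl⟩ : ∃ m, n = m + 1 := ⟨n - 1, by omega⟩
  simp only [Nat.add_sub_cancel]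
  ring

/-- The left side is α'. The equation α'' = α - ((n+1)/x) α' makes the derivative of α² - α'² equal
to 2 (n+1) α'²/x ≥ 0, and α² - α'² = 1 at the origin. -/
lemma alpha_deriv_le {x : ℝ} (hx : 0 ≤ x) : x * alpha (n + 2) x / (n + 2) ≤ alpha n x := by
  have hn0 : (0 : ℝ) ≤ n := Nat.cast_nonneg n
  have hn2 : (0 : ℝ) ≤ n + 2 := by linarith
  have hmono : MonotoneOn (fun x => alpha n x ^ 2 - (x * alpha (n + 2) x / (n + 2)) ^ 2)
      (Ici 0) := by
    have hd : ∀ y ∈ interior (Ici (0 : ℝ)), HasDerivAt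
        (fun x => alpha n x ^ 2 - (x * alpha (n + 2) x / (n + 2)) ^ 2)
        (2 * (n + 1) / y * (y * alpha (n + 2) y / (n + 2)) ^ 2) y := by
      intro y hy
      rw [interior_Ici] at hy
      have hy : 0 < y := hy
      have a0 := hasDerivAt_alpha hn0 hy
      have a1 := hasDerivAt_alpha hn2 hy
      have h := (a0.pow 2).sub ((((hasDerivAt_id y).mul a1).div_const ((n : ℝ) + 2)).pow 2)
      refine h.congr_deriv ?_
      have ea := alpha_contiguous hn0 hy.le
      rw [show (n : ℝ) + 2 + 2 = n + 4 by ring]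
      have : (n : ℝ) + 2 ≠ 0 := by positivity
      have : (n : ℝ) + 4 ≠ 0 := by positivity
      push_cast
      simp only [Pi.mul_apply, id]
      rw [ea]
      field_simp
      ring
    refine monotoneOn_of_deriv_nonneg (convex_Ici 0)
      (((continuousOn_alpha hn0).pow 2).sub
        (((continuousOn_id.mul (continuousOn_alpha hn2)).div_const _).pow 2))
      (fun y hy => (hd y hy).differentiableAt.differentiableWithinAt) fun y hy => ?_
    rw [(hd y hy).deriv]
    rw [interior_Ici] at hy
    have hy : 0 < y := hy
    positivity
  have h := hmono self_mem_Ici (mem_Ici.2 hx) hx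
  simp only [alpha_zero, zero_mul, zero_div] at h
  have h1 := one_le_alpha hn0 hx
  have h2 := one_le_alpha hn2 hx
  refine abs_le_of_sq_le_sq' (a := x * alpha (n + 2) x / (n + 2)) ?_ (by linarith) |>.2
  linarith

lemma alpha_deriv_nonneg {x : ℝ} (hx : 0 ≤ x) : 0 ≤ x * alpha (n + 2) x / (n + 2) := by
  have := one_le_alpha (by positivity : (0 : ℝ) ≤ n + 2) hx
  positivity

lemma kerP_le_mul_kerP' {x : ℝ} (hx : 0 ≤ x) : kerP n x ≤ x * kerP' n x := by
  have := alpha_deriv_nonneg (n := n) hx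
  unfold kerP kerP'
  gcongr
  nlinarith

lemma one_le_kerP' {x : ℝ} (hx : 0 ≤ x) : 1 ≤ kerP' n x := by
  have := alpha_deriv_nonneg (n := n) hx
  have := one_le_alpha (Nat.cast_nonneg n) hx
  unfold kerP'
  nlinarith

lemma kerP'_le {x : ℝ} (hx : 0 < x) : kerP' n x ≤ (1 + 1 / x) * kerP n x := by
  have h := alpha_deriv_le (n := n) hx.le
  have e : (1 + 1 / x) * kerP n x = alpha n x + x * alpha n x := by
    unfold kerP; field_simp; ring
  rw [e, kerP']
  gcongr

lemma kerQ'_nonpos {x : ℝ} (hn : 1 ≤ n) (hx : 0 < x) : kerQ' n x ≤ 0 := by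
  have hn1 : (1 : ℝ) ≤ n := by exact_mod_cast hn
  have h := (beta_deriv_bounds hn1 hx).1
  have hb := beta_pos (Nat.cast_nonneg n) hx
  have h2 : x * (n / x * beta n x) ≤ x * ((n + 2) * x * beta (n + 2) x) := by gcongr
  have e : x * (n / x * beta n x) = n * beta n x := by field_simp
  unfold kerQ'
  nlinarith

lemma neg_kerQ'_le {x : ℝ} (hn : 1 ≤ n) (hx : 0 < x) : -kerQ' n x ≤ (1 + n / x) * kerQ n x := by
  have hn1 : (1 : ℝ) ≤ n := by exact_mod_cast hn
  have h := (beta_deriv_bounds hn1 hx).2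
  have hb := beta_pos (Nat.cast_nonneg n) hx
  have h2 : x * ((n + 2) * x * beta (n + 2) x) ≤ x * ((1 + n / x) * beta n x) := by gcongr
  have e : (1 + n / x) * kerQ n x = x * ((1 + n / x) * beta n x) := by unfold kerQ; ring
  unfold kerQ'
  linarith

lemma pow_mul_kerQ {x : ℝ} (hn : 1 ≤ n) : x ^ (n - 1) * kerQ n x = x ^ n * beta n x := by
  obtain ⟨m, rfl⟩ : ∃ m, n = m + 1 := ⟨n - 1, by omega⟩
  simp only [Nat.add_sub_cancel, kerQ]
  ring

lemma pow_mul_beta_le {x : ℝ} (hn : 1 ≤ n) (hx : 0 < x) : x ^ n * beta n x ≤ 1 / n := by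
  have := rpow_mul_beta_le (by exact_mod_cast hn : (0 : ℝ) < n) hx
  rwa [Real.rpow_natCast] at this

lemma exists_pow_mul_kerQ_le_exp (hn : 1 ≤ n) :
    ∃ C : ℝ, 0 < C ∧ ∀ x : ℝ, 0 < x → x ^ (n - 1) * kerQ n x ≤ C * Real.exp (-x / 2) := by
  obtain ⟨C, hC, h⟩ := rpow_mul_beta_le_exp (by exact_mod_cast hn : (0 : ℝ) < n)
  refine ⟨C, hC, fun x hx => ?_⟩
  rw [pow_mul_kerQ hn]
  have := h x hx
  rwa [Real.rpow_natCast] at this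

lemma alpha_monotoneOn : MonotoneOn (alpha n) (Ici 0) := by
  have hn0 : (0 : ℝ) ≤ n := Nat.cast_nonneg n
  refine monotoneOn_of_deriv_nonneg (convex_Ici 0) (continuousOn_alpha hn0) ?_ ?_
  · rw [interior_Ici]
    exact fun y hy => (hasDerivAt_alpha hn0 hy).differentiableAt.differentiableWithinAt
  · rw [interior_Ici]
    intro y hy
    rw [(hasDerivAt_alpha hn0 hy).deriv]
    exact alpha_deriv_nonneg (le_of_lt hy)

/-- Since α' ≤ α, the function α(x) e^(-x) is nonincreasing. -/
lemma alpha_le_mul_exp {x s : ℝ} (hs : 0 ≤ s) (h : s ≤ x) :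
    alpha n x ≤ alpha n s * Real.exp (x - s) := by
  have hn0 : (0 : ℝ) ≤ n := Nat.cast_nonneg n
  have hanti : AntitoneOn (fun x => alpha n x * Real.exp (-x)) (Ici 0) := by
    have hd : ∀ y ∈ interior (Ici (0 : ℝ)), HasDerivAt (fun x => alpha n x * Real.exp (-x))
        ((y * alpha (n + 2) y / (n + 2) - alpha n y) * Real.exp (-y)) y := by
      intro y hy
      rw [interior_Ici] at hy
      exact ((hasDerivAt_alpha hn0 hy).mul (hasDerivAt_neg y).exp).congr_deriv (by ring)
    refine antitoneOn_of_deriv_nonpos (convex_Ici 0)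
      ((continuousOn_alpha hn0).mul (by fun_prop))
      (fun y hy => (hd y hy).differentiableAt.differentiableWithinAt) fun y hy => ?_
    rw [(hd y hy).deriv]
    rw [interior_Ici] at hy
    have := alpha_deriv_le (n := n) (le_of_lt hy)
    have := Real.exp_pos (-y)
    nlinarith
  have h1 : alpha n x * Real.exp (-x) ≤ alpha n s * Real.exp (-s) :=
    hanti (mem_Ici.2 hs) (mem_Ici.2 (hs.trans h)) h
  have h2 : alpha n x = alpha n x * Real.exp (-x) * Real.exp x := by
    rw [mul_assoc, ← Real.exp_add]; simp
  rw [h2, sub_eq_neg_add, Real.exp_add, ← mul_assoc]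
  gcongr

lemma kerP_monotoneOn : MonotoneOn (kerP n) (Ici 0) := fun x hx y hy h => by
  have := one_le_alpha (Nat.cast_nonneg n) (mem_Ici.1 hx)
  exact mul_le_mul h (alpha_monotoneOn hx hy h) (by linarith) hy

lemma kerQ_antitoneOn (hn : 1 ≤ n) : AntitoneOn (kerQ n) (Ioi 0) := by
  refine antitoneOn_of_deriv_nonpos (convex_Ioi 0) continuousOn_kerQ ?_ ?_
  · rw [interior_Ioi]
    exact fun y hy => (hasDerivAt_kerQ hy).differentiableAt.differentiableWithinAt
  · rw [interior_Ioi]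
    intro y hy
    rw [(hasDerivAt_kerQ hy).deriv]
    exact kerQ'_nonpos hn hy

/-- The bound -q' ≤ (1 + n/x) q says that x^n e^x q(x) is nondecreasing. -/
lemma kerQ_le_mul_exp {x s : ℝ} (hn : 1 ≤ n) (hx : 0 < x) (h : x ≤ s) :
    kerQ n x ≤ kerQ n s * ((s / x) ^ n * Real.exp (s - x)) := by
  have hmono : MonotoneOn (fun x => x ^ n * Real.exp x * kerQ n x) (Ioi 0) := by
    have hd : ∀ y ∈ Ioi (0 : ℝ), HasDerivAt (fun x => x ^ n * Real.exp x * kerQ n x)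
        (y ^ n * Real.exp y * ((1 + n / y) * kerQ n y + kerQ' n y)) y := by
      intro y hy
      have hy : 0 < y := hy
      refine (((hasDerivAt_pow n y).mul (Real.hasDerivAt_exp y)).mul
        (hasDerivAt_kerQ hy)).congr_deriv ?_
      obtain ⟨m, rfl⟩ : ∃ m, n = m + 1 := ⟨n - 1, by omega⟩
      simp only [Nat.add_sub_cancel, Pi.mul_apply]
      field_simp
      ring
    refine monotoneOn_of_deriv_nonneg (convex_Ioi 0)
      (fun y hy => (hd y hy).continuousAt.continuousWithinAt)
      (fun y hy => (hd y (by simpa using hy)).differentiableAt.differentiableWithinAt)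
      fun y hy => ?_
    rw [interior_Ioi] at hy
    rw [(hd y hy).deriv]
    have hy : 0 < y := hy
    have := neg_kerQ'_le hn hy
    have h0 : 0 ≤ (1 + n / y) * kerQ n y + kerQ' n y := by linarith
    positivity
  have h1 : x ^ n * Real.exp x * kerQ n x ≤ s ^ n * Real.exp s * kerQ n s :=
    hmono hx (lt_of_lt_of_le hx h) h
  have hp : 0 < x ^ n * Real.exp x := by positivity
  rw [← le_div_iff₀' hp] at h1
  refine h1.trans_eq ?_
  rw [Real.exp_sub, div_pow]
  field_simp

lemma beta_antitoneOn : AntitoneOn (beta n) (Ioi 0) := by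
  have hn0 : (0 : ℝ) ≤ n := Nat.cast_nonneg n
  refine antitoneOn_of_deriv_nonpos (convex_Ioi 0)
    (fun y hy => (hasDerivAt_beta hn0 hy).continuousAt.continuousWithinAt) ?_ ?_
  · rw [interior_Ioi]
    exact fun y hy => (hasDerivAt_beta hn0 hy).differentiableAt.differentiableWithinAt
  · rw [interior_Ioi]
    intro y hy
    rw [(hasDerivAt_beta hn0 hy).deriv]
    have hy : 0 < y := hy
    have := beta_pos (by linarith : (0 : ℝ) ≤ n + 2) hy
    have : 0 < (n + 2) * y * beta (n + 2) y := by positivity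
    linarith

end RadialEPDiff
end

/-! ### Masses of the kernels and uniform bounds for the Green operator. -/

noncomputable section

namespace RadialEPDiff

lemma hasDerivAt_integral_Ioc {F : ℝ → ℝ} (hF : ContinuousOn F (Ioi 0))
    (hi : ∀ r, IntegrableOn F (Ioc 0 r)) {r : ℝ} (hr : 0 < r) :
    HasDerivAt (fun r => ∫ s in Ioc 0 r, F s) (F r) r := by
  have h : HasDerivAt (fun r => ∫ s in (0 : ℝ)..r, F s) (F r) r := by
    refine intervalIntegral.integral_hasDerivAt_right ?_ ?_ (hF.continuousAt (Ioi_mem_nhds hr))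
    · rw [intervalIntegrable_iff_integrableOn_Ioc_of_le hr.le]
      exact hi r
    · exact hF.stronglyMeasurableAtFilter isOpen_Ioi r hr
  refine h.congr_of_eventuallyEq ?_
  filter_upwards [lt_mem_nhds hr] with x hx
  rw [intervalIntegral.integral_of_le hx.le]

lemma integral_Ioi_eq_sub {F : ℝ → ℝ} (hi : IntegrableOn F (Ioi 0)) {r : ℝ} (hr : 0 ≤ r) :
    ∫ s in Ioi r, F s = (∫ s in Ioi 0, F s) - ∫ s in Ioc 0 r, F s := by
  rw [← Ioc_union_Ioi_eq_Ioi hr, setIntegral_union Ioc_disjoint_Ioi_same measurableSet_Ioi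
    (hi.mono_set Ioc_subset_Ioi_self) (hi.mono_set (Ioi_subset_Ioi hr))]
  ring

lemma hasDerivAt_integral_Ioi {F : ℝ → ℝ} (hF : ContinuousOn F (Ioi 0))
    (hi : IntegrableOn F (Ioi 0)) {r : ℝ} (hr : 0 < r) :
    HasDerivAt (fun r => ∫ s in Ioi r, F s) (-F r) r := by
  have h := (hasDerivAt_integral_Ioc hF (fun r => hi.mono_set Ioc_subset_Ioi_self) hr).const_sub
    (∫ s in Ioi 0, F s)
  refine h.congr_of_eventuallyEq ?_
  filter_upwards [lt_mem_nhds hr] with x hx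
  exact integral_Ioi_eq_sub hi hx.le

lemma continuousOn_integral_Ioc {F : ℝ → ℝ} (hi : ∀ r, IntegrableOn F (Ioc 0 r)) :
    ContinuousOn (fun r => ∫ s in Ioc 0 r, F s) (Ici 0) := by
  intro r hr
  have h := intervalIntegral.continuousOn_primitive
    ((integrableOn_Icc_iff_integrableOn_Ioc (by simp)).2 (hi (r + 1)))
  refine (h r ⟨hr, by linarith⟩).mono_of_mem_nhdsWithin ?_
  have : Iic (r + 1) ∈ 𝓝[Ici 0] r := mem_nhdsWithin_of_mem_nhds (Iic_mem_nhds (by linarith))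
  filter_upwards [this, self_mem_nhdsWithin] with x h1 h2 using ⟨h2, h1⟩

lemma continuousOn_integral_Ioi {F : ℝ → ℝ} (hi : IntegrableOn F (Ioi 0)) :
    ContinuousOn (fun r => ∫ s in Ioi r, F s) (Ici 0) :=
  (continuousOn_const.sub
    (continuousOn_integral_Ioc fun _ => hi.mono_set Ioc_subset_Ioi_self)).congr
    fun _ hr => integral_Ioi_eq_sub hi hr

lemma tendsto_integral_Ioi_atTop {F : ℝ → ℝ} (hi : IntegrableOn F (Ioi 0)) :
    Tendsto (fun r => ∫ s in Ioi r, F s) atTop (𝓝 0) := by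
  have h := intervalIntegral_tendsto_integral_Ioi 0 hi tendsto_id
  have h2 := h.const_sub (∫ s in Ioi 0, F s)
  rw [sub_self] at h2
  refine h2.congr' ?_
  filter_upwards [eventually_ge_atTop 0] with r hr
  rw [integral_Ioi_eq_sub hi hr, id, intervalIntegral.integral_of_le hr]

variable {n : ℕ}

/-- `∫₀^r p(s) s^{n-1} ds`. -/
def massP (n : ℕ) (r : ℝ) : ℝ := ∫ s in Ioc 0 r, kerP n s * s ^ (n - 1)

/-- `∫_r^∞ q(s) s^{n-1} ds`. -/
def massQ (n : ℕ) (r : ℝ) : ℝ := ∫ s in Ioi r, kerQ n s * s ^ (n - 1)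

lemma continuousOn_kerP_mul : ContinuousOn (fun s => kerP n s * s ^ (n - 1)) (Ici 0) :=
  continuousOn_kerP.mul (by fun_prop)

lemma integrableOn_Ioc_of_continuousOn {F : ℝ → ℝ} (hF : ContinuousOn F (Ici 0)) (r : ℝ) :
    IntegrableOn F (Ioc 0 r) :=
  ((hF.mono Icc_subset_Ici_self).integrableOn_Icc).mono_set Ioc_subset_Icc_self

lemma integrableOn_exp_neg_mul {a : ℝ} (ha : 0 < a) (C : ℝ) :
    IntegrableOn (fun s : ℝ => C * Real.exp (-a * s)) (Ioi 0) :=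
  (integrableOn_exp_mul_Ioi (by linarith : -a < 0) 0).const_mul C

lemma integrableOn_kerQ_mul (hn : 1 ≤ n) :
    IntegrableOn (fun s => kerQ n s * s ^ (n - 1)) (Ioi 0) := by
  obtain ⟨C, _, h⟩ := exists_pow_mul_kerQ_le_exp hn
  refine (integrableOn_exp_neg_mul (by norm_num : (0 : ℝ) < 1 / 2) C).mono'
    ((continuousOn_kerQ.mul (by fun_prop)).aestronglyMeasurable measurableSet_Ioi) ?_
  refine (ae_restrict_iff' measurableSet_Ioi).2 (Eventually.of_forall fun s hs => ?_)
  have hs : 0 < s := hs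
  have := kerQ_pos (n := n) hs
  rw [Real.norm_eq_abs, abs_of_pos (by positivity), mul_comm]
  refine (h s hs).trans_eq ?_
  congr 2; ring

lemma massP_nonneg (r : ℝ) : 0 ≤ massP n r :=
  setIntegral_nonneg measurableSet_Ioc fun s hs => by
    have := kerP_pos (n := n) hs.1
    have := hs.1
    positivity

lemma massQ_nonneg {r : ℝ} (hr : 0 ≤ r) : 0 ≤ massQ n r :=
  setIntegral_nonneg measurableSet_Ioi fun s hs => by
    have hs : 0 < s := lt_of_le_of_lt hr hs
    have := kerQ_pos (n := n) hs
    positivity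

lemma hasDerivAt_massP {r : ℝ} (hr : 0 < r) :
    HasDerivAt (massP n) (kerP n r * r ^ (n - 1)) r :=
  hasDerivAt_integral_Ioc (continuousOn_kerP_mul.mono Ioi_subset_Ici_self)
    (integrableOn_Ioc_of_continuousOn continuousOn_kerP_mul) hr

lemma hasDerivAt_massQ (hn : 1 ≤ n) {r : ℝ} (hr : 0 < r) :
    HasDerivAt (massQ n) (-(kerQ n r * r ^ (n - 1))) r :=
  hasDerivAt_integral_Ioi (continuousOn_kerQ.mul (by fun_prop)) (integrableOn_kerQ_mul hn) hr

lemma continuousOn_massP : ContinuousOn (massP n) (Ici 0) :=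
  continuousOn_integral_Ioc (integrableOn_Ioc_of_continuousOn continuousOn_kerP_mul)

lemma continuousOn_massQ (hn : 1 ≤ n) : ContinuousOn (massQ n) (Ici 0) :=
  continuousOn_integral_Ioi (integrableOn_kerQ_mul hn)

lemma tendsto_massQ (hn : 1 ≤ n) : Tendsto (massQ n) atTop (𝓝 0) :=
  tendsto_integral_Ioi_atTop (integrableOn_kerQ_mul hn)

/-- The self-adjoint form of the homogeneous equation. As (n-1)/x² ≥ 0, it bounds x^(n-1) u by an
exact derivative when u ≥ 0. -/
lemma hasDerivAt_pow_mul_of_kerSecond (hn : 1 ≤ n) {u u' : ℝ → ℝ} {x : ℝ} (hx : 0 < x)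
    (hu : HasDerivAt u' (kerSecond n (u x) (u' x) x) x) :
    HasDerivAt (fun x => x ^ (n - 1) * u' x) (x ^ (n - 1) * ((1 + (n - 1) / x ^ 2) * u x)) x := by
  refine ((hasDerivAt_pow (n - 1) x).mul hu).congr_deriv ?_
  obtain ⟨m, rfl⟩ : ∃ m, n = m + 1 := ⟨n - 1, by omega⟩
  simp only [Nat.add_sub_cancel, kerSecond]
  rcases m with _ | m
  · simp
  · simp only [Nat.add_sub_cancel]
    push_cast
    field_simp
    ring

/-- Integrate x^(n-1) p ≤ (x^(n-1) p')' from the origin. -/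
lemma massP_le (hn : 1 ≤ n) {r : ℝ} (hr : 0 ≤ r) : massP n r ≤ r ^ (n - 1) * kerP' n r := by
  have hn1 : (1 : ℝ) ≤ n := by exact_mod_cast hn
  have hd : ∀ y ∈ Ioi (0 : ℝ), HasDerivAt (fun x => x ^ (n - 1) * kerP' n x - massP n x)
      (y ^ (n - 1) * ((1 + (n - 1) / y ^ 2) * kerP n y) - kerP n y * y ^ (n - 1)) y :=
    fun y hy => (hasDerivAt_pow_mul_of_kerSecond hn hy (hasDerivAt_kerP' hy)).sub
      (hasDerivAt_massP hy)
  have hmono : MonotoneOn (fun x => x ^ (n - 1) * kerP' n x - massP n x) (Ici 0) := by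
    refine monotoneOn_of_deriv_nonneg (convex_Ici 0)
      ((ContinuousOn.mul (by fun_prop) continuousOn_kerP').sub continuousOn_massP)
      (fun y hy => (hd y (by simpa using hy)).differentiableAt.differentiableWithinAt)
      fun y hy => ?_
    rw [interior_Ici] at hy
    rw [(hd y hy).deriv]
    have hy : 0 < y := hy
    have := kerP_pos (n := n) hy
    have h0 : 0 ≤ ((n : ℝ) - 1) / y ^ 2 := div_nonneg (by linarith) (by positivity)
    have : 0 ≤ y ^ (n - 1) * kerP n y * (((n : ℝ) - 1) / y ^ 2) := by positivity
    linarith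
  have h := hmono self_mem_Ici (mem_Ici.2 hr) hr
  have h0 : massP n 0 = 0 := by simp [massP]
  simp only [h0, kerP'_zero] at h
  have : (0 : ℝ) ≤ 0 ^ (n - 1) := by positivity
  linarith

lemma tendsto_kerQ (hn : 1 ≤ n) : Tendsto (fun x => x ^ (n - 1) * kerQ n x) atTop (𝓝 0) := by
  obtain ⟨C, _, h⟩ := exists_pow_mul_kerQ_le_exp hn
  have h1 : Tendsto (fun x : ℝ => C * Real.exp (-x / 2)) atTop (𝓝 0) := by
    have : Tendsto (fun x : ℝ => -x / 2) atTop atBot := by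
      have h2 := (tendsto_id (α := ℝ) (x := atTop)).const_mul_atTop_of_neg
        (by norm_num : (-(1 / 2) : ℝ) < 0)
      refine h2.congr fun x => ?_
      simp only [id]; ring
    simpa using (Real.tendsto_exp_atBot.comp this).const_mul C
  refine tendsto_of_tendsto_of_tendsto_of_le_of_le' tendsto_const_nhds h1 ?_ ?_
  · filter_upwards [eventually_gt_atTop 0] with x hx
    have := kerQ_pos (n := n) hx
    positivity
  · filter_upwards [eventually_gt_atTop 0] with x hx using h x hx

/-- The same inequality for q, integrated to infinity, where the boundary term vanishes by
exponential decay. -/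
lemma massQ_le (hn : 1 ≤ n) {r : ℝ} (hr : 0 < r) : massQ n r ≤ -(r ^ (n - 1) * kerQ' n r) := by
  have hn1 : (1 : ℝ) ≤ n := by exact_mod_cast hn
  have hd : ∀ y ∈ Ioi (0 : ℝ), HasDerivAt (fun x => x ^ (n - 1) * kerQ' n x + massQ n x)
      (y ^ (n - 1) * ((1 + (n - 1) / y ^ 2) * kerQ n y) + -(kerQ n y * y ^ (n - 1))) y :=
    fun y hy => (hasDerivAt_pow_mul_of_kerSecond hn hy (hasDerivAt_kerQ' hy)).add
      (hasDerivAt_massQ hn hy)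
  have hmono : MonotoneOn (fun x => x ^ (n - 1) * kerQ' n x + massQ n x) (Ioi 0) := by
    refine monotoneOn_of_deriv_nonneg (convex_Ioi 0)
      (fun y hy => (hd y hy).continuousAt.continuousWithinAt)
      (fun y hy => (hd y (by simpa using hy)).differentiableAt.differentiableWithinAt)
      fun y hy => ?_
    rw [interior_Ioi] at hy
    rw [(hd y hy).deriv]
    have hy : 0 < y := hy
    have := kerQ_pos (n := n) hy
    have h0 : 0 ≤ ((n : ℝ) - 1) / y ^ 2 := div_nonneg (by linarith) (by positivity)
    have : 0 ≤ y ^ (n - 1) * kerQ n y * (((n : ℝ) - 1) / y ^ 2) := by positivity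
    linarith
  have hl : Tendsto (fun x => x ^ (n - 1) * kerQ' n x) atTop (𝓝 0) := by
    have h1 := (tendsto_kerQ hn).const_mul (-(1 + n : ℝ))
    rw [mul_zero] at h1
    refine tendsto_of_tendsto_of_tendsto_of_le_of_le' h1 tendsto_const_nhds ?_ ?_
    · filter_upwards [eventually_ge_atTop 1] with x hx
      have hx0 : 0 < x := by linarith
      have h2 := neg_kerQ'_le hn hx0
      have hq := kerQ_pos (n := n) hx0
      have h3 : (n : ℝ) / x ≤ n := div_le_self (by positivity) hx
      have h4 : (1 + n / x) * kerQ n x ≤ (1 + n) * kerQ n x := by gcongr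
      have h5 : x ^ (n - 1) * -kerQ' n x ≤ x ^ (n - 1) * ((1 + n) * kerQ n x) := by
        gcongr; linarith
      linarith
    · filter_upwards [eventually_gt_atTop 0] with x hx
      exact mul_nonpos_of_nonneg_of_nonpos (by positivity) (kerQ'_nonpos hn hx)
  have hl2 := hl.add (tendsto_massQ hn)
  rw [add_zero] at hl2
  have : r ^ (n - 1) * kerQ' n r + massQ n r ≤ 0 := by
    refine ge_of_tendsto hl2 ?_
    filter_upwards [eventually_ge_atTop r] with x hx
    exact hmono hr (lt_of_lt_of_le hr hx) hx
  linarith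

/-- The left side is the Green potential of the constant 1. The two mass bounds add up to the
Wronskian expression, whose value is 1. -/
lemma kernel_mass_le_one (hn : 1 ≤ n) {r : ℝ} (hr : 0 < r) :
    kerQ n r * massP n r + kerP n r * massQ n r ≤ 1 := by
  have h1 := massP_le hn hr.le
  have h2 := massQ_le hn hr
  have hq := kerQ_pos (n := n) hr
  have hp := kerP_pos (n := n) hr
  rw [← kernel_wronskian hn hr]
  have h3 : kerQ n r * massP n r ≤ kerQ n r * (r ^ (n - 1) * kerP' n r) := by gcongr
  have h4 : kerP n r * massQ n r ≤ kerP n r * -(r ^ (n - 1) * kerQ' n r) := by gcongr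
  linarith

lemma massQ_anti (hn : 1 ≤ n) {r s : ℝ} (hr : 0 ≤ r) (h : r ≤ s) : massQ n s ≤ massQ n r := by
  refine setIntegral_mono_set ((integrableOn_kerQ_mul hn).mono_set (Ioi_subset_Ioi hr)) ?_
    (Ioi_subset_Ioi h).eventuallyLE
  refine (ae_restrict_iff' measurableSet_Ioi).2 (Eventually.of_forall fun x hx => ?_)
  have hx : 0 < x := lt_of_le_of_lt hr hx
  have := kerQ_pos (n := n) hx
  simp only [Pi.zero_apply]
  positivity

/-- In the Wronskian identity, discard -p q' ≥ 0 and use p ≤ r p'. -/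
lemma pow_mul_kerP_mul_kerQ_le (hn : 1 ≤ n) {r : ℝ} (hr : 0 < r) :
    r ^ (n - 1) * (kerP n r * kerQ n r) ≤ r := by
  have h := kernel_wronskian hn hr
  have h1 := kerP_le_mul_kerP' (n := n) hr.le
  have h2 := kerQ'_nonpos hn hr
  have hq := kerQ_pos (n := n) hr
  have hp := kerP_pos (n := n) hr
  have h3 : kerP n r * kerQ n r ≤ r * (kerP' n r * kerQ n r - kerP n r * kerQ' n r) := by
    nlinarith [mul_nonneg (mul_nonneg hr.le hp.le) (neg_nonneg.2 h2)]
  calc r ^ (n - 1) * (kerP n r * kerQ n r)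
      ≤ r ^ (n - 1) * (r * (kerP' n r * kerQ n r - kerP n r * kerQ' n r)) := by gcongr
    _ = r * (r ^ (n - 1) * (kerP' n r * kerQ n r - kerP n r * kerQ' n r)) := by ring
    _ = r := by rw [h, mul_one]

lemma massP_le_mul {r : ℝ} (hr : 0 ≤ r) : massP n r ≤ r * (kerP n r * r ^ (n - 1)) := by
  have h : ∀ s ∈ Ioc 0 r, ‖kerP n s * s ^ (n - 1)‖ ≤ kerP n r * r ^ (n - 1) := fun s hs => by
    have h1 := kerP_pos (n := n) hs.1
    have h2 := kerP_monotoneOn (n := n) (mem_Ici.2 hs.1.le) (mem_Ici.2 hr) hs.2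
    have h3 := hs.1
    have h4 := hs.2
    rw [Real.norm_eq_abs, abs_of_pos (by positivity)]
    have h5 : 0 ≤ kerP n r := h1.le.trans h2
    gcongr
  have := norm_setIntegral_le_of_norm_le_const (μ := volume) measure_Ioc_lt_top h
  simp only [Measure.real, Real.volume_Ioc, sub_zero, ENNReal.toReal_ofReal hr] at this
  rw [massP, mul_comm]
  exact (le_abs_self _).trans this

lemma kerQ_mul_massP_le (hn : 1 ≤ n) {r : ℝ} (hr : 0 < r) : kerQ n r * massP n r ≤ r * r := by
  have hq := kerQ_pos (n := n) hr
  calc kerQ n r * massP n r ≤ kerQ n r * (r * (kerP n r * r ^ (n - 1))) := by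
        gcongr; exact massP_le_mul hr.le
    _ = r * (r ^ (n - 1) * (kerP n r * kerQ n r)) := by ring
    _ ≤ r * r := by gcongr; exact pow_mul_kerP_mul_kerQ_le hn hr

/-- A constant bounding `(1 + 1/r) (q(r) ∫₀^r p s^{n-1} + p(r) ∫_r^∞ q s^{n-1})`. -/
def massConst (n : ℕ) : ℝ := 2 + 2 * (alpha n 1 * massQ n 0)

lemma massConst_pos : 0 < massConst n := by
  have ha := one_le_alpha (Nat.cast_nonneg n) zero_le_one
  have hm := massQ_nonneg (n := n) le_rfl
  unfold massConst
  positivity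

/-- The weight 1 + 1/r is the price of differentiating p or q. For r ≥ 1 it is at most 2 and the
mass is at most 1; for r ≤ 1 the mass is O(r), which compensates 1/r. -/
lemma kernel_mass_le (hn : 1 ≤ n) {r : ℝ} (hr : 0 < r) :
    (1 + 1 / r) * (kerQ n r * massP n r + kerP n r * massQ n r) ≤ massConst n := by
  have ha := one_le_alpha (Nat.cast_nonneg n) zero_le_one
  have hm := massQ_nonneg (n := n) le_rfl
  have hq := kerQ_pos (n := n) hr
  have hp := kerP_pos (n := n) hr
  have hM := massP_nonneg (n := n) r
  have hM2 := massQ_nonneg (n := n) hr.le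
  have h5 : 0 ≤ alpha n 1 * massQ n 0 := by positivity
  unfold massConst
  rcases le_total 1 r with h | h
  · have h1 := kernel_mass_le_one hn hr
    have h2 : 1 / r ≤ 1 := by rw [div_le_one hr]; exact h
    have h3 : 0 ≤ kerQ n r * massP n r + kerP n r * massQ n r := by positivity
    nlinarith
  · have h1 := kerQ_mul_massP_le hn hr
    have h2 : kerP n r * massQ n r ≤ r * (alpha n 1 * massQ n 0) := by
      rw [kerP, mul_assoc]
      gcongr
      · exact alpha_monotoneOn (mem_Ici.2 hr.le) (mem_Ici.2 zero_le_one) h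
      · exact massQ_anti hn le_rfl hr.le
    have h3 : (1 + 1 / r) * (kerQ n r * massP n r + kerP n r * massQ n r) ≤
        (1 + 1 / r) * (r * r + r * (alpha n 1 * massQ n 0)) := by gcongr
    refine h3.trans ?_
    have h4 : (1 + 1 / r) * (r * r + r * (alpha n 1 * massQ n 0)) =
        (1 + r) * (r + alpha n 1 * massQ n 0) := by field_simp; ring
    rw [h4]
    nlinarith

lemma kernel_mass_le_mul (hn : 1 ≤ n) {r : ℝ} (hr : 0 < r) :
    kerQ n r * massP n r + kerP n r * massQ n r ≤ massConst n * r := by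
  have hq := kerQ_pos (n := n) hr
  have hp := kerP_pos (n := n) hr
  have hM := massP_nonneg (n := n) r
  have hM2 := massQ_nonneg (n := n) hr.le
  rw [← div_le_iff₀ hr]
  refine le_trans ?_ (kernel_mass_le hn hr)
  rw [div_eq_inv_mul, ← one_div]
  gcongr
  linarith

end RadialEPDiff
end

/-! ### The Green kernel, uniqueness, and the function S. -/

noncomputable section

namespace RadialEPDiff

variable {n : ℕ}

lemma delta_eq (r s : ℝ) : delta n r s = kerP n r * kerQ n s := by
  simp only [delta, phi, kerP, kerQ]; ring

/-- `∫₀^r p(s) s^{n-1} f(s) ds`. -/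
def potP (n : ℕ) (f : ℝ → ℝ) (r : ℝ) : ℝ := ∫ s in Ioc 0 r, kerP n s * (s ^ (n - 1) * f s)

/-- `∫_r^∞ q(s) s^{n-1} f(s) ds`. -/
def potQ (n : ℕ) (f : ℝ → ℝ) (r : ℝ) : ℝ := ∫ s in Ioi r, kerQ n s * (s ^ (n - 1) * f s)

lemma greenPotential_eq (f : ℝ → ℝ) (r : ℝ) :
    greenPotential n f r = kerQ n r * potP n f r + kerP n r * potQ n f r := by
  simp only [greenPotential, potP, potQ, delta_eq]
  rw [← integral_const_mul, ← integral_const_mul]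
  congr 1
  · refine integral_congr_ae (Eventually.of_forall fun s => ?_)
    simp only; ring
  · refine integral_congr_ae (Eventually.of_forall fun s => ?_)
    simp only; ring

lemma exists_bound_of_tendsto {f : ℝ → ℝ} (hf : ContinuousOn f (Ici 0))
    (h0 : Tendsto f atTop (𝓝 0)) : ∃ F : ℝ, 0 < F ∧ ∀ s, 0 ≤ s → |f s| ≤ F := by
  have h1 : ∀ᶠ s in atTop, |f s| < 1 := by
    have := h0.abs
    rw [abs_zero] at this
    exact this.eventually (gt_mem_nhds one_pos)
  obtain ⟨R, hR⟩ := eventually_atTop.1 h1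
  obtain ⟨C, hC⟩ := isCompact_Icc.exists_bound_of_continuousOn
    (hf.mono (Icc_subset_Ici_self : Icc 0 R ⊆ Ici 0))
  refine ⟨max C 1, by positivity, fun s hs => ?_⟩
  rcases le_total s R with h | h
  · exact (hC s ⟨hs, h⟩).trans (le_max_left _ _)
  · exact (hR s h).le.trans (le_max_right _ _)

lemma continuousOn_kerP_mul_weight {f : ℝ → ℝ} (hf : ContinuousOn f (Ici 0)) :
    ContinuousOn (fun s => kerP n s * (s ^ (n - 1) * f s)) (Ici 0) :=
  continuousOn_kerP.mul (ContinuousOn.mul (by fun_prop) hf)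

lemma continuousOn_kerQ_mul_weight {f : ℝ → ℝ} (hf : ContinuousOn f (Ici 0)) :
    ContinuousOn (fun s => kerQ n s * (s ^ (n - 1) * f s)) (Ioi 0) :=
  continuousOn_kerQ.mul (ContinuousOn.mul (by fun_prop) (hf.mono Ioi_subset_Ici_self))

lemma integrableOn_kerQ_mul_weight (hn : 1 ≤ n) {f : ℝ → ℝ} {F : ℝ} (hf : ContinuousOn f (Ici 0))
    (hF : ∀ s, 0 ≤ s → |f s| ≤ F) :
    IntegrableOn (fun s => kerQ n s * (s ^ (n - 1) * f s)) (Ioi 0) := by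
  refine ((integrableOn_kerQ_mul hn).mul_const F).mono'
    ((continuousOn_kerQ_mul_weight hf).aestronglyMeasurable measurableSet_Ioi) ?_
  refine (ae_restrict_iff' measurableSet_Ioi).2 (Eventually.of_forall fun s hs => ?_)
  have hs : 0 < s := hs
  have hq := kerQ_pos (n := n) hs
  rw [Real.norm_eq_abs, ← mul_assoc, abs_mul, abs_of_pos (by positivity)]
  gcongr
  exact hF s hs.le

lemma abs_potP_le {f : ℝ → ℝ} {F r : ℝ} (hF : ∀ s ∈ Ioc 0 r, |f s| ≤ F) :
    |potP n f r| ≤ F * massP n r := by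
  rw [potP, massP, ← integral_const_mul, ← Real.norm_eq_abs]
  refine norm_integral_le_of_norm_le
    ((integrableOn_Ioc_of_continuousOn continuousOn_kerP_mul r).const_mul F) ?_
  refine (ae_restrict_iff' measurableSet_Ioc).2 (Eventually.of_forall fun s hs => ?_)
  have h1 := kerP_pos (n := n) hs.1
  have h2 := hs.1
  rw [Real.norm_eq_abs, ← mul_assoc, abs_mul, abs_of_pos (by positivity), mul_comm]
  gcongr
  exact hF s hs

lemma abs_potQ_le (hn : 1 ≤ n) {f : ℝ → ℝ} {F r : ℝ} (hr : 0 ≤ r) (hF : ∀ s ∈ Ioi r, |f s| ≤ F) :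
    |potQ n f r| ≤ F * massQ n r := by
  rw [potQ, massQ, ← integral_const_mul, ← Real.norm_eq_abs]
  refine norm_integral_le_of_norm_le
    (((integrableOn_kerQ_mul hn).mono_set (Ioi_subset_Ioi hr)).const_mul F) ?_
  refine (ae_restrict_iff' measurableSet_Ioi).2 (Eventually.of_forall fun s hs => ?_)
  have h2 : 0 < s := lt_of_le_of_lt hr hs
  have h1 := kerQ_pos (n := n) h2
  rw [Real.norm_eq_abs, ← mul_assoc, abs_mul, abs_of_pos (by positivity), mul_comm]
  gcongr
  exact hF s hs

lemma tendsto_kerQ_atTop (hn : 1 ≤ n) : Tendsto (kerQ n) atTop (𝓝 0) := by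
  refine tendsto_of_tendsto_of_tendsto_of_le_of_le' tendsto_const_nhds (tendsto_kerQ hn) ?_ ?_
  · filter_upwards [eventually_gt_atTop 0] with x hx using (kerQ_pos hx).le
  · filter_upwards [eventually_ge_atTop 1] with x hx
    have := kerQ_pos (n := n) (by linarith : 0 < x)
    exact le_mul_of_one_le_left this.le (one_le_pow₀ hx)

lemma tendsto_kerP_mul_potQ (hn : 1 ≤ n) {f : ℝ → ℝ} (h0 : Tendsto f atTop (𝓝 0)) :
    Tendsto (fun r => kerP n r * potQ n f r) atTop (𝓝 0) := by
  rw [Metric.tendsto_nhds]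
  intro ε hε
  have h1 : ∀ᶠ s in atTop, |f s| < ε / 2 := by
    have := h0.abs
    rw [abs_zero] at this
    exact this.eventually (gt_mem_nhds (by positivity))
  obtain ⟨R, hR⟩ := eventually_atTop.1 h1
  filter_upwards [eventually_ge_atTop R, eventually_gt_atTop 0] with r hr hr0
  have h2 := abs_potQ_le hn hr0.le (f := f) (F := ε / 2) fun s hs =>
    (hR s (hr.trans (le_of_lt hs))).le
  have hp := kerP_pos (n := n) hr0
  have hq := kerQ_pos (n := n) hr0
  have h3 := kernel_mass_le_one hn hr0
  have h4 := mul_nonneg hq.le (massP_nonneg (n := n) r)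
  rw [Real.dist_eq, sub_zero, abs_mul, abs_of_pos hp]
  calc kerP n r * |potQ n f r| ≤ kerP n r * (ε / 2 * massQ n r) := by gcongr
    _ = ε / 2 * (kerP n r * massQ n r) := by ring
    _ ≤ ε / 2 * 1 := by gcongr; linarith
    _ < ε := by linarith

/-- Split the integral at an R beyond which |f| < ε/2: the part up to R is a fixed number multiplied
by q(r) → 0, the rest is at most ε/2 by `kernel_mass_le_one`. -/
lemma tendsto_kerQ_mul_potP (hn : 1 ≤ n) {f : ℝ → ℝ} (hf : ContinuousOn f (Ici 0))
    (h0 : Tendsto f atTop (𝓝 0)) :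
    Tendsto (fun r => kerQ n r * potP n f r) atTop (𝓝 0) := by
  rw [Metric.tendsto_nhds]
  intro ε hε
  have h1 : ∀ᶠ s in atTop, |f s| < ε / 2 := by
    have := h0.abs
    rw [abs_zero] at this
    exact this.eventually (gt_mem_nhds (by positivity))
  obtain ⟨R', hR'⟩ := eventually_atTop.1 h1
  set R := max R' 0 with hRdef
  have hR0 : 0 ≤ R := le_max_right _ _
  have hR : ∀ s, R ≤ s → |f s| < ε / 2 := fun s hs => hR' s ((le_max_left _ _).trans hs)
  have hlim : Tendsto (fun r => kerQ n r * |potP n f R|) atTop (𝓝 0) := by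
    simpa using (tendsto_kerQ_atTop hn).mul_const |potP n f R|
  filter_upwards [eventually_ge_atTop R, eventually_gt_atTop 0,
    hlim.eventually (gt_mem_nhds (half_pos hε))] with r hr hr0 hsmall
  have hint := integrableOn_Ioc_of_continuousOn (continuousOn_kerP_mul_weight (n := n) hf) r
  have hsplit : potP n f r = potP n f R + ∫ s in Ioc R r, kerP n s * (s ^ (n - 1) * f s) := by
    rw [potP, potP, ← Ioc_union_Ioc_eq_Ioc hR0 hr, setIntegral_union (Ioc_disjoint_Ioc_of_le le_rfl)
      measurableSet_Ioc (hint.mono_set (Ioc_subset_Ioc_right hr))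
      (hint.mono_set (Ioc_subset_Ioc_left hR0))]
  have hM := integrableOn_Ioc_of_continuousOn (continuousOn_kerP_mul (n := n)) r
  have hfar : |∫ s in Ioc R r, kerP n s * (s ^ (n - 1) * f s)| ≤ ε / 2 * massP n r := by
    have h2 : |∫ s in Ioc R r, kerP n s * (s ^ (n - 1) * f s)| ≤
        ∫ s in Ioc R r, ε / 2 * (kerP n s * s ^ (n - 1)) := by
      rw [← Real.norm_eq_abs]
      refine norm_integral_le_of_norm_le
        ((hM.mono_set (Ioc_subset_Ioc_left hR0)).const_mul (ε / 2)) ?_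
      refine (ae_restrict_iff' measurableSet_Ioc).2 (Eventually.of_forall fun s hs => ?_)
      have h3 : 0 < s := lt_of_le_of_lt hR0 hs.1
      have h4 := kerP_pos (n := n) h3
      rw [Real.norm_eq_abs, ← mul_assoc, abs_mul, abs_of_pos (by positivity), mul_comm]
      gcongr
      exact (hR s hs.1.le).le
    refine h2.trans ?_
    rw [integral_const_mul, massP]
    refine mul_le_mul_of_nonneg_left ?_ (by positivity)
    refine setIntegral_mono_set hM ?_ (Ioc_subset_Ioc_left hR0).eventuallyLE
    refine (ae_restrict_iff' measurableSet_Ioc).2 (Eventually.of_forall fun s hs => ?_)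
    have h3 : 0 < s := hs.1
    have h4 := kerP_pos (n := n) h3
    simp only [Pi.zero_apply]
    positivity
  have hp := kerP_pos (n := n) hr0
  have hq := kerQ_pos (n := n) hr0
  have h3 := kernel_mass_le_one hn hr0
  have h4 := mul_nonneg hp.le (massQ_nonneg (n := n) hr0.le)
  rw [Real.dist_eq, sub_zero, abs_mul, abs_of_pos hq, hsplit]
  calc kerQ n r * |potP n f R + ∫ s in Ioc R r, kerP n s * (s ^ (n - 1) * f s)|
      ≤ kerQ n r * (|potP n f R| + ε / 2 * massP n r) := by
        gcongr; exact (abs_add_le _ _).trans (by gcongr)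
    _ = kerQ n r * |potP n f R| + ε / 2 * (kerQ n r * massP n r) := by ring
    _ ≤ kerQ n r * |potP n f R| + ε / 2 * 1 := by gcongr; linarith
    _ < ε := by linarith

lemma hasDerivAt_potP {f : ℝ → ℝ} (hf : ContinuousOn f (Ici 0)) {r : ℝ} (hr : 0 < r) :
    HasDerivAt (potP n f) (kerP n r * (r ^ (n - 1) * f r)) r :=
  hasDerivAt_integral_Ioc ((continuousOn_kerP_mul_weight hf).mono Ioi_subset_Ici_self)
    (integrableOn_Ioc_of_continuousOn (continuousOn_kerP_mul_weight hf)) hr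

lemma hasDerivAt_potQ (hn : 1 ≤ n) {f : ℝ → ℝ} {F : ℝ} (hf : ContinuousOn f (Ici 0))
    (hF : ∀ s, 0 ≤ s → |f s| ≤ F) {r : ℝ} (hr : 0 < r) :
    HasDerivAt (potQ n f) (-(kerQ n r * (r ^ (n - 1) * f r))) r :=
  hasDerivAt_integral_Ioi (continuousOn_kerQ_mul_weight hf)
    (integrableOn_kerQ_mul_weight hn hf hF) hr

/-- Variation of parameters: the endpoint terms cancel in the first derivative, and in the second
they add up to -f times the Wronskian, that is to -f. -/
theorem isInverse_greenPotential (hn : 1 ≤ n) {f : ℝ → ℝ} (hf : ContinuousOn f (Ici 0))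
    (h0 : Tendsto f atTop (𝓝 0)) : IsInverse n f (greenPotential n f) := by
  obtain ⟨F, hF0, hF⟩ := exists_bound_of_tendsto hf h0
  have hfun : greenPotential n f = fun r => kerQ n r * potP n f r + kerP n r * potQ n f r :=
    funext (greenPotential_eq f)
  have hd1 : ∀ r ∈ Ioi (0 : ℝ), HasDerivAt (greenPotential n f)
      (kerQ' n r * potP n f r + kerP' n r * potQ n f r) r := by
    intro r hr
    rw [hfun]
    refine (((hasDerivAt_kerQ hr).mul (hasDerivAt_potP hf hr)).add
      ((hasDerivAt_kerP hr).mul (hasDerivAt_potQ hn hf hF hr))).congr_deriv ?_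
    ring
  have hd2 : ∀ r ∈ Ioi (0 : ℝ), HasDerivAt
      (fun r => kerQ' n r * potP n f r + kerP' n r * potQ n f r)
      (kerSecond n (greenPotential n f r) (kerQ' n r * potP n f r + kerP' n r * potQ n f r) r
        - f r) r := by
    intro r hr
    refine (((hasDerivAt_kerQ' hr).mul (hasDerivAt_potP hf hr)).add
      ((hasDerivAt_kerP' hr).mul (hasDerivAt_potQ hn hf hF hr))).congr_deriv ?_
    have h := kernel_wronskian hn hr
    rw [greenPotential_eq]
    simp only [kerSecond]
    linear_combination (-f r) * h
  have hderiv : EqOn (deriv (greenPotential n f))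
      (fun r => kerQ' n r * potP n f r + kerP' n r * potQ n f r) (Ioi 0) :=
    fun r hr => (hd1 r hr).deriv
  have hderiv2 : ∀ r ∈ Ioi (0 : ℝ), deriv (deriv (greenPotential n f)) r =
      kerSecond n (greenPotential n f r) (kerQ' n r * potP n f r + kerP' n r * potQ n f r) r
        - f r := by
    intro r hr
    rw [(hderiv.eventuallyEq_of_mem (isOpen_Ioi.mem_nhds hr)).deriv_eq]
    exact (hd2 r hr).deriv
  have hcont : ContinuousOn (greenPotential n f) (Ioi 0) :=
    fun r hr => (hd1 r hr).continuousAt.continuousWithinAt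
  have hcont1 : ContinuousOn (fun r => kerQ' n r * potP n f r + kerP' n r * potQ n f r) (Ioi 0) :=
    fun r hr => (hd2 r hr).continuousAt.continuousWithinAt
  constructor
  · rw [show (2 : WithTop ℕ∞) = 1 + 1 by norm_num, contDiffOn_succ_iff_deriv_of_isOpen isOpen_Ioi]
    refine ⟨fun r hr => (hd1 r hr).differentiableAt.differentiableWithinAt, by simp, ?_⟩
    rw [show (1 : WithTop ℕ∞) = 0 + 1 by norm_num, contDiffOn_succ_iff_deriv_of_isOpen isOpen_Ioi]
    refine ⟨fun r hr => ?_, by simp, ?_⟩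
    · exact ((hd2 r hr).congr_of_eventuallyEq
        (hderiv.eventuallyEq_of_mem (isOpen_Ioi.mem_nhds hr))).differentiableAt.differentiableWithinAt
    · rw [contDiffOn_zero]
      refine ContinuousOn.congr ?_ hderiv2
      refine ContinuousOn.sub ?_ (hf.mono Ioi_subset_Ici_self)
      refine ContinuousOn.sub (ContinuousOn.mul ?_ hcont) (ContinuousOn.mul ?_ hcont1)
      · exact continuousOn_const.add (continuousOn_const.div (by fun_prop)
          fun x hx => pow_ne_zero _ (ne_of_gt hx))
      · exact continuousOn_const.div continuousOn_id fun x hx => ne_of_gt hx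
  · intro r hr
    rw [vectorLaplacian, hderiv2 r hr, hderiv hr, kerSecond]
    ring
  · rw [greenPotential_eq, kerP_zero]
    simp [potP]
  · have hP : Tendsto (kerP n) (𝓝[>] 0) (𝓝 0) := by
      have := (continuousOn_kerP (n := n) 0 self_mem_Ici).tendsto
      rw [kerP_zero] at this
      exact this.mono_left (nhdsWithin_mono _ Ioi_subset_Ici_self)
    set C := massConst n
    have hlin : Tendsto (fun r : ℝ => F * (r * C)) (𝓝[>] 0) (𝓝 0) := by
      have : Tendsto (fun r : ℝ => F * (r * C)) (𝓝 0) (𝓝 (F * (0 * C))) :=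
        Continuous.tendsto (by fun_prop) 0
      simp only [zero_mul, mul_zero] at this
      exact this.mono_left nhdsWithin_le_nhds
    refine squeeze_zero_norm' ?_ hlin
    filter_upwards [self_mem_nhdsWithin] with r hr
    have hr : 0 < r := hr
    have hq := kerQ_pos (n := n) hr
    have hp := kerP_pos (n := n) hr
    have h1 := abs_potP_le (n := n) (f := f) (F := F) (r := r) fun s hs => hF s hs.1.le
    have h2 := abs_potQ_le hn (f := f) (F := F) hr.le fun s hs => hF s (hr.le.trans (le_of_lt hs))
    have h4 : kerQ n r * massP n r + kerP n r * massQ n r ≤ r * C :=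
      (kernel_mass_le_mul hn hr).trans_eq (mul_comm _ _)
    rw [greenPotential_eq, Real.norm_eq_abs]
    calc |kerQ n r * potP n f r + kerP n r * potQ n f r|
        ≤ kerQ n r * |potP n f r| + kerP n r * |potQ n f r| := by
          refine (abs_add_le _ _).trans ?_
          rw [abs_mul, abs_mul, abs_of_pos hq, abs_of_pos hp]
      _ ≤ kerQ n r * (F * massP n r) + kerP n r * (F * massQ n r) := by gcongr
      _ = F * (kerQ n r * massP n r + kerP n r * massQ n r) := by ring
      _ ≤ F * (r * C) := by gcongr
  · rw [hfun]
    simpa using (tendsto_kerQ_mul_potP hn hf h0).add (tendsto_kerP_mul_potQ hn h0)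

lemma IsInverse.hasDerivAt {f u : ℝ → ℝ} (h : IsInverse n f u) {r : ℝ} (hr : 0 < r) :
    HasDerivAt u (deriv u r) r ∧ HasDerivAt (deriv u) (deriv (deriv u) r) r := by
  have h1 := h.contDiffOn
  rw [show (2 : WithTop ℕ∞) = 1 + 1 by norm_num,
    contDiffOn_succ_iff_deriv_of_isOpen isOpen_Ioi] at h1
  have hm : Ioi (0 : ℝ) ∈ 𝓝 r := Ioi_mem_nhds hr
  exact ⟨(h1.1.differentiableAt hm).hasDerivAt,
    ((h1.2.2.differentiableOn (by norm_num)).differentiableAt hm).hasDerivAt⟩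

lemma exists_isMaxOn_Ioi {w : ℝ → ℝ} (hw : ContinuousOn w (Ioi 0))
    (h0 : Tendsto w (𝓝[>] 0) (𝓝 0)) (h1 : Tendsto w atTop (𝓝 0)) {r : ℝ} (hr : 0 < r)
    (hpos : 0 < w r) : ∃ x, 0 < x ∧ 0 < w x ∧ ∀ y, 0 < y → w y ≤ w x := by
  have e0 := h0.eventually (gt_mem_nhds hpos)
  obtain ⟨R, hR⟩ := eventually_atTop.1 (h1.eventually (gt_mem_nhds hpos))
  obtain ⟨ε, hε, hεs⟩ := mem_nhdsGT_iff_exists_Ioo_subset.1 e0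
  have hε : 0 < ε := hε
  have hrε : ε ≤ r := by
    by_contra h
    have h' : w r < w r := hεs ⟨hr, not_le.1 h⟩
    exact lt_irrefl _ h'
  have hrR : r ≤ R := by
    by_contra h
    exact lt_irrefl _ (hR r (not_le.1 h).le)
  obtain ⟨x, hx, hmax⟩ := isCompact_Icc.exists_isMaxOn (nonempty_Icc.2 (hrε.trans hrR))
    (hw.mono fun y hy => lt_of_lt_of_le hε hy.1)
  have hxr : w r ≤ w x := hmax ⟨hrε, hrR⟩
  refine ⟨x, lt_of_lt_of_le hε hx.1, lt_of_lt_of_le hpos hxr, fun y hy => ?_⟩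
  rcases lt_or_ge y ε with h | h
  · have h' : w y < w r := hεs ⟨hy, h⟩
    exact h'.le.trans hxr
  rcases lt_or_ge R y with h' | h'
  · exact (hR y h'.le).le.trans hxr
  · exact hmax ⟨h, h'⟩

/-- Maximum principle for w = u - v, which vanishes at 0 and at infinity: at a positive maximum the
equation forces w'' = (1 + (n-1)/x²) w > 0. -/
lemma IsInverse.le (hn : 1 ≤ n) {f u v : ℝ → ℝ} (hu : IsInverse n f u) (hv : IsInverse n f v)
    {r : ℝ} (hr : 0 < r) : u r ≤ v r := by
  have hn1 : (1 : ℝ) ≤ n := by exact_mod_cast hn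
  by_contra hlt
  rw [not_le] at hlt
  set w : ℝ → ℝ := fun x => u x - v x with hw
  have hd1 : ∀ x ∈ Ioi (0 : ℝ), HasDerivAt w (deriv u x - deriv v x) x := fun x hx =>
    (hu.hasDerivAt hx).1.sub (hv.hasDerivAt hx).1
  have hE : EqOn (deriv w) (fun x => deriv u x - deriv v x) (Ioi 0) := fun x hx => (hd1 x hx).deriv
  have hd2 : ∀ x ∈ Ioi (0 : ℝ), deriv (deriv w) x = deriv (deriv u) x - deriv (deriv v) x :=
    fun x hx => by
      rw [(hE.eventuallyEq_of_mem (isOpen_Ioi.mem_nhds hx)).deriv_eq]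
      exact ((hu.hasDerivAt hx).2.sub (hv.hasDerivAt hx).2).deriv
  have t0 := hu.tendsto_zero.sub hv.tendsto_zero
  have t1 := hu.tendsto_atTop.sub hv.tendsto_atTop
  rw [sub_zero] at t0 t1
  obtain ⟨x, hx, hwx, hmax⟩ := exists_isMaxOn_Ioi (w := w)
    (fun x hx => (hd1 x hx).continuousAt.continuousWithinAt) t0 t1 hr (sub_pos.2 hlt)
  have hlm : IsLocalMax w x := by
    filter_upwards [lt_mem_nhds hx] with y hy using hmax y hy
  have hw0 : deriv w x = 0 := hlm.deriv_eq_zero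
  have hw0' : deriv u x - deriv v x = 0 := (hE hx).symm.trans hw0
  have hw2 : deriv (deriv w) x = (1 + (n - 1) / x ^ 2) * w x := by
    rw [hd2 x hx]
    have e1 := hu.equation x hx
    have e2 := hv.equation x hx
    simp only [vectorLaplacian] at e1 e2
    simp only [hw]
    linear_combination e2 - e1 - (n - 1) / x * hw0'
  have hpos : 0 < deriv (deriv w) x := by
    rw [hw2]
    have : 0 ≤ ((n : ℝ) - 1) / x ^ 2 := div_nonneg (by linarith) (by positivity)
    positivity
  -- The maximum point is then also a local minimum, so w is locally constant and w'' = 0, a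
  -- contradiction.
  have hmin := isLocalMin_of_deriv_deriv_pos hpos hw0 (hd1 x hx).continuousAt
  have hconst : w =ᶠ[𝓝 x] fun _ => w x := by
    filter_upwards [hmin, hlm] with y h1 h2 using le_antisymm h2 h1
  have h3 : deriv w =ᶠ[𝓝 x] fun _ => 0 := by
    have := hconst.deriv
    simpa using this
  rw [h3.deriv_eq] at hpos
  simp at hpos

theorem IsInverse.eq_greenPotential (hn : 1 ≤ n) {f u : ℝ → ℝ} (hf : ContinuousOn f (Ici 0))
    (h0 : Tendsto f atTop (𝓝 0)) (hu : IsInverse n f u) {r : ℝ} (hr : 0 ≤ r) :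
    u r = greenPotential n f r := by
  have hg := isInverse_greenPotential hn hf h0
  rcases hr.eq_or_lt with rfl | hr
  · rw [hu.zero, hg.zero]
  · exact le_antisymm (hu.le hn hg hr) (hg.le hn hu hr)

/-- The numerator of S is r β_n(r) (α' β - α β')(r), so the formula is the Wronskian identity again.
-/
theorem S_eq (hn : 1 ≤ n) {r : ℝ} (hr : 0 < r) : S n r = 1 / (r ^ n * beta n r) := by
  have hn0 : (0 : ℝ) ≤ n := Nat.cast_nonneg n
  have hu : UniqueDiffWithinAt ℝ (Ici (0 : ℝ)) r := uniqueDiffOn_Ici 0 r hr.le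
  have h1 : phi₁ n r r = r * alpha (n + 2) r / (n + 2) * beta n r :=
    ((hasDerivAt_alpha hn0 hr).mul_const (beta n r)).hasDerivWithinAt.derivWithin hu
  have h2 : phi₂ n 0 r = alpha n 0 * -((n + 2) * r * beta (n + 2) r) :=
    ((hasDerivAt_beta hn0 hr).const_mul (alpha n 0)).hasDerivWithinAt.derivWithin hu
  have hb := (beta_pos hn0 hr).ne'
  have w := alpha_wronskian hn hr
  rw [S, h1, h2, phi, phi, alpha_zero, div_eq_div_iff (by positivity) (by positivity)]
  linear_combination beta n r ^ 2 * w

theorem le_S (hn : 1 ≤ n) {r : ℝ} (hr : 0 < r) : (n : ℝ) ≤ S n r := by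
  have hn1 : (0 : ℝ) < n := by exact_mod_cast hn
  have hb := beta_pos (Nat.cast_nonneg n) hr
  have h := pow_mul_beta_le hn hr
  rw [S_eq hn hr, le_div_iff₀ (by positivity)]
  rw [le_div_iff₀ hn1] at h
  linarith

end RadialEPDiff
end

/-! ### Velocity and strain along a particle configuration. -/

noncomputable section

namespace RadialEPDiff

/-- A `C¹` diffeomorphism `γ` of `[0,∞)` whose derivative `ρ` takes values in `[a,b]`, `a > 0`. -/
structure IsProfile (a b : ℝ) (γ ρ : ℝ → ℝ) : Prop where
  pos : 0 < a
  zero : γ 0 = 0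
  deriv : ∀ r, 0 ≤ r → HasDerivWithinAt γ (ρ r) (Ici 0) r
  continuousOn : ContinuousOn ρ (Ici 0)
  lower : ∀ r, 0 ≤ r → a ≤ ρ r
  upper : ∀ r, 0 ≤ r → ρ r ≤ b

namespace IsProfile

variable {a b : ℝ} {γ ρ : ℝ → ℝ}

lemma le (h : IsProfile a b γ ρ) : a ≤ b := (h.lower 0 le_rfl).trans (h.upper 0 le_rfl)

lemma rho_pos (h : IsProfile a b γ ρ) {r : ℝ} (hr : 0 ≤ r) : 0 < ρ r :=
  h.pos.trans_le (h.lower r hr)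

lemma hasDerivAt (h : IsProfile a b γ ρ) {r : ℝ} (hr : 0 < r) : HasDerivAt γ (ρ r) r :=
  (h.deriv r hr.le).hasDerivAt (Ici_mem_nhds hr)

lemma gamma_continuousOn (h : IsProfile a b γ ρ) : ContinuousOn γ (Ici 0) :=
  fun r hr => (h.deriv r hr).continuousWithinAt

lemma mul_sub_le (h : IsProfile a b γ ρ) {s r : ℝ} (hs : 0 ≤ s) (hsr : s ≤ r) :
    a * (r - s) ≤ γ r - γ s := by
  refine (convex_Ici (0 : ℝ)).mul_sub_le_image_sub_of_le_deriv h.gamma_continuousOn ?_ ?_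
    s hs r (hs.trans hsr) hsr
  · rw [interior_Ici]
    exact fun x hx => (h.hasDerivAt hx).differentiableAt.differentiableWithinAt
  · rw [interior_Ici]
    intro x hx
    rw [(h.hasDerivAt hx).deriv]
    exact h.lower x (le_of_lt hx)

lemma sub_le_mul (h : IsProfile a b γ ρ) {s r : ℝ} (hs : 0 ≤ s) (hsr : s ≤ r) :
    γ r - γ s ≤ b * (r - s) := by
  refine (convex_Ici (0 : ℝ)).image_sub_le_mul_sub_of_deriv_le h.gamma_continuousOn ?_ ?_
    s hs r (hs.trans hsr) hsr
  · rw [interior_Ici]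
    exact fun x hx => (h.hasDerivAt hx).differentiableAt.differentiableWithinAt
  · rw [interior_Ici]
    intro x hx
    rw [(h.hasDerivAt hx).deriv]
    exact h.upper x (le_of_lt hx)

lemma mul_le (h : IsProfile a b γ ρ) {r : ℝ} (hr : 0 ≤ r) : a * r ≤ γ r := by
  have := h.mul_sub_le le_rfl hr
  rw [h.zero] at this
  linarith

lemma le_mul (h : IsProfile a b γ ρ) {r : ℝ} (hr : 0 ≤ r) : γ r ≤ b * r := by
  have := h.sub_le_mul le_rfl hr
  rw [h.zero] at this
  linarith

lemma gamma_pos (h : IsProfile a b γ ρ) {r : ℝ} (hr : 0 < r) : 0 < γ r :=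
  (mul_pos h.pos hr).trans_le (h.mul_le hr.le)

lemma gamma_nonneg (h : IsProfile a b γ ρ) {r : ℝ} (hr : 0 ≤ r) : 0 ≤ γ r :=
  (mul_nonneg h.pos.le hr).trans (h.mul_le hr)

lemma gamma_mono (h : IsProfile a b γ ρ) {s r : ℝ} (hs : 0 ≤ s) (hsr : s ≤ r) : γ s ≤ γ r := by
  have := h.mul_sub_le hs hsr
  have := mul_nonneg h.pos.le (sub_nonneg.2 hsr)
  linarith

lemma mapsTo_Ici (h : IsProfile a b γ ρ) : MapsTo γ (Ici 0) (Ici 0) := fun _ hr => h.gamma_nonneg hr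

lemma mapsTo_Ioi (h : IsProfile a b γ ρ) : MapsTo γ (Ioi 0) (Ioi 0) := fun _ hr => h.gamma_pos hr

lemma tendsto_atTop (h : IsProfile a b γ ρ) : Tendsto γ atTop atTop := by
  refine tendsto_atTop_mono' atTop ?_ (tendsto_id.const_mul_atTop h.pos)
  filter_upwards [eventually_ge_atTop 0] with r hr using h.mul_le hr

variable {n : ℕ}

lemma integral_kerP (h : IsProfile a b γ ρ) {r : ℝ} (hr : 0 ≤ r) :
    IntegrableOn (fun s => kerP n (γ s) * γ s ^ (n - 1) * ρ s) (Ioc 0 r) ∧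
    ∫ s in Ioc 0 r, kerP n (γ s) * γ s ^ (n - 1) * ρ s = massP n (γ r) := by
  have hc : ContinuousOn (fun s => kerP n (γ s) * γ s ^ (n - 1) * ρ s) (Ici 0) :=
    ((continuousOn_kerP.comp h.gamma_continuousOn h.mapsTo_Ici).mul
      (h.gamma_continuousOn.pow _)).mul h.continuousOn
  have hi := integrableOn_Ioc_of_continuousOn hc r
  refine ⟨hi, ?_⟩
  rw [← intervalIntegral.integral_of_le hr,
    intervalIntegral.integral_eq_sub_of_hasDerivAt_of_le (f := fun s => massP n (γ s)) hr]
  · simp [h.zero, massP]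
  · exact (continuousOn_massP.comp h.gamma_continuousOn h.mapsTo_Ici).mono Icc_subset_Ici_self
  · intro s hs
    exact (hasDerivAt_massP (h.gamma_pos hs.1)).comp s (h.hasDerivAt hs.1)
  · rwa [intervalIntegrable_iff_integrableOn_Ioc_of_le hr]

lemma integral_kerQ (h : IsProfile a b γ ρ) (hn : 1 ≤ n) {r : ℝ} (hr : 0 ≤ r) :
    IntegrableOn (fun s => kerQ n (γ s) * γ s ^ (n - 1) * ρ s) (Ioi r) ∧
    ∫ s in Ioi r, kerQ n (γ s) * γ s ^ (n - 1) * ρ s = massQ n (γ r) := by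
  have hc : ContinuousWithinAt (fun s => massQ n (γ s)) (Ici r) r :=
    (((continuousOn_massQ hn).comp h.gamma_continuousOn h.mapsTo_Ici) r hr).mono
      (Ici_subset_Ici.2 hr)
  have hd : ∀ x ∈ Ioi r, HasDerivAt (fun s => massQ n (γ s))
      (-(kerQ n (γ x) * γ x ^ (n - 1) * ρ x)) x := fun x hx => by
    have hx0 : 0 < x := lt_of_le_of_lt hr hx
    exact ((hasDerivAt_massQ hn (h.gamma_pos hx0)).comp x (h.hasDerivAt hx0)).congr_deriv (by ring)
  have ht := (tendsto_massQ hn).comp h.tendsto_atTop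
  have hi := integrableOn_Ioi_deriv_of_nonpos hc hd (fun x hx => by
    have hx0 : 0 < x := lt_of_le_of_lt hr hx
    have h1 := kerQ_pos (n := n) (h.gamma_pos hx0)
    have h2 := h.gamma_pos hx0
    have h3 := h.rho_pos hx0.le
    have : 0 < kerQ n (γ x) * γ x ^ (n - 1) * ρ x := by positivity
    linarith) ht
  have hv := integral_Ioi_of_hasDerivAt_of_tendsto hc hd hi ht
  rw [integral_neg] at hv
  refine ⟨?_, by linarith⟩
  have := hi.neg
  simpa using this

/-- From γ(s) ≥ a s and ρ(s) ≥ a. The weight γ^(n-1) ρ on the right is the one produced by the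
change of variables x = γ(s), so that integrals along a profile are controlled by `massP` and
`massQ` at γ(r). -/
lemma weight_le (h : IsProfile a b γ ρ) (hn : 1 ≤ n) {s k : ℝ} (hs : 0 < s) (hk : 0 ≤ k) :
    k * s ^ (n - 1) ≤ (a⁻¹) ^ n * (k * γ s ^ (n - 1) * ρ s) := by
  have ha := h.pos
  have h1 : s ^ (n - 1) ≤ (a⁻¹ * γ s) ^ (n - 1) := by
    refine pow_le_pow_left₀ hs.le ?_ _
    rw [← div_eq_inv_mul, le_div_iff₀ ha]
    linarith [h.mul_le hs.le]
  have h2 : 1 ≤ a⁻¹ * ρ s := by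
    rw [← div_eq_inv_mul, le_div_iff₀ ha]
    linarith [h.lower s hs.le]
  have h3 := h.gamma_pos hs
  calc k * s ^ (n - 1) ≤ k * (a⁻¹ * γ s) ^ (n - 1) * 1 := by rw [mul_one]; gcongr
    _ ≤ k * (a⁻¹ * γ s) ^ (n - 1) * (a⁻¹ * ρ s) := by gcongr
    _ = (a⁻¹) ^ (n - 1 + 1) * (k * γ s ^ (n - 1) * ρ s) := by rw [mul_pow, pow_succ]; ring
    _ = _ := by rw [Nat.sub_add_cancel hn]

lemma abs_integral_Ioc_le (h : IsProfile a b γ ρ) (hn : 1 ≤ n) {G : ℝ → ℝ} {K r : ℝ}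
    (hr : 0 ≤ r) (hK : 0 ≤ K) (hG : ∀ s ∈ Ioc 0 r, |G s| ≤ K * (kerP n (γ s) * s ^ (n - 1))) :
    |∫ s in Ioc 0 r, G s| ≤ K * (a⁻¹) ^ n * massP n (γ r) := by
  obtain ⟨hi, hv⟩ := h.integral_kerP (n := n) hr
  rw [← hv, ← integral_const_mul, ← Real.norm_eq_abs]
  refine norm_integral_le_of_norm_le (hi.const_mul _) ?_
  refine (ae_restrict_iff' measurableSet_Ioc).2 (Eventually.of_forall fun s hs => ?_)
  refine (hG s hs).trans ?_
  rw [mul_assoc]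
  refine mul_le_mul_of_nonneg_left ?_ hK
  exact h.weight_le hn hs.1 (kerP_pos (h.gamma_pos hs.1)).le

lemma abs_integral_Ioi_le (h : IsProfile a b γ ρ) (hn : 1 ≤ n) {G : ℝ → ℝ} {K r : ℝ}
    (hr : 0 ≤ r) (hK : 0 ≤ K) (hG : ∀ s ∈ Ioi r, |G s| ≤ K * (kerQ n (γ s) * s ^ (n - 1))) :
    |∫ s in Ioi r, G s| ≤ K * (a⁻¹) ^ n * massQ n (γ r) := by
  obtain ⟨hi, hv⟩ := h.integral_kerQ hn hr
  rw [← hv, ← integral_const_mul, ← Real.norm_eq_abs]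
  refine norm_integral_le_of_norm_le (hi.const_mul _) ?_
  refine (ae_restrict_iff' measurableSet_Ioi).2 (Eventually.of_forall fun s hs => ?_)
  have hs : 0 < s := lt_of_le_of_lt hr hs
  refine (hG s (by assumption)).trans ?_
  rw [mul_assoc]
  refine mul_le_mul_of_nonneg_left ?_ hK
  exact h.weight_le hn hs (kerQ_pos (h.gamma_pos hs)).le

lemma integrableOn_of_le_kerQ (h : IsProfile a b γ ρ) (hn : 1 ≤ n) {G : ℝ → ℝ} {K : ℝ} (hK : 0 ≤ K)
    (hc : ContinuousOn G (Ioi 0)) (hG : ∀ s, 0 < s → |G s| ≤ K * (kerQ n (γ s) * s ^ (n - 1))) :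
    IntegrableOn G (Ioi 0) := by
  obtain ⟨hi, -⟩ := h.integral_kerQ hn le_rfl
  refine (hi.const_mul (K * (a⁻¹) ^ n)).mono' (hc.aestronglyMeasurable measurableSet_Ioi) ?_
  refine (ae_restrict_iff' measurableSet_Ioi).2 (Eventually.of_forall fun s hs => ?_)
  refine (hG s hs).trans ?_
  rw [mul_assoc]
  refine mul_le_mul_of_nonneg_left ?_ hK
  exact h.weight_le hn hs (kerQ_pos (h.gamma_pos hs)).le

end IsProfile

/-- `∫₀^r p(γ(s)) z₀(s)/ρ(s) ds`. -/
def lagP (n : ℕ) (ω γ ρ : ℝ → ℝ) (r : ℝ) : ℝ :=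
  ∫ s in Ioc 0 r, kerP n (γ s) / ρ s * (s ^ (n - 1) * ω s)

/-- `∫_r^∞ q(γ(s)) z₀(s)/ρ(s) ds`. -/
def lagQ (n : ℕ) (ω γ ρ : ℝ → ℝ) (r : ℝ) : ℝ :=
  ∫ s in Ioi r, kerQ n (γ s) / ρ s * (s ^ (n - 1) * ω s)

/-- The velocity `q(γ) ∫₀^r + p(γ) ∫_r^∞` of the particle `r`. -/
def velocity (n : ℕ) (ω γ ρ : ℝ → ℝ) (r : ℝ) : ℝ :=
  kerQ n (γ r) * lagP n ω γ ρ r + kerP n (γ r) * lagQ n ω γ ρ r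

/-- The velocity gradient `q'(γ) ∫₀^r + p'(γ) ∫_r^∞` at the particle `r`. -/
def strain (n : ℕ) (ω γ ρ : ℝ → ℝ) (r : ℝ) : ℝ :=
  kerQ' n (γ r) * lagP n ω γ ρ r + kerP' n (γ r) * lagQ n ω γ ρ r

variable {n : ℕ}

lemma hasDerivWithinAt_kerP {x : ℝ} (hx : 0 ≤ x) :
    HasDerivWithinAt (kerP n) (kerP' n x) (Ici 0) x := by
  rcases hx.eq_or_lt with rfl | hx
  · rw [kerP'_zero, hasDerivWithinAt_iff_tendsto_slope]
    have h := (continuousOn_alpha (Nat.cast_nonneg n) 0 self_mem_Ici).tendsto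
    rw [alpha_zero] at h
    refine (h.mono_left (nhdsWithin_mono _ sdiff_subset)).congr' ?_
    filter_upwards [self_mem_nhdsWithin] with y hy
    have hy : y ≠ 0 := hy.2
    rw [slope_def_field, kerP_zero, kerP]
    field_simp
    simp
  · exact (hasDerivAt_kerP hx).hasDerivWithinAt

lemma delta₁_eq {r : ℝ} (hr : 0 ≤ r) (s : ℝ) : delta₁ n r s = kerP' n r * kerQ n s := by
  rw [delta₁]
  simp only [delta_eq]
  exact ((hasDerivWithinAt_kerP hr).mul_const _).derivWithin (uniqueDiffOn_Ici 0 r hr)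

lemma delta₂_eq (r : ℝ) {s : ℝ} (hs : 0 < s) : delta₂ n r s = kerP n r * kerQ' n s := by
  rw [delta₂]
  simp only [delta_eq]
  exact ((hasDerivAt_kerQ hs).hasDerivWithinAt.const_mul _).derivWithin
    (uniqueDiffOn_Ici 0 s hs.le)

lemma gammaField_eq (ω γ ρ : ℝ → ℝ) (r : ℝ) : gammaField n ω γ ρ r = velocity n ω γ ρ r := by
  simp only [gammaField, velocity, lagP, lagQ, delta_eq]
  rw [← integral_const_mul, ← integral_const_mul]
  congr 1
  · refine integral_congr_ae (Eventually.of_forall fun s => ?_)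
    simp only; ring
  · refine integral_congr_ae (Eventually.of_forall fun s => ?_)
    simp only; ring

lemma rhoField_eq {a b : ℝ} {γ ρ : ℝ → ℝ} (h : IsProfile a b γ ρ) (ω : ℝ → ℝ) {r : ℝ}
    (hr : 0 ≤ r) : rhoField n ω γ ρ r = ρ r * strain n ω γ ρ r := by
  simp only [rhoField, strain, lagP, lagQ]
  rw [← mul_add, ← integral_const_mul, ← integral_const_mul]
  congr 2
  · refine setIntegral_congr_fun measurableSet_Ioc fun s hs => ?_
    rw [delta₂_eq _ (h.gamma_pos (hs.1.trans_le hs.2))]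
    ring
  · refine setIntegral_congr_fun measurableSet_Ioi fun s _ => ?_
    rw [delta₁_eq (h.gamma_nonneg hr)]
    ring

/-- An admissible initial momentum bounded by `F`. -/
structure IsMomentum (F : ℝ) (ω : ℝ → ℝ) : Prop where
  pos : 0 < F
  continuousOn : ContinuousOn ω (Ici 0)
  bound : ∀ s, 0 ≤ s → |ω s| ≤ F

namespace IsProfile

variable {a b F : ℝ} {γ ρ ω : ℝ → ℝ}

lemma continuousOn_lagP_integrand (h : IsProfile a b γ ρ) (hω : IsMomentum F ω) :
    ContinuousOn (fun s => kerP n (γ s) / ρ s * (s ^ (n - 1) * ω s)) (Ici 0) :=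
  ((continuousOn_kerP.comp h.gamma_continuousOn h.mapsTo_Ici).div h.continuousOn
    fun _ hs => (h.rho_pos hs).ne').mul (ContinuousOn.mul (by fun_prop) hω.continuousOn)

lemma continuousOn_lagQ_integrand (h : IsProfile a b γ ρ) (hω : IsMomentum F ω) :
    ContinuousOn (fun s => kerQ n (γ s) / ρ s * (s ^ (n - 1) * ω s)) (Ioi 0) :=
  ((continuousOn_kerQ.comp (h.gamma_continuousOn.mono Ioi_subset_Ici_self) h.mapsTo_Ioi).div
    (h.continuousOn.mono Ioi_subset_Ici_self)
    fun _ hs => (h.rho_pos (le_of_lt hs)).ne').mul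
    (ContinuousOn.mul (by fun_prop) (hω.continuousOn.mono Ioi_subset_Ici_self))

lemma abs_integrand_le (h : IsProfile a b γ ρ) (hω : IsMomentum F ω) {s k : ℝ} (hs : 0 < s)
    (hk : 0 ≤ k) : |k / ρ s * (s ^ (n - 1) * ω s)| ≤ F * a⁻¹ * (k * s ^ (n - 1)) := by
  have h1 := h.rho_pos hs.le
  have h2 : (ρ s)⁻¹ ≤ a⁻¹ := inv_anti₀ h.pos (h.lower s hs.le)
  have h3 := hω.bound s hs.le
  have h4 := hω.pos
  have h5 := h.pos
  rw [abs_mul, abs_mul, abs_of_nonneg (by positivity : 0 ≤ k / ρ s),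
    abs_of_nonneg (by positivity : 0 ≤ s ^ (n - 1)), div_eq_mul_inv]
  calc k * (ρ s)⁻¹ * (s ^ (n - 1) * |ω s|) ≤ k * a⁻¹ * (s ^ (n - 1) * F) := by gcongr
    _ = _ := by ring

lemma integrableOn_lagP (h : IsProfile a b γ ρ) (hω : IsMomentum F ω) (r : ℝ) :
    IntegrableOn (fun s => kerP n (γ s) / ρ s * (s ^ (n - 1) * ω s)) (Ioc 0 r) :=
  integrableOn_Ioc_of_continuousOn (h.continuousOn_lagP_integrand hω) r

lemma integrableOn_lagQ (h : IsProfile a b γ ρ) (hn : 1 ≤ n) (hω : IsMomentum F ω) :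
    IntegrableOn (fun s => kerQ n (γ s) / ρ s * (s ^ (n - 1) * ω s)) (Ioi 0) := by
  have := h.pos
  have := hω.pos
  exact h.integrableOn_of_le_kerQ hn (by positivity) (h.continuousOn_lagQ_integrand hω)
    fun s hs => h.abs_integrand_le hω hs (kerQ_pos (h.gamma_pos hs)).le

lemma hasDerivAt_lagP (h : IsProfile a b γ ρ) (hω : IsMomentum F ω) {r : ℝ} (hr : 0 < r) :
    HasDerivAt (lagP n ω γ ρ) (kerP n (γ r) / ρ r * (r ^ (n - 1) * ω r)) r :=
  hasDerivAt_integral_Ioc ((h.continuousOn_lagP_integrand hω).mono Ioi_subset_Ici_self)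
    (h.integrableOn_lagP hω) hr

lemma hasDerivAt_lagQ (h : IsProfile a b γ ρ) (hn : 1 ≤ n) (hω : IsMomentum F ω) {r : ℝ}
    (hr : 0 < r) :
    HasDerivAt (lagQ n ω γ ρ) (-(kerQ n (γ r) / ρ r * (r ^ (n - 1) * ω r))) r :=
  hasDerivAt_integral_Ioi (h.continuousOn_lagQ_integrand hω) (h.integrableOn_lagQ hn hω) hr

lemma continuousOn_lagQ (h : IsProfile a b γ ρ) (hn : 1 ≤ n) (hω : IsMomentum F ω) :
    ContinuousOn (lagQ n ω γ ρ) (Ici 0) :=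
  continuousOn_integral_Ioi (h.integrableOn_lagQ hn hω)

lemma abs_lagP_le (h : IsProfile a b γ ρ) (hn : 1 ≤ n) (hω : IsMomentum F ω) {r : ℝ}
    (hr : 0 ≤ r) : |lagP n ω γ ρ r| ≤ F * a⁻¹ * (a⁻¹) ^ n * massP n (γ r) := by
  have := h.pos
  have := hω.pos
  exact h.abs_integral_Ioc_le hn hr (by positivity)
    fun s hs => h.abs_integrand_le hω hs.1 (kerP_pos (h.gamma_pos hs.1)).le

lemma abs_lagQ_le (h : IsProfile a b γ ρ) (hn : 1 ≤ n) (hω : IsMomentum F ω) {r : ℝ}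
    (hr : 0 ≤ r) : |lagQ n ω γ ρ r| ≤ F * a⁻¹ * (a⁻¹) ^ n * massQ n (γ r) := by
  have := h.pos
  have := hω.pos
  refine h.abs_integral_Ioi_le hn hr (by positivity) fun s hs => ?_
  have hs : 0 < s := lt_of_le_of_lt hr hs
  exact h.abs_integrand_le hω hs (kerQ_pos (h.gamma_pos hs)).le

/-- The spatial derivative of the velocity is the strain times `ρ`. -/
lemma hasDerivAt_velocity (h : IsProfile a b γ ρ) (hn : 1 ≤ n) (hω : IsMomentum F ω) {r : ℝ}
    (hr : 0 < r) : HasDerivAt (velocity n ω γ ρ) (ρ r * strain n ω γ ρ r) r := by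
  have hg := h.gamma_pos hr
  have h1 := ((hasDerivAt_kerQ (n := n) hg).comp r (h.hasDerivAt hr)).mul
    (h.hasDerivAt_lagP (n := n) hω hr)
  have h2 := ((hasDerivAt_kerP (n := n) hg).comp r (h.hasDerivAt hr)).mul
    (h.hasDerivAt_lagQ hn hω hr)
  -- The contributions of the moving endpoint r to `lagP` and `lagQ` are opposite after
  -- multiplication by q(γ) and p(γ), and cancel.
  refine (h1.add h2).congr_deriv ?_
  simp only [strain, Function.comp]
  ring

lemma velocity_zero (h : IsProfile a b γ ρ) : velocity n ω γ ρ 0 = 0 := by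
  simp [velocity, h.zero, kerP_zero, lagP]

lemma strain_zero (h : IsProfile a b γ ρ) : strain n ω γ ρ 0 = lagQ n ω γ ρ 0 := by
  simp [strain, h.zero, kerP'_zero, lagP]

end IsProfile

lemma abs_kerQ'_le (hn : 1 ≤ n) {x : ℝ} (hx : 0 < x) :
    |kerQ' n x| ≤ n * ((1 + 1 / x) * kerQ n x) := by
  have hn1 : (1 : ℝ) ≤ n := by exact_mod_cast hn
  rw [abs_of_nonpos (kerQ'_nonpos hn hx)]
  refine (neg_kerQ'_le hn hx).trans ?_
  rw [← mul_assoc]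
  have := kerQ_pos (n := n) hx
  gcongr
  rw [mul_add, mul_one, mul_one_div]
  gcongr

lemma abs_kerP'_le (hn : 1 ≤ n) {x : ℝ} (hx : 0 < x) :
    |kerP' n x| ≤ n * ((1 + 1 / x) * kerP n x) := by
  have hn1 : (1 : ℝ) ≤ n := by exact_mod_cast hn
  have h1 := one_le_kerP' (n := n) hx.le
  have h2 := kerP_pos (n := n) hx
  rw [abs_of_pos (by linarith)]
  exact (kerP'_le hx).trans (le_mul_of_one_le_left (by positivity) hn1)

/-- Each derivative of p or q costs a factor 1 + 1/x; the differential equation gives this for the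
second one. -/
lemma abs_kerSecond_le (hn : 1 ≤ n) {x u u' : ℝ} (hx : 0 < x) (hu : 0 ≤ u)
    (hu' : |u'| ≤ n * ((1 + 1 / x) * u)) :
    |kerSecond n u u' x| ≤ 2 * n ^ 2 * ((1 + 1 / x) ^ 2 * u) := by
  have hn1 : (1 : ℝ) ≤ n := by exact_mod_cast hn
  have hy : 0 < 1 / x := by positivity
  set y := 1 / x with hydef
  have e1 : (1 + ((n : ℝ) - 1) / x ^ 2) = 1 + (n - 1) * y ^ 2 := by rw [hydef]; field_simp
  have e2 : ((n : ℝ) - 1) / x = (n - 1) * y := by rw [hydef]; field_simp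
  rw [kerSecond, e1, e2]
  have h0 : 0 ≤ (n : ℝ) - 1 := by linarith
  calc |(1 + (n - 1) * y ^ 2) * u - (n - 1) * y * u'|
      ≤ (1 + (n - 1) * y ^ 2) * u + (n - 1) * y * |u'| := by
        refine (abs_sub _ _).trans ?_
        rw [abs_mul, abs_mul, abs_of_nonneg (by positivity : 0 ≤ 1 + ((n : ℝ) - 1) * y ^ 2),
          abs_of_nonneg hu, abs_of_nonneg (by positivity : 0 ≤ ((n : ℝ) - 1) * y)]
    _ ≤ (n * (1 + y) ^ 2) * u + (n * (1 + y)) * (n * ((1 + y) * u)) := by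
        gcongr
        · nlinarith
        · linarith
        · linarith
    _ = (n + n ^ 2) * ((1 + y) ^ 2 * u) := by ring
    _ ≤ 2 * n ^ 2 * ((1 + y) ^ 2 * u) := by
        gcongr
        nlinarith

end RadialEPDiff
end

/-! ### Bounds and continuity of the field; comparability of the kernels. -/

noncomputable section

namespace RadialEPDiff

variable {n : ℕ}

/-- The constant in the bounds for the momentum integrals. -/
def sizeConst (n : ℕ) (F a : ℝ) : ℝ := F * a⁻¹ * (a⁻¹) ^ n

namespace IsProfile

variable {a b F : ℝ} {γ ρ ω : ℝ → ℝ}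

lemma sizeConst_pos (h : IsProfile a b γ ρ) (hω : IsMomentum F ω) : 0 < sizeConst n F a := by
  have := h.pos
  have := hω.pos
  unfold sizeConst
  positivity

lemma abs_velocity_le_mass (h : IsProfile a b γ ρ) (hn : 1 ≤ n) (hω : IsMomentum F ω) {r : ℝ}
    (hr : 0 < r) : |velocity n ω γ ρ r| ≤ sizeConst n F a *
      (kerQ n (γ r) * massP n (γ r) + kerP n (γ r) * massQ n (γ r)) := by
  have hg := h.gamma_pos hr
  have h1 := h.abs_lagP_le hn hω hr.le
  have h2 := h.abs_lagQ_le hn hω hr.le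
  have hq := kerQ_pos (n := n) hg
  have hp := kerP_pos (n := n) hg
  rw [velocity]
  calc _ ≤ kerQ n (γ r) * |lagP n ω γ ρ r| + kerP n (γ r) * |lagQ n ω γ ρ r| := by
        refine (abs_add_le _ _).trans ?_
        rw [abs_mul, abs_mul, abs_of_pos hq, abs_of_pos hp]
    _ ≤ kerQ n (γ r) * (sizeConst n F a * massP n (γ r)) +
        kerP n (γ r) * (sizeConst n F a * massQ n (γ r)) := by
        unfold sizeConst; gcongr
    _ = _ := by ring

lemma abs_velocity_le (h : IsProfile a b γ ρ) (hn : 1 ≤ n) (hω : IsMomentum F ω) {r : ℝ}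
    (hr : 0 ≤ r) : |velocity n ω γ ρ r| ≤ sizeConst n F a := by
  have h0 := h.sizeConst_pos (n := n) hω
  rcases hr.eq_or_lt with rfl | hr
  · rw [h.velocity_zero, abs_zero]; exact h0.le
  · refine (h.abs_velocity_le_mass hn hω hr).trans ?_
    exact mul_le_of_le_one_right h0.le (kernel_mass_le_one hn (h.gamma_pos hr))

lemma abs_strain_le (h : IsProfile a b γ ρ) (hn : 1 ≤ n) (hω : IsMomentum F ω) {r : ℝ}
    (hr : 0 < r) : |strain n ω γ ρ r| ≤ n * (sizeConst n F a * massConst n) := by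
  have h0 := h.sizeConst_pos (n := n) hω
  have hg := h.gamma_pos hr
  have h1 := h.abs_lagP_le hn hω hr.le
  have h2 := h.abs_lagQ_le hn hω hr.le
  have hq := kerQ_pos (n := n) hg
  have hp := kerP_pos (n := n) hg
  have hq' := abs_kerQ'_le hn hg
  have hp' := abs_kerP'_le hn hg
  rw [strain]
  calc _ ≤ |kerQ' n (γ r)| * |lagP n ω γ ρ r| + |kerP' n (γ r)| * |lagQ n ω γ ρ r| := by
        refine (abs_add_le _ _).trans ?_
        rw [abs_mul, abs_mul]
    _ ≤ n * ((1 + 1 / γ r) * kerQ n (γ r)) * (sizeConst n F a * massP n (γ r)) +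
        n * ((1 + 1 / γ r) * kerP n (γ r)) * (sizeConst n F a * massQ n (γ r)) := by
        unfold sizeConst; gcongr
    _ = n * (sizeConst n F a * ((1 + 1 / γ r) *
          (kerQ n (γ r) * massP n (γ r) + kerP n (γ r) * massQ n (γ r)))) := by ring
    _ ≤ _ := by gcongr; exact kernel_mass_le hn hg

lemma tendsto_gamma_zero (h : IsProfile a b γ ρ) : Tendsto γ (𝓝[≥] 0) (𝓝 0) := by
  have := (h.gamma_continuousOn 0 self_mem_Ici).tendsto
  rwa [h.zero] at this

lemma continuousOn_velocity (h : IsProfile a b γ ρ) (hn : 1 ≤ n) (hω : IsMomentum F ω) :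
    ContinuousOn (velocity n ω γ ρ) (Ici 0) := by
  intro r hr
  rcases (mem_Ici.1 hr).eq_or_lt with rfl | hr
  · rw [ContinuousWithinAt, h.velocity_zero]
    have hl : Tendsto (fun r => sizeConst n F a * (massConst n * γ r)) (𝓝[≥] 0) (𝓝 0) := by
      simpa using (h.tendsto_gamma_zero.const_mul (massConst n)).const_mul (sizeConst n F a)
    refine squeeze_zero_norm' ?_ hl
    filter_upwards [self_mem_nhdsWithin] with r hr
    have h0 := h.sizeConst_pos (n := n) hω
    rcases (mem_Ici.1 hr).eq_or_lt with rfl | hr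
    · rw [h.velocity_zero, h.zero]; simp
    · refine (h.abs_velocity_le_mass hn hω hr).trans ?_
      gcongr
      exact kernel_mass_le_mul hn (h.gamma_pos hr)
  · exact (h.hasDerivAt_velocity hn hω hr).continuousAt.continuousWithinAt

/-- Only the origin is delicate, since q' is singular there: its product with `lagP` is O((1 + 1/γ)
γ²) and so tends to 0. -/
lemma continuousOn_strain (h : IsProfile a b γ ρ) (hn : 1 ≤ n) (hω : IsMomentum F ω) :
    ContinuousOn (strain n ω γ ρ) (Ici 0) := by
  refine ContinuousOn.add ?_ ((continuousOn_kerP'.comp h.gamma_continuousOn h.mapsTo_Ici).mul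
    (h.continuousOn_lagQ hn hω))
  intro r hr
  rcases (mem_Ici.1 hr).eq_or_lt with rfl | hr
  · have hz : lagP n ω γ ρ 0 = 0 := by simp [lagP]
    rw [ContinuousWithinAt, hz, mul_zero]
    have hl : Tendsto (fun r => n * (sizeConst n F a * (γ r * γ r + γ r))) (𝓝[≥] 0) (𝓝 0) := by
      have hg := h.tendsto_gamma_zero
      simpa using (((hg.mul hg).add hg).const_mul (sizeConst n F a)).const_mul (n : ℝ)
    refine squeeze_zero_norm' ?_ hl
    filter_upwards [self_mem_nhdsWithin] with r hr
    have h0 := h.sizeConst_pos (n := n) hω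
    rcases (mem_Ici.1 hr).eq_or_lt with rfl | hr
    · rw [hz, h.zero]; simp
    · have hg := h.gamma_pos hr
      have h1 := h.abs_lagP_le hn hω hr.le
      have hq := kerQ_pos (n := n) hg
      rw [Real.norm_eq_abs, abs_mul]
      calc |kerQ' n (γ r)| * |lagP n ω γ ρ r|
          ≤ n * ((1 + 1 / γ r) * kerQ n (γ r)) * (sizeConst n F a * massP n (γ r)) := by
            unfold sizeConst; gcongr; exact abs_kerQ'_le hn hg
        _ = n * (sizeConst n F a * ((1 + 1 / γ r) * (kerQ n (γ r) * massP n (γ r)))) := by ring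
        _ ≤ n * (sizeConst n F a * ((1 + 1 / γ r) * (γ r * γ r))) := by
            gcongr ?_ * (_ * (_ * ?_))
            exact kerQ_mul_massP_le hn hg
        _ = _ := by field_simp
  · have hg := h.gamma_pos hr
    exact ((((hasDerivAt_kerQ' (n := n) hg).comp r (h.hasDerivAt hr)).mul
      (h.hasDerivAt_lagP (n := n) hω hr)).continuousAt).continuousWithinAt

/-- The pair (velocity, ρ · strain) thus satisfies the linear relation that defines `stateSpace`, so
the vector field preserves the constraint γ_r = ρ. -/
lemma velocity_eq_integral (h : IsProfile a b γ ρ) (hn : 1 ≤ n) (hω : IsMomentum F ω) {r : ℝ}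
    (hr : 0 ≤ r) : velocity n ω γ ρ r = ∫ s in (0 : ℝ)..r, ρ s * strain n ω γ ρ s := by
  rw [intervalIntegral.integral_eq_sub_of_hasDerivAt_of_le hr
    ((h.continuousOn_velocity hn hω).mono Icc_subset_Ici_self)
    (fun s hs => h.hasDerivAt_velocity hn hω hs.1), h.velocity_zero, sub_zero]
  rw [intervalIntegrable_iff_integrableOn_Ioc_of_le hr]
  exact integrableOn_Ioc_of_continuousOn (h.continuousOn.mul (h.continuousOn_strain hn hω)) r

end IsProfile

/-- A Harnack-type comparison: the ratio bound κ handles the origin, the distance bound E handles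
exponential growth. A single factor κ would do here; κ^n matches `kerQ_comparable`. -/
lemma kerP_comparable (hn : 1 ≤ n) {x y κ E : ℝ} (hx : 0 < x) (hy : 0 < y) (hκ : 1 ≤ κ)
    (h : x ≤ κ * y) (hE : |x - y| ≤ E) : kerP n x ≤ κ ^ n * Real.exp E * kerP n y := by
  have hp := kerP_pos (n := n) hy
  have hE0 : 0 ≤ E := (abs_nonneg _).trans hE
  have h1 : κ ≤ κ ^ n := le_self_pow₀ hκ (by omega)
  rcases le_total x y with hxy | hxy
  · refine (kerP_monotoneOn (mem_Ici.2 hx.le) (mem_Ici.2 hy.le) hxy).trans ?_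
    refine le_mul_of_one_le_left hp.le ?_
    exact one_le_mul_of_one_le_of_one_le (hκ.trans h1) (Real.one_le_exp hE0)
  · have ha := one_le_alpha (Nat.cast_nonneg n) hy.le
    calc kerP n x = x * alpha n x := rfl
      _ ≤ (κ ^ n * y) * (alpha n y * Real.exp E) := by
        have hax := one_le_alpha (Nat.cast_nonneg n) hx.le
        refine mul_le_mul (h.trans (by gcongr)) ?_ (by linarith) (by positivity)
        refine (alpha_le_mul_exp hy.le hxy).trans ?_
        gcongr
        exact (le_abs_self _).trans hE
      _ = _ := by rw [kerP]; ring

lemma kerQ_comparable (hn : 1 ≤ n) {x y κ E : ℝ} (hx : 0 < x) (hy : 0 < y) (hκ : 1 ≤ κ)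
    (h : y ≤ κ * x) (hE : |x - y| ≤ E) : kerQ n x ≤ κ ^ n * Real.exp E * kerQ n y := by
  have hp := kerQ_pos (n := n) hy
  have hE0 : 0 ≤ E := (abs_nonneg _).trans hE
  rcases le_total x y with hxy | hxy
  · rw [mul_comm]
    refine (kerQ_le_mul_exp hn hx hxy).trans ?_
    gcongr
    · rwa [div_le_iff₀ hx]
    · rw [abs_sub_comm] at hE
      exact (le_abs_self _).trans hE
  · refine (kerQ_antitoneOn hn hy hx hxy).trans ?_
    refine le_mul_of_one_le_left hp.le ?_
    exact one_le_mul_of_one_le_of_one_le (one_le_pow₀ hκ) (Real.one_le_exp hE0)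

/-- The Lipschitz constant of the kernels along profiles. -/
def kernelLip (n : ℕ) (a b E : ℝ) : ℝ :=
  2 * n ^ 2 * (b / a) ^ 2 * ((b / a) ^ n * Real.exp E) * (1 + a⁻¹)

section Lipschitz

variable {a b F D E : ℝ} {γ ρ γ' ρ' ω : ℝ → ℝ}

lemma IsProfile.abs_sub_le_mul (h : IsProfile a b γ ρ) (h' : IsProfile a b γ' ρ')
    (hρ : ∀ s, 0 ≤ s → |ρ s - ρ' s| ≤ D) {s : ℝ} (hs : 0 ≤ s) : |γ s - γ' s| ≤ D * s := by
  have := (convex_Ici (0 : ℝ)).norm_image_sub_le_of_norm_hasDerivWithin_le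
    (f := fun x => γ x - γ' x) (C := D) (fun x hx => (h.deriv x hx).sub (h'.deriv x hx))
    (fun x hx => hρ x hx) self_mem_Ici (mem_Ici.2 hs)
  simpa [h.zero, h'.zero, abs_of_nonneg hs] using this

lemma IsProfile.kernelLip_nonneg (h : IsProfile a b γ ρ) : 0 ≤ kernelLip n a b E := by
  have := h.pos
  have := h.pos.trans_le h.le
  unfold kernelLip
  positivity

/-- The mean value inequality between the two positions of the particle s. Comparability carries the
bound of f' to the point γ(s), and one factor 1 + 1/γ(s) is absorbed because the positions differ by
at most D and by at most D s. The case j = 0 serves p and q, the case j = 1 their derivatives. -/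
lemma kernel_diff_le (hn : 1 ≤ n) (h : IsProfile a b γ ρ) (h' : IsProfile a b γ' ρ')
    (hE : D ≤ E) (hγ : ∀ s, 0 ≤ s → |γ s - γ' s| ≤ D) (hρ : ∀ s, 0 ≤ s → |ρ s - ρ' s| ≤ D)
    {f f' g : ℝ → ℝ} {j : ℕ} (hj : j ≤ 1) (hf : ∀ x, 0 < x → HasDerivAt f (f' x) x)
    (hf' : ∀ x, 0 < x → |f' x| ≤ 2 * n ^ 2 * ((1 + 1 / x) ^ (j + 1) * g x))
    (hg0 : ∀ x, 0 < x → 0 < g x)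
    (hg : ∀ x y : ℝ, 0 < x → 0 < y → x ≤ b / a * y → y ≤ b / a * x → |x - y| ≤ E →
      g x ≤ (b / a) ^ n * Real.exp E * g y) {s : ℝ} (hs : 0 < s) :
    |f (γ s) - f (γ' s)| ≤ kernelLip n a b E * D * ((1 + 1 / γ s) ^ j * g (γ s)) := by
  have ha := h.pos
  have hb : 0 < b := ha.trans_le h.le
  have hκ : 1 ≤ b / a := by rw [le_div_iff₀ ha]; linarith [h.le]
  have hD : 0 ≤ D := (abs_nonneg _).trans (hγ 0 le_rfl)
  set x₀ := γ s with hx₀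
  have hx0 : 0 < x₀ := h.gamma_pos hs
  have hx1 : 0 < γ' s := h'.gamma_pos hs
  set L := (b / a) ^ n * Real.exp E with hL
  have hL0 : 0 < L := by positivity
  have hgx := hg0 x₀ hx0
  have hbound : ∀ x ∈ uIcc (γ' s) x₀,
      |f' x| ≤ 2 * n ^ 2 * (((b / a) * (1 + 1 / x₀)) ^ (j + 1) * (L * g x₀)) := by
    intro x hx
    have hlow : a * s ≤ x := (le_min (h'.mul_le hs.le) (h.mul_le hs.le)).trans hx.1
    have hup : x ≤ b * s := hx.2.trans (max_le (h'.le_mul hs.le) (h.le_mul hs.le))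
    have hxpos : 0 < x := (mul_pos ha hs).trans_le hlow
    have e1 : x ≤ b / a * x₀ := by
      have : b * s = b / a * (a * s) := by field_simp
      rw [this] at hup
      exact hup.trans (by gcongr; exact h.mul_le hs.le)
    have e2 : x₀ ≤ b / a * x := by
      have h3 : x₀ ≤ b * s := h.le_mul hs.le
      have : b * s = b / a * (a * s) := by field_simp
      rw [this] at h3
      exact h3.trans (by gcongr)
    have e3 : |x - x₀| ≤ E := by
      refine le_trans ?_ ((hγ s hs.le).trans hE)
      have := abs_sub_left_of_mem_uIcc (uIcc_comm (γ' s) x₀ ▸ hx)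
      rw [abs_sub_comm (γ s)]
      exact this
    have e4 : 1 + 1 / x ≤ b / a * (1 + 1 / x₀) := by
      rw [mul_add, mul_one]
      have : 1 / x ≤ b / a * (1 / x₀) := by
        rw [mul_one_div, div_le_div_iff₀ hxpos hx0, one_mul]
        exact e2
      linarith
    refine (hf' x hxpos).trans ?_
    have := hg x x₀ hxpos hx0 e1 e2 e3
    have := (hg0 x hxpos).le
    gcongr
  have hmv := (convex_uIcc (γ' s) x₀).norm_image_sub_le_of_norm_hasDerivWithin_le
    (f := f) (f' := f') (fun x hx => (hf x ((lt_min hx1 hx0).trans_le hx.1)).hasDerivWithinAt)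
    hbound left_mem_uIcc right_mem_uIcc
  rw [Real.norm_eq_abs, Real.norm_eq_abs] at hmv
  have hd1 : |x₀ - γ' s| ≤ D := hγ s hs.le
  have hd2 : |x₀ - γ' s| ≤ D * s := h.abs_sub_le_mul h' hρ hs.le
  -- The singular factor is harmless: 1/γ(s) ≤ 1/(a s), while the displacement is at most D s.
  have hd3 : (1 + 1 / x₀) * |x₀ - γ' s| ≤ D * (1 + a⁻¹) := by
    have h1 : 1 / x₀ * |x₀ - γ' s| ≤ D * a⁻¹ := by
      calc 1 / x₀ * |x₀ - γ' s| ≤ 1 / (a * s) * (D * s) := by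
            gcongr
            exact h.mul_le hs.le
        _ = D * a⁻¹ := by field_simp
    rw [add_mul, one_mul, mul_add, mul_one]
    linarith
  have hκj : (b / a) ^ (j + 1) ≤ (b / a) ^ 2 := pow_le_pow_right₀ hκ (by omega)
  refine hmv.trans ?_
  calc 2 * (n : ℝ) ^ 2 * (((b / a) * (1 + 1 / x₀)) ^ (j + 1) * (L * g x₀)) * |x₀ - γ' s|
      = 2 * n ^ 2 * (b / a) ^ (j + 1) * L * ((1 + 1 / x₀) ^ j * g x₀) *
        ((1 + 1 / x₀) * |x₀ - γ' s|) := by rw [mul_pow, pow_succ (1 + 1 / x₀)]; ring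
    _ ≤ 2 * n ^ 2 * (b / a) ^ 2 * L * ((1 + 1 / x₀) ^ j * g x₀) * (D * (1 + a⁻¹)) := by gcongr
    _ = _ := by rw [kernelLip]; ring

end Lipschitz

end RadialEPDiff
end

/-! ### Lipschitz estimates for velocity and strain. -/

noncomputable section

namespace RadialEPDiff

variable {n : ℕ}

/-- The Lipschitz constant of the momentum integrals along profiles. -/
def momentLip (n : ℕ) (F a b E : ℝ) : ℝ :=
  F * (kernelLip n a b E * a⁻¹ + a⁻¹ * a⁻¹) * (a⁻¹) ^ n

/-- The Lipschitz constant of the velocity along profiles. -/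
def velocityLip (n : ℕ) (F a b E : ℝ) : ℝ :=
  momentLip n F a b E + kernelLip n a b E * (sizeConst n F a + momentLip n F a b E * E)

section Lipschitz

variable {a b F D E : ℝ} {γ ρ γ' ρ' ω : ℝ → ℝ}

lemma le_two_mul_sq (hn : 1 ≤ n) : (n : ℝ) ≤ 2 * n ^ 2 := by
  have hn1 : (1 : ℝ) ≤ n := by exact_mod_cast hn
  nlinarith

lemma kerP_diff_le (hn : 1 ≤ n) (h : IsProfile a b γ ρ) (h' : IsProfile a b γ' ρ')
    (hE : D ≤ E) (hγ : ∀ s, 0 ≤ s → |γ s - γ' s| ≤ D) (hρ : ∀ s, 0 ≤ s → |ρ s - ρ' s| ≤ D)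
    {s : ℝ} (hs : 0 < s) :
    |kerP n (γ s) - kerP n (γ' s)| ≤ kernelLip n a b E * D * kerP n (γ s) ∧
    |kerP' n (γ s) - kerP' n (γ' s)| ≤
      kernelLip n a b E * D * ((1 + 1 / γ s) * kerP n (γ s)) := by
  have hκ : 1 ≤ b / a := by rw [le_div_iff₀ h.pos]; linarith [h.le]
  constructor
  · have := kernel_diff_le hn h h' hE hγ hρ (j := 0) (f := kerP n) (f' := kerP' n) (g := kerP n)
      (by norm_num) (fun x hx => hasDerivAt_kerP hx) (fun x hx => by
        have hp := kerP_pos (n := n) hx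
        rw [zero_add, pow_one]
        exact (abs_kerP'_le hn hx).trans (by gcongr; exact le_two_mul_sq hn))
      (fun x hx => kerP_pos hx)
      (fun x y hx hy h1 _ h3 => kerP_comparable hn hx hy hκ h1 h3) hs
    simpa using this
  · have := kernel_diff_le hn h h' hE hγ hρ (j := 1) (f := kerP' n) (g := kerP n)
      (f' := fun x => kerSecond n (kerP n x) (kerP' n x) x)
      le_rfl (fun x hx => hasDerivAt_kerP' hx)
      (fun x hx => abs_kerSecond_le hn hx (kerP_pos hx).le (abs_kerP'_le hn hx))
      (fun x hx => kerP_pos hx)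
      (fun x y hx hy h1 _ h3 => kerP_comparable hn hx hy hκ h1 h3) hs
    simpa using this

lemma kerQ_diff_le (hn : 1 ≤ n) (h : IsProfile a b γ ρ) (h' : IsProfile a b γ' ρ')
    (hE : D ≤ E) (hγ : ∀ s, 0 ≤ s → |γ s - γ' s| ≤ D) (hρ : ∀ s, 0 ≤ s → |ρ s - ρ' s| ≤ D)
    {s : ℝ} (hs : 0 < s) :
    |kerQ n (γ s) - kerQ n (γ' s)| ≤ kernelLip n a b E * D * kerQ n (γ s) ∧
    |kerQ' n (γ s) - kerQ' n (γ' s)| ≤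
      kernelLip n a b E * D * ((1 + 1 / γ s) * kerQ n (γ s)) := by
  have hκ : 1 ≤ b / a := by rw [le_div_iff₀ h.pos]; linarith [h.le]
  constructor
  · have := kernel_diff_le hn h h' hE hγ hρ (j := 0) (f := kerQ n) (f' := kerQ' n) (g := kerQ n)
      (by norm_num) (fun x hx => hasDerivAt_kerQ hx) (fun x hx => by
        have hp := kerQ_pos (n := n) hx
        rw [zero_add, pow_one]
        exact (abs_kerQ'_le hn hx).trans (by gcongr; exact le_two_mul_sq hn))
      (fun x hx => kerQ_pos hx)
      (fun x y hx hy _ h2 h3 => kerQ_comparable hn hx hy hκ h2 h3) hs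
    simpa using this
  · have := kernel_diff_le hn h h' hE hγ hρ (j := 1) (f := kerQ' n) (g := kerQ n)
      (f' := fun x => kerSecond n (kerQ n x) (kerQ' n x) x)
      le_rfl (fun x hx => hasDerivAt_kerQ' hx)
      (fun x hx => abs_kerSecond_le hn hx (kerQ_pos hx).le (abs_kerQ'_le hn hx))
      (fun x hx => kerQ_pos hx)
      (fun x y hx hy _ h2 h3 => kerQ_comparable hn hx hy hκ h2 h3) hs
    simpa using this

/-- Vary k and 1/ρ separately; the variation of 1/ρ is (1/ρ)(1/ρ')(ρ - ρ') up to sign, which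
explains a⁻¹ * a⁻¹. -/
lemma integrand_diff_le (h : IsProfile a b γ ρ) (h' : IsProfile a b γ' ρ') (hω : IsMomentum F ω)
    (hρ : ∀ s, 0 ≤ s → |ρ s - ρ' s| ≤ D) {s k k' Λ : ℝ} (hs : 0 < s) (hk : 0 ≤ k)
    (hkk : |k - k'| ≤ Λ * D * k) :
    |k / ρ s * (s ^ (n - 1) * ω s) - k' / ρ' s * (s ^ (n - 1) * ω s)| ≤
      F * (Λ * a⁻¹ + a⁻¹ * a⁻¹) * D * (k * s ^ (n - 1)) := by
  have ha := h.pos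
  have h1 := h.rho_pos hs.le
  have h2 := h'.rho_pos hs.le
  have i1 : (ρ s)⁻¹ ≤ a⁻¹ := inv_anti₀ ha (h.lower s hs.le)
  have i2 : (ρ' s)⁻¹ ≤ a⁻¹ := inv_anti₀ ha (h'.lower s hs.le)
  have hD := hρ s hs.le
  have hD0 : 0 ≤ D := (abs_nonneg _).trans hD
  have hb := hω.bound s hs.le
  have hF := hω.pos
  have e : k / ρ s * (s ^ (n - 1) * ω s) - k' / ρ' s * (s ^ (n - 1) * ω s) =
      ((k - k') * (ρ' s)⁻¹ - k * ((ρ s)⁻¹ * (ρ' s)⁻¹ * (ρ s - ρ' s))) * (s ^ (n - 1) * ω s) := by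
    field_simp
    ring
  have hsp : 0 < s ^ (n - 1) := by positivity
  rw [e, abs_mul, abs_mul (s ^ (n - 1)), abs_of_pos hsp]
  have hA : |(k - k') * (ρ' s)⁻¹ - k * ((ρ s)⁻¹ * (ρ' s)⁻¹ * (ρ s - ρ' s))| ≤
      (Λ * a⁻¹ + a⁻¹ * a⁻¹) * D * k := by
    have hΛ : 0 ≤ Λ * D * k := (abs_nonneg _).trans hkk
    calc _ ≤ |k - k'| * (ρ' s)⁻¹ + k * ((ρ s)⁻¹ * (ρ' s)⁻¹ * |ρ s - ρ' s|) := by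
          refine (abs_sub _ _).trans (le_of_eq ?_)
          rw [abs_mul, abs_mul k, abs_mul _ (ρ s - ρ' s), abs_of_pos (inv_pos.2 h2), abs_of_nonneg hk,
            abs_of_pos (mul_pos (inv_pos.2 h1) (inv_pos.2 h2))]
      _ ≤ (Λ * D * k) * a⁻¹ + k * (a⁻¹ * a⁻¹ * D) := by gcongr
      _ = _ := by ring
  have hA0 := (abs_nonneg _).trans hA
  calc _ ≤ ((Λ * a⁻¹ + a⁻¹ * a⁻¹) * D * k) * (s ^ (n - 1) * F) := by gcongr
    _ = _ := by ring

lemma lagP_diff_le (hn : 1 ≤ n) (h : IsProfile a b γ ρ) (h' : IsProfile a b γ' ρ')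
    (hω : IsMomentum F ω) (hE : D ≤ E) (hγ : ∀ s, 0 ≤ s → |γ s - γ' s| ≤ D)
    (hρ : ∀ s, 0 ≤ s → |ρ s - ρ' s| ≤ D) {r : ℝ} (hr : 0 ≤ r) :
    |lagP n ω γ ρ r - lagP n ω γ' ρ' r| ≤ momentLip n F a b E * D * massP n (γ r) := by
  have ha := h.pos
  have hF := hω.pos
  have hΛ := h.kernelLip_nonneg (n := n) (E := E)
  have hD0 : 0 ≤ D := (abs_nonneg _).trans (hρ 0 le_rfl)
  rw [lagP, lagP, ← integral_sub (h.integrableOn_lagP hω r) (h'.integrableOn_lagP hω r)]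
  refine (h.abs_integral_Ioc_le hn hr
    (K := F * (kernelLip n a b E * a⁻¹ + a⁻¹ * a⁻¹) * D) (by positivity) fun s hs => ?_).trans_eq ?_
  · exact integrand_diff_le h h' hω hρ hs.1 (kerP_pos (h.gamma_pos hs.1)).le
      (kerP_diff_le hn h h' hE hγ hρ hs.1).1
  · rw [momentLip]; ring

lemma lagQ_diff_le (hn : 1 ≤ n) (h : IsProfile a b γ ρ) (h' : IsProfile a b γ' ρ')
    (hω : IsMomentum F ω) (hE : D ≤ E) (hγ : ∀ s, 0 ≤ s → |γ s - γ' s| ≤ D)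
    (hρ : ∀ s, 0 ≤ s → |ρ s - ρ' s| ≤ D) {r : ℝ} (hr : 0 ≤ r) :
    |lagQ n ω γ ρ r - lagQ n ω γ' ρ' r| ≤ momentLip n F a b E * D * massQ n (γ r) := by
  have ha := h.pos
  have hF := hω.pos
  have hΛ := h.kernelLip_nonneg (n := n) (E := E)
  have hD0 : 0 ≤ D := (abs_nonneg _).trans (hρ 0 le_rfl)
  rw [lagQ, lagQ, ← integral_sub ((h.integrableOn_lagQ hn hω).mono_set (Ioi_subset_Ioi hr))
    ((h'.integrableOn_lagQ hn hω).mono_set (Ioi_subset_Ioi hr))]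
  refine (h.abs_integral_Ioi_le hn hr
    (K := F * (kernelLip n a b E * a⁻¹ + a⁻¹ * a⁻¹) * D) (by positivity) fun s hs => ?_).trans_eq ?_
  · have hs : 0 < s := lt_of_le_of_lt hr hs
    exact integrand_diff_le h h' hω hρ hs (kerQ_pos (h.gamma_pos hs)).le
      (kerQ_diff_le hn h h' hE hγ hρ hs).1
  · rw [momentLip]; ring

/-- Use xA - x'A' = x(A - A') + (x - x')A', bounding A' through A with D ≤ E. The factor c is 1 for
the velocity and n for the strain, whose kernels are bounded by n (1 + 1/x) times p and q. -/
lemma abs_mul_sub_mul_le {x x' A A' X m c K L Λ D E : ℝ} (hx : |x| ≤ c * X) (hX : 0 ≤ X)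
    (hc : 1 ≤ c) (hxx : |x - x'| ≤ Λ * D * X) (hA : |A| ≤ K * m) (hAA : |A - A'| ≤ L * D * m)
    (hm : 0 ≤ m) (hL : 0 ≤ L) (hΛ : 0 ≤ Λ) (hD : 0 ≤ D) (hE : D ≤ E) (hK : 0 ≤ K) :
    |x * A - x' * A'| ≤ c * ((L + Λ * (K + L * E)) * D * (X * m)) := by
  have hA' : |A'| ≤ (K + L * E) * m := by
    have : |A'| ≤ |A| + |A - A'| := by
      have := abs_sub A (A - A')
      simpa using this
    have : L * D * m ≤ L * E * m := by gcongr
    linarith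
  have hE0 : 0 ≤ E := hD.trans hE
  have e : x * A - x' * A' = x * (A - A') + (x - x') * A' := by ring
  rw [e]
  calc _ ≤ |x| * |A - A'| + |x - x'| * |A'| := by
        refine (abs_add_le _ _).trans ?_
        rw [abs_mul, abs_mul]
    _ ≤ (c * X) * (L * D * m) + (Λ * D * X) * ((K + L * E) * m) := by gcongr
    _ = c * (L * D * (X * m)) + 1 * (Λ * (K + L * E) * D * (X * m)) := by ring
    _ ≤ c * (L * D * (X * m)) + c * (Λ * (K + L * E) * D * (X * m)) := by gcongr
    _ = _ := by ring

lemma IsProfile.momentLip_nonneg (h : IsProfile a b γ ρ) (hω : IsMomentum F ω) :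
    0 ≤ momentLip n F a b E := by
  have ha := h.pos
  have hF := hω.pos
  have hΛ := h.kernelLip_nonneg (n := n) (E := E)
  unfold momentLip
  positivity

lemma IsProfile.velocityLip_nonneg (h : IsProfile a b γ ρ) (hω : IsMomentum F ω) (hE : 0 ≤ E) :
    0 ≤ velocityLip n F a b E := by
  have h1 := h.momentLip_nonneg (n := n) (E := E) hω
  have h2 := h.sizeConst_pos (n := n) hω
  have h3 := h.kernelLip_nonneg (n := n) (E := E)
  unfold velocityLip
  positivity

lemma velocity_diff_le (hn : 1 ≤ n) (h : IsProfile a b γ ρ) (h' : IsProfile a b γ' ρ')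
    (hω : IsMomentum F ω) (hE : D ≤ E) (hγ : ∀ s, 0 ≤ s → |γ s - γ' s| ≤ D)
    (hρ : ∀ s, 0 ≤ s → |ρ s - ρ' s| ≤ D) {r : ℝ} (hr : 0 < r) :
    |velocity n ω γ ρ r - velocity n ω γ' ρ' r| ≤ velocityLip n F a b E * D := by
  have hD : 0 ≤ D := (abs_nonneg _).trans (hρ 0 le_rfl)
  have hg := h.gamma_pos hr
  have hq := kerQ_pos (n := n) hg
  have hp := kerP_pos (n := n) hg
  have hL := h.momentLip_nonneg (n := n) (E := E) hω
  have hK := h.sizeConst_pos (n := n) hω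
  have hΛ := h.kernelLip_nonneg (n := n) (E := E)
  have hV := h.velocityLip_nonneg (n := n) hω (hD.trans hE)
  have h1 := abs_mul_sub_mul_le (c := 1) (by rw [abs_of_pos hq, one_mul]) hq.le le_rfl
    (kerQ_diff_le hn h h' hE hγ hρ hr).1 (h.abs_lagP_le hn hω hr.le)
    (lagP_diff_le hn h h' hω hE hγ hρ hr.le) (massP_nonneg (γ r)) hL hΛ hD hE hK.le
  have h2 := abs_mul_sub_mul_le (c := 1) (by rw [abs_of_pos hp, one_mul]) hp.le le_rfl
    (kerP_diff_le hn h h' hE hγ hρ hr).1 (h.abs_lagQ_le hn hω hr.le)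
    (lagQ_diff_le hn h h' hω hE hγ hρ hr.le) (massQ_nonneg hg.le) hL hΛ hD hE hK.le
  rw [velocity, velocity, add_sub_add_comm]
  refine (abs_add_le _ _).trans ((add_le_add h1 h2).trans ?_)
  -- The constant produced by `abs_mul_sub_mul_le` is `velocityLip` by definition.
  change 1 * (velocityLip n F a b E * D * _) + 1 * (velocityLip n F a b E * D * _) ≤ _
  rw [one_mul, one_mul, ← mul_add]
  exact mul_le_of_le_one_right (by positivity) (kernel_mass_le_one hn hg)

lemma strain_diff_le (hn : 1 ≤ n) (h : IsProfile a b γ ρ) (h' : IsProfile a b γ' ρ')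
    (hω : IsMomentum F ω) (hE : D ≤ E) (hγ : ∀ s, 0 ≤ s → |γ s - γ' s| ≤ D)
    (hρ : ∀ s, 0 ≤ s → |ρ s - ρ' s| ≤ D) {r : ℝ} (hr : 0 < r) :
    |strain n ω γ ρ r - strain n ω γ' ρ' r| ≤ n * (velocityLip n F a b E * D * massConst n) := by
  have hn1 : (1 : ℝ) ≤ n := by exact_mod_cast hn
  have hD : 0 ≤ D := (abs_nonneg _).trans (hρ 0 le_rfl)
  have hg := h.gamma_pos hr
  have hq := kerQ_pos (n := n) hg
  have hp := kerP_pos (n := n) hg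
  have hL := h.momentLip_nonneg (n := n) (E := E) hω
  have hK := h.sizeConst_pos (n := n) hω
  have hΛ := h.kernelLip_nonneg (n := n) (E := E)
  have hV := h.velocityLip_nonneg (n := n) hω (hD.trans hE)
  have h1 := abs_mul_sub_mul_le (abs_kerQ'_le hn hg) (by positivity) hn1
    (kerQ_diff_le hn h h' hE hγ hρ hr).2 (h.abs_lagP_le hn hω hr.le)
    (lagP_diff_le hn h h' hω hE hγ hρ hr.le) (massP_nonneg (γ r)) hL hΛ hD hE hK.le
  have h2 := abs_mul_sub_mul_le (abs_kerP'_le hn hg) (by positivity) hn1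
    (kerP_diff_le hn h h' hE hγ hρ hr).2 (h.abs_lagQ_le hn hω hr.le)
    (lagQ_diff_le hn h h' hω hE hγ hρ hr.le) (massQ_nonneg hg.le) hL hΛ hD hE hK.le
  rw [strain, strain, add_sub_add_comm]
  refine (abs_add_le _ _).trans ((add_le_add h1 h2).trans ?_)
  change n * (velocityLip n F a b E * D * _) + n * (velocityLip n F a b E * D * _) ≤ _
  rw [← mul_add, ← mul_add, mul_assoc (1 + 1 / γ r), mul_assoc (1 + 1 / γ r), ← mul_add]
  gcongr
  exact kernel_mass_le hn hg

end Lipschitz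

end RadialEPDiff
end

/-! ### The Banach space of states and the vector field on it. -/

noncomputable section

namespace RadialEPDiff

open scoped NNReal BoundedContinuousFunction

variable {n : ℕ}

/-- The kernel estimates hold for r > 0 only; continuity extends the resulting bounds to the origin.
-/
lemma abs_le_of_forall_pos {f : ℝ → ℝ} {C : ℝ} (hc : ContinuousOn f (Ici 0))
    (h : ∀ r, 0 < r → |f r| ≤ C) {r : ℝ} (hr : 0 ≤ r) : |f r| ≤ C := by
  rcases hr.eq_or_lt with rfl | hr
  · have h1 := ((hc 0 self_mem_Ici).mono Ioi_subset_Ici_self).tendsto.abs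
    refine le_of_tendsto h1 ?_
    filter_upwards [self_mem_nhdsWithin] with x hx using h x hx
  · exact h r hr

/-- The space of pairs `(γ - id, γ' - 1)` of bounded continuous functions on `[0,∞)`. -/
def stateSpace : Submodule ℝ (ℝ≥0 →ᵇ ℝ × ℝ) where
  carrier := {y | ∀ r : ℝ≥0, (y r).1 = ∫ s in (0 : ℝ)..r, (y s.toNNReal).2}
  zero_mem' := fun r => by simp
  add_mem' := fun {y z} hy hz r => by
    have hc : ∀ w : ℝ≥0 →ᵇ ℝ × ℝ, Continuous fun s : ℝ => (w s.toNNReal).2 := fun w =>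
      continuous_snd.comp (w.continuous.comp continuous_real_toNNReal)
    simp only [BoundedContinuousFunction.coe_add, Pi.add_apply, Prod.fst_add, Prod.snd_add]
    rw [intervalIntegral.integral_add ((hc y).intervalIntegrable _ _)
      ((hc z).intervalIntegrable _ _), hy r, hz r]
  smul_mem' := fun c y hy r => by
    simp only [BoundedContinuousFunction.coe_smul, Prod.smul_fst, Prod.smul_snd, smul_eq_mul]
    rw [intervalIntegral.integral_const_mul, hy r]

/-- For each r both sides of the constraint are continuous in the sup norm. Closedness gives the
completeness needed for Picard–Lindelöf. -/
lemma isClosed_stateSpace : IsClosed (stateSpace : Set (ℝ≥0 →ᵇ ℝ × ℝ)) := by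
  have : (stateSpace : Set (ℝ≥0 →ᵇ ℝ × ℝ)) =
      ⋂ r : ℝ≥0, {y | (y r).1 = ∫ s in (0 : ℝ)..r, (y s.toNNReal).2} := by
    ext y
    simp only [mem_iInter]
    rfl
  rw [this]
  refine isClosed_iInter fun r => isClosed_eq ?_ ?_
  · exact continuous_fst.comp (continuous_eval_const r)
  · refine LipschitzWith.continuous (K := r) (LipschitzWith.of_dist_le_mul fun y z => ?_)
    have hc : ∀ w : ℝ≥0 →ᵇ ℝ × ℝ, Continuous fun s : ℝ => (w s.toNNReal).2 := fun w =>
      continuous_snd.comp (w.continuous.comp continuous_real_toNNReal)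
    rw [Real.dist_eq, ← intervalIntegral.integral_sub ((hc y).intervalIntegrable _ _)
      ((hc z).intervalIntegrable _ _), ← Real.norm_eq_abs]
    have := intervalIntegral.norm_integral_le_of_norm_le_const (a := 0) (b := (r : ℝ))
      (f := fun s : ℝ => (y s.toNNReal).2 - (z s.toNNReal).2) (C := dist y z) fun s _ => by
        rw [Real.norm_eq_abs, ← Real.dist_eq]
        have h := BoundedContinuousFunction.dist_coe_le_dist (f := y) (g := z) s.toNNReal
        exact (le_max_right _ _).trans h
    rw [sub_zero, abs_of_nonneg r.coe_nonneg] at this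
    rwa [mul_comm]

/-- The Banach space of states. -/
def State : Type := stateSpace

instance : NormedAddCommGroup State := inferInstanceAs (NormedAddCommGroup stateSpace)

instance : NormedSpace ℝ State := inferInstanceAs (NormedSpace ℝ stateSpace)

instance : CompleteSpace State := isClosed_stateSpace.completeSpace_coe

/-- The underlying bounded continuous function of a state. -/
def State.fn (y : State) : ℝ≥0 →ᵇ ℝ × ℝ := Subtype.val y

/-- The particle positions encoded by a state. -/
def pos (y : State) (r : ℝ) : ℝ := r + (y.fn r.toNNReal).1

/-- The derivative of the particle positions encoded by a state. -/
def jac (y : State) (r : ℝ) : ℝ := 1 + (y.fn r.toNNReal).2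

/-- The states whose `jac` takes values in `[a,b]`. -/
def Admissible (a b : ℝ) (y : State) : Prop := ∀ r, 0 ≤ r → a ≤ jac y r ∧ jac y r ≤ b

lemma continuous_jac (y : State) : Continuous (jac y) :=
  continuous_const.add (continuous_snd.comp (y.fn.continuous.comp continuous_real_toNNReal))

lemma pos_eq_integral (y : State) {r : ℝ} (hr : 0 ≤ r) :
    pos y r = ∫ s in (0 : ℝ)..r, jac y s := by
  have h := Subtype.prop (p := (· ∈ stateSpace)) y r.toNNReal
  change (y.fn r.toNNReal).1 = ∫ s in (0 : ℝ)..r.toNNReal, (y.fn s.toNNReal).2 at h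
  rw [Real.coe_toNNReal r hr] at h
  have hc : Continuous fun s : ℝ => (y.fn s.toNNReal).2 :=
    continuous_snd.comp (y.fn.continuous.comp continuous_real_toNNReal)
  simp only [pos, jac]
  rw [intervalIntegral.integral_add (by simp) (hc.intervalIntegrable _ _), h]
  simp

lemma Admissible.isProfile {a b : ℝ} {y : State} (h : Admissible a b y) (ha : 0 < a) :
    IsProfile a b (pos y) (jac y) where
  pos := ha
  zero := by rw [pos_eq_integral y le_rfl]; simp
  deriv := fun r hr => by
    have h1 := intervalIntegral.integral_hasDerivAt_right
      ((continuous_jac y).intervalIntegrable 0 r)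
      ((continuous_jac y).stronglyMeasurableAtFilter _ _) (continuous_jac y).continuousAt
    exact h1.hasDerivWithinAt.congr (fun x hx => pos_eq_integral y hx) (pos_eq_integral y hr)
  continuousOn := (continuous_jac y).continuousOn
  lower := fun r hr => (h r hr).1
  upper := fun r hr => (h r hr).2

lemma abs_pos_sub_le (y z : State) (r : ℝ) : |pos y r - pos z r| ≤ ‖y - z‖ := by
  have h := (y - z).fn.norm_coe_le_norm r.toNNReal
  have h2 := (norm_fst_le _).trans h
  simp only [pos]
  rw [add_sub_add_left_eq_sub]
  exact h2

lemma abs_jac_sub_le (y z : State) (r : ℝ) : |jac y r - jac z r| ≤ ‖y - z‖ := by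
  have h := (y - z).fn.norm_coe_le_norm r.toNNReal
  have h2 := (norm_snd_le _).trans h
  simp only [jac]
  rw [add_sub_add_left_eq_sub]
  exact h2

lemma norm_sub_le_of_forall {y z : State} {C : ℝ} (hC : 0 ≤ C)
    (h1 : ∀ r, 0 ≤ r → |pos y r - pos z r| ≤ C) (h2 : ∀ r, 0 ≤ r → |jac y r - jac z r| ≤ C) :
    ‖y - z‖ ≤ C := by
  have : ‖(y - z).fn‖ ≤ C := by
    rw [BoundedContinuousFunction.norm_le hC]
    intro r
    have e1 := h1 r r.2
    have e2 := h2 r r.2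
    simp only [pos, jac, Real.toNNReal_coe, add_sub_add_left_eq_sub] at e1 e2
    exact max_le e1 e2
  exact this

lemma State.ext {y z : State} (h1 : ∀ r, 0 ≤ r → pos y r = pos z r)
    (h2 : ∀ r, 0 ≤ r → jac y r = jac z r) : y = z := by
  have h : ‖y - z‖ ≤ 0 := norm_sub_le_of_forall le_rfl (fun r hr => by rw [h1 r hr]; simp)
    fun r hr => by rw [h2 r hr]; simp
  exact sub_eq_zero.1 (norm_le_zero_iff.1 h)

lemma exists_state {g h : ℝ → ℝ} (hg : ContinuousOn g (Ici 0)) (hh : ContinuousOn h (Ici 0)) {C : ℝ}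
    (bg : ∀ r, 0 ≤ r → |g r| ≤ C) (bh : ∀ r, 0 ≤ r → |h r| ≤ C)
    (hi : ∀ r, 0 ≤ r → g r = ∫ s in (0 : ℝ)..r, h s) :
    ∃ y : State, ∀ r : ℝ≥0, y.fn r = (g r, h r) := by
  have hcoe : Continuous fun r : ℝ≥0 => (⟨r, r.2⟩ : Ici (0 : ℝ)) := by fun_prop
  have c1 : Continuous fun r : ℝ≥0 => g r := (continuousOn_iff_continuous_domRestrict.1 hg).comp hcoe
  have c2 : Continuous fun r : ℝ≥0 => h r := (continuousOn_iff_continuous_domRestrict.1 hh).comp hcoe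
  let y : ℝ≥0 →ᵇ ℝ × ℝ := BoundedContinuousFunction.ofNormedAddCommGroup
    (fun r : ℝ≥0 => (g r, h r)) (c1.prodMk c2) C fun r => max_le (bg r r.2) (bh r r.2)
  refine ⟨⟨y, fun r => ?_⟩, fun r => rfl⟩
  change g r = ∫ s in (0 : ℝ)..r, h s.toNNReal
  rw [hi r r.2]
  refine intervalIntegral.integral_congr fun s hs => ?_
  rw [uIcc_of_le r.coe_nonneg] at hs
  simp only [Real.coe_toNNReal s hs.1]

open Classical in
/-- The Lagrangian vector field on the state space. -/
def field (n : ℕ) (ω : ℝ → ℝ) (y : State) : State :=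
  -- The default value 0 never occurs at admissible states, by `field_apply`.
  if h : ∃ v : State, ∀ r : ℝ≥0, v.fn r = (velocity n ω (pos y) (jac y) r,
    jac y r * strain n ω (pos y) (jac y) r) then h.choose else 0

section Field

variable {a b F E : ℝ} {ω : ℝ → ℝ}

lemma field_apply (hn : 1 ≤ n) (hω : IsMomentum F ω) {y : State} (ha : 0 < a)
    (hy : Admissible a b y) (r : ℝ≥0) :
    (field n ω y).fn r = (velocity n ω (pos y) (jac y) r,
      jac y r * strain n ω (pos y) (jac y) r) := by
  have hp := hy.isProfile ha
  have hb : 0 < b := ha.trans_le hp.le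
  have hK := hp.sizeConst_pos (n := n) hω
  have hM := massConst_pos (n := n)
  have hex : ∃ v : State, ∀ r : ℝ≥0, v.fn r = (velocity n ω (pos y) (jac y) r,
      jac y r * strain n ω (pos y) (jac y) r) := by
    refine exists_state (g := velocity n ω (pos y) (jac y))
      (h := fun r => jac y r * strain n ω (pos y) (jac y) r)
      (C := max (sizeConst n F a) (b * (n * (sizeConst n F a * massConst n))))
      (hp.continuousOn_velocity hn hω) (hp.continuousOn.mul (hp.continuousOn_strain hn hω))
      (fun r hr => (hp.abs_velocity_le hn hω hr).trans (le_max_left _ _)) (fun r hr => ?_)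
      (fun r hr => hp.velocity_eq_integral hn hω hr)
    refine le_trans ?_ (le_max_right _ _)
    rw [abs_mul, abs_of_pos (hp.rho_pos hr)]
    gcongr
    · exact (hy r hr).2
    · exact abs_le_of_forall_pos (hp.continuousOn_strain hn hω)
        (fun r hr => hp.abs_strain_le hn hω hr) hr
  rw [field, dif_pos hex]
  exact hex.choose_spec r

lemma field_norm_le (hn : 1 ≤ n) (hω : IsMomentum F ω) {y : State} (ha : 0 < a)
    (hy : Admissible a b y) :
    ‖field n ω y‖ ≤ max (sizeConst n F a) (b * (n * (sizeConst n F a * massConst n))) := by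
  have hp := hy.isProfile ha
  have hb : 0 < b := ha.trans_le hp.le
  have hK := hp.sizeConst_pos (n := n) hω
  have hM := massConst_pos (n := n)
  have : ‖(field n ω y).fn‖ ≤ max (sizeConst n F a) (b * (n * (sizeConst n F a * massConst n))) := by
    rw [BoundedContinuousFunction.norm_le (by positivity)]
    intro r
    rw [field_apply hn hω ha hy]
    refine max_le ((hp.abs_velocity_le hn hω r.2).trans (le_max_left _ _)) ?_
    refine le_trans ?_ (le_max_right _ _)
    simp only
    rw [Real.norm_eq_abs, abs_mul, abs_of_pos (hp.rho_pos r.coe_nonneg)]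
    gcongr
    · exact (hy r r.2).2
    · exact abs_le_of_forall_pos (hp.continuousOn_strain hn hω)
        (fun r hr => hp.abs_strain_le hn hω hr) r.2
  exact this

/-- The Lipschitz constant of the Lagrangian vector field. -/
def fieldLip (n : ℕ) (F a b E : ℝ) : ℝ :=
  velocityLip n F a b E + n * (sizeConst n F a * massConst n) +
    b * (n * (velocityLip n F a b E * massConst n))

lemma fieldLip_nonneg (hω : IsMomentum F ω) {y : State} (ha : 0 < a)
    (hy : Admissible a b y) (hE : 0 ≤ E) : 0 ≤ fieldLip n F a b E := by
  have hp := hy.isProfile ha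
  have hb : 0 < b := ha.trans_le hp.le
  have hK := hp.sizeConst_pos (n := n) hω
  have hM := massConst_pos (n := n)
  have hV := hp.velocityLip_nonneg (n := n) hω hE
  unfold fieldLip
  positivity

/-- The norm of `State` controls γ and ρ simultaneously, so D = ‖y - z‖ can be fed into
`velocity_diff_le` and `strain_diff_le`; the factor ρ in the second component adds one product-rule
term. -/
lemma field_lipschitz (hn : 1 ≤ n) (hω : IsMomentum F ω) {y z : State} (ha : 0 < a)
    (hy : Admissible a b y) (hz : Admissible a b z) (hE : ‖y - z‖ ≤ E) :
    ‖field n ω y - field n ω z‖ ≤ fieldLip n F a b E * ‖y - z‖ := by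
  have hp := hy.isProfile ha
  have hp' := hz.isProfile ha
  have hb : 0 < b := ha.trans_le hp.le
  have hE0 : 0 ≤ E := (norm_nonneg (y - z)).trans hE
  have hK := hp.sizeConst_pos (n := n) hω
  have hM := massConst_pos (n := n)
  have hV := hp.velocityLip_nonneg (n := n) hω hE0
  have hL := fieldLip_nonneg (n := n) (E := E) hω ha hy hE0
  set D := ‖y - z‖ with hD
  have hD0 : 0 ≤ D := norm_nonneg (y - z)
  have hγ : ∀ s, 0 ≤ s → |pos y s - pos z s| ≤ D := fun s _ => abs_pos_sub_le y z s
  have hρ : ∀ s, 0 ≤ s → |jac y s - jac z s| ≤ D := fun s _ => abs_jac_sub_le y z s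
  have hv : ∀ r, 0 ≤ r → |velocity n ω (pos y) (jac y) r - velocity n ω (pos z) (jac z) r| ≤
      fieldLip n F a b E * D := by
    intro r hr
    refine abs_le_of_forall_pos (f := fun r => velocity n ω (pos y) (jac y) r -
      velocity n ω (pos z) (jac z) r)
      ((hp.continuousOn_velocity hn hω).sub (hp'.continuousOn_velocity hn hω)) (fun r hr => ?_) hr
    refine (velocity_diff_le hn hp hp' hω hE hγ hρ hr).trans ?_
    gcongr
    have h1 : 0 ≤ n * (sizeConst n F a * massConst n) := by positivity
    have h2 : 0 ≤ b * (n * (velocityLip n F a b E * massConst n)) := by positivity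
    unfold fieldLip
    linarith
  have hs : ∀ r, 0 ≤ r → |jac y r * strain n ω (pos y) (jac y) r -
      jac z r * strain n ω (pos z) (jac z) r| ≤ fieldLip n F a b E * D := by
    intro r hr
    refine abs_le_of_forall_pos (f := fun r => jac y r * strain n ω (pos y) (jac y) r -
      jac z r * strain n ω (pos z) (jac z) r)
      ((hp.continuousOn.mul (hp.continuousOn_strain hn hω)).sub
        (hp'.continuousOn.mul (hp'.continuousOn_strain hn hω))) (fun r hr => ?_) hr
    have e : jac y r * strain n ω (pos y) (jac y) r - jac z r * strain n ω (pos z) (jac z) r =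
      (jac y r - jac z r) * strain n ω (pos y) (jac y) r + jac z r *
        (strain n ω (pos y) (jac y) r - strain n ω (pos z) (jac z) r) := by ring
    rw [e]
    calc _ ≤ |jac y r - jac z r| * |strain n ω (pos y) (jac y) r| + jac z r *
          |strain n ω (pos y) (jac y) r - strain n ω (pos z) (jac z) r| := by
          refine (abs_add_le _ _).trans ?_
          rw [abs_mul, abs_mul, abs_of_pos (hp'.rho_pos hr.le)]
      _ ≤ D * (n * (sizeConst n F a * massConst n)) +
          b * (n * (velocityLip n F a b E * D * massConst n)) := by
          gcongr
          · exact hρ r hr.le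
          · exact hp.abs_strain_le hn hω hr
          · exact (hz r hr.le).2
          · exact strain_diff_le hn hp hp' hω hE hγ hρ hr
      _ ≤ fieldLip n F a b E * D := by
          have : 0 ≤ velocityLip n F a b E * D := by positivity
          unfold fieldLip
          linarith
  have : ‖(field n ω y - field n ω z).fn‖ ≤ fieldLip n F a b E * D := by
    rw [BoundedContinuousFunction.norm_le (by positivity)]
    intro r
    have e : (field n ω y - field n ω z).fn r = (field n ω y).fn r - (field n ω z).fn r := rfl
    rw [e, field_apply hn hω ha hy, field_apply hn hω ha hz]
    exact max_le (hv r r.2) (hs r r.2)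
  exact this

end Field

end RadialEPDiff
end

/-! ### Local existence, uniqueness, continuation and maximal solutions. -/

noncomputable section

namespace RadialEPDiff

open scoped NNReal BoundedContinuousFunction

section ODE

variable {X : Type*} [NormedAddCommGroup X] [NormedSpace ℝ X]

/-- Picard–Lindelöf, with the information that the solution stays in the ball. -/
lemma exists_solution_mem_closedBall [CompleteSpace X] {f : ℝ → X → X} {tmin tmax : ℝ}
    {t₀ : Icc tmin tmax} {x₀ x : X} {a r L K : ℝ≥0} (hf : IsPicardLindelof f t₀ x₀ a r L K)
    (hx : x ∈ Metric.closedBall x₀ r) :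
    ∃ α : ℝ → X, α t₀ = x ∧ ∀ t ∈ Icc tmin tmax, α t ∈ Metric.closedBall x₀ a ∧
      HasDerivWithinAt α (f t (α t)) (Icc tmin tmax) t := by
  obtain ⟨α, hα⟩ := ODE.FunSpace.exists_isFixedPt_next hf hx
  refine ⟨α.compProj, by rw [ODE.FunSpace.compProj_val, ← hα, ODE.FunSpace.next_apply₀],
    fun t ht => ⟨α.compProj_mem_closedBall hf.mul_max_le, ?_⟩⟩
  apply ODE.hasDerivWithinAt_picard_Icc t₀.2 hf.continuousOn_uncurry
    α.continuous_compProj.continuousOn (fun _ _ => α.compProj_mem_closedBall hf.mul_max_le)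
    x ht |>.congr_of_mem _ ht
  intro t' ht'
  nth_rw 1 [← hα]
  rw [ODE.FunSpace.compProj_of_mem ht', ODE.FunSpace.next_apply]

/-- Both pieces have the same one-sided derivative at t₀ because the field is autonomous and the
values agree. -/
lemma hasDerivWithinAt_glue {V : X → X} {y z : ℝ → X} {t₀ T : ℝ}
    (hy : ∀ t ∈ Icc 0 t₀, HasDerivWithinAt y (V (y t)) (Icc 0 t₀) t)
    (hz : ∀ t ∈ Ico t₀ T, HasDerivWithinAt z (V (z t)) (Ico t₀ T) t) (h0 : z t₀ = y t₀) {t : ℝ}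
    (ht : t ∈ Ico 0 T) :
    HasDerivWithinAt (fun t => if t ≤ t₀ then y t else z t)
      (V (if t ≤ t₀ then y t else z t)) (Ico 0 T) t := by
  set w : ℝ → X := fun t => if t ≤ t₀ then y t else z t with hw
  have ew1 : ∀ s ∈ Icc 0 t₀, w s = y s := fun s hs => by simp [hw, hs.2]
  have ew2 : ∀ s ∈ Ico t₀ T, w s = z s := fun s hs => by
    rcases hs.1.eq_or_lt with h | h
    · simp [hw, ← h, h0]
    · simp [hw, not_le.2 h]
  have d1 : ∀ s ∈ Icc 0 t₀, HasDerivWithinAt w (V (w s)) (Icc 0 t₀) s := fun s hs => by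
    rw [ew1 s hs]
    exact (hy s hs).congr ew1 (ew1 s hs)
  have d2 : ∀ s ∈ Ico t₀ T, HasDerivWithinAt w (V (w s)) (Ico t₀ T) s := fun s hs => by
    rw [ew2 s hs]
    exact (hz s hs).congr ew2 (ew2 s hs)
  change HasDerivWithinAt w (V (w t)) (Ico 0 T) t
  rcases lt_trichotomy t t₀ with h | h | h
  · refine (d1 t ⟨ht.1, h.le⟩).mono_of_mem_nhdsWithin ?_
    filter_upwards [self_mem_nhdsWithin, mem_nhdsWithin_of_mem_nhds (Iio_mem_nhds h)] with s h1 h2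
    exact ⟨h1.1, le_of_lt h2⟩
  · subst h
    refine ((d1 t ⟨ht.1, le_rfl⟩).union (d2 t ⟨le_rfl, ht.2⟩)).mono fun s hs => ?_
    rcases le_total s t with h | h
    · exact Or.inl ⟨hs.1, h⟩
    · exact Or.inr ⟨h, hs.2⟩
  · refine (d2 t ⟨h.le, ht.2⟩).mono_of_mem_nhdsWithin ?_
    filter_upwards [self_mem_nhdsWithin, mem_nhdsWithin_of_mem_nhds (Ioi_mem_nhds h)] with s h1 h2
    exact ⟨le_of_lt h2, h1.2⟩

end ODE

variable {n : ℕ} {F : ℝ} {ω : ℝ → ℝ}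

/-- A solution of the Lagrangian equations on `[0,T)`, as a curve in the state space. -/
structure IsFlow (n : ℕ) (ω : ℝ → ℝ) (T : ℝ) (y : ℝ → State) : Prop where
  init : y 0 = 0
  bounds : ∀ τ ∈ Ico 0 T, ∃ a b : ℝ, 0 < a ∧ ∀ t ∈ Icc 0 τ, Admissible a b (y t)
  equation : ∀ t ∈ Ico 0 T, HasDerivWithinAt y (field n ω (y t)) (Ico 0 T) t

lemma Admissible.mono {a b a' b' : ℝ} {y : State} (h : Admissible a b y) (ha : a' ≤ a)
    (hb : b ≤ b') : Admissible a' b' y := fun r hr => ⟨ha.trans (h r hr).1, (h r hr).2.trans hb⟩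

lemma Admissible.of_norm_sub_le {a b c : ℝ} {y z : State} (h : Admissible a b z)
    (hyz : ‖y - z‖ ≤ c) : Admissible (a - c) (b + c) y := fun r hr => by
  have h1 := abs_le.1 ((abs_jac_sub_le y z r).trans hyz)
  have h2 := h r hr
  exact ⟨by linarith [h1.1], by linarith [h1.2]⟩

lemma admissible_zero : Admissible 1 1 (0 : State) := fun r _ => by
  have : jac 0 r = 1 := add_zero 1
  rw [this]
  exact ⟨le_rfl, le_rfl⟩

/-- Local existence, on a time interval whose length depends only on the bounds for the data. -/
lemma exists_local_solution (hn : 1 ≤ n) (hω : IsMomentum F ω) {a b : ℝ} (ha : 0 < a)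
    (hab : a ≤ b) : ∃ ε : ℝ, 0 < ε ∧ ∀ (t₀ : ℝ) (y₀ : State), Admissible a b y₀ →
      ∃ z : ℝ → State, z t₀ = y₀ ∧ ∀ t ∈ Icc t₀ (t₀ + ε),
        Admissible (a / 2) (b + a / 2) (z t) ∧
          HasDerivWithinAt z (field n ω (z t)) (Icc t₀ (t₀ + ε)) t := by
  have ha2 : 0 < a / 2 := by positivity
  have hb : 0 < b + a / 2 := by linarith
  have hM := massConst_pos (n := n)
  have hF := hω.pos
  set L : ℝ := max (sizeConst n F (a / 2))
    ((b + a / 2) * (n * (sizeConst n F (a / 2) * massConst n))) with hL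
  have hL0 : 0 < L := lt_of_lt_of_le (by unfold sizeConst; positivity) (le_max_left _ _)
  -- In the ball of radius a/2 the lower bound for ρ is still a/2 and the field has norm at most L,
  -- so the ball cannot be left before time (a/2)/L.
  refine ⟨a / 2 / L, by positivity, fun t₀ y₀ hy₀ => ?_⟩
  have hball : ∀ y ∈ Metric.closedBall y₀ (a / 2), Admissible (a / 2) (b + a / 2) y := by
    intro y hy
    rw [mem_closedBall_iff_norm] at hy
    exact (hy₀.of_norm_sub_le hy).mono (by linarith) le_rfl
  -- Here E = a is the diameter of that ball.
  have hK := fieldLip_nonneg (n := n) (E := a) hω ha2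
    (hball y₀ (Metric.mem_closedBall_self ha2.le)) ha.le
  have hP : IsPicardLindelof (fun _ => field n ω) (tmin := t₀) (tmax := t₀ + a / 2 / L)
      ⟨t₀, le_rfl, by have : 0 < a / 2 / L := by positivity
                      linarith⟩ y₀ ⟨a / 2, ha2.le⟩ 0 ⟨L, hL0.le⟩
      ⟨fieldLip n F (a / 2) (b + a / 2) a, hK⟩ := by
    refine IsPicardLindelof.of_time_independent (fun y hy => ?_) ?_ ?_
    · exact field_norm_le hn hω ha2 (hball y hy)
    · refine LipschitzOnWith.of_dist_le_mul fun y hy z hz => ?_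
      rw [dist_eq_norm, dist_eq_norm]
      refine field_lipschitz hn hω ha2 (hball y hy) (hball z hz) ?_
      have h1 := mem_closedBall_iff_norm.1 hy
      have h2 := mem_closedBall_iff_norm.1 hz
      have h3 : ‖y - z‖ ≤ ‖y - y₀‖ + ‖z - y₀‖ := by
        rw [← dist_eq_norm, ← dist_eq_norm, ← dist_eq_norm]
        exact dist_triangle_right _ _ _
      change ‖y - y₀‖ ≤ a / 2 at h1
      change ‖z - y₀‖ ≤ a / 2 at h2
      linarith
    · have : 0 ≤ a / 2 / L := by positivity
      change L * max (t₀ + a / 2 / L - t₀) (t₀ - t₀) ≤ a / 2 - 0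
      rw [add_sub_cancel_left, sub_self, max_eq_left this, mul_div_cancel₀ _ hL0.ne', sub_zero]
  obtain ⟨z, hz0, hz⟩ := exists_solution_mem_closedBall hP (Metric.mem_closedBall_self le_rfl)
  exact ⟨z, hz0, fun t ht => ⟨hball _ (hz t ht).1, (hz t ht).2⟩⟩

lemma exists_isFlow (hn : 1 ≤ n) (hω : IsMomentum F ω) :
    ∃ T : ℝ, 0 < T ∧ ∃ y, IsFlow n ω T y := by
  obtain ⟨ε, hε, h⟩ := exists_local_solution (b := 1) hn hω one_pos le_rfl
  obtain ⟨z, hz0, hz⟩ := h 0 0 admissible_zero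
  rw [zero_add] at hz
  exact ⟨ε, hε, z, hz0, fun τ hτ => ⟨1 / 2, 1 + 1 / 2, by norm_num, fun t ht =>
    (hz t ⟨ht.1, ht.2.trans hτ.2.le⟩).1⟩, fun t ht =>
    (hz t ⟨ht.1, ht.2.le⟩).2.mono Ico_subset_Icc_self⟩

lemma IsFlow.mono {T T' : ℝ} {y : ℝ → State} (h : IsFlow n ω T y) (hT : T' ≤ T) :
    IsFlow n ω T' y where
  init := h.init
  bounds := fun τ hτ => h.bounds τ ⟨hτ.1, hτ.2.trans_le hT⟩
  equation := fun t ht => (h.equation t ⟨ht.1, ht.2.trans_le hT⟩).mono (Ico_subset_Ico_right hT)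

lemma IsFlow.continuousOn {T : ℝ} {y : ℝ → State} (h : IsFlow n ω T y) :
    ContinuousOn y (Ico 0 T) := fun t ht => (h.equation t ht).continuousWithinAt

lemma IsFlow.hasDerivWithinAt_Ici {T t : ℝ} {y : ℝ → State} (h : IsFlow n ω T y)
    (ht : t ∈ Ico 0 T) : HasDerivWithinAt y (field n ω (y t)) (Ici t) t := by
  refine (h.equation t ht).mono_of_mem_nhdsWithin ?_
  filter_upwards [self_mem_nhdsWithin, mem_nhdsWithin_of_mem_nhds (Iio_mem_nhds ht.2)] with s h1 h2
  exact ⟨ht.1.trans h1, h2⟩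

lemma IsFlow.eqOn (hn : 1 ≤ n) (hω : IsMomentum F ω) {T : ℝ} {y z : ℝ → State}
    (hy : IsFlow n ω T y) (hz : IsFlow n ω T z) : EqOn y z (Ico 0 T) := by
  intro τ hτ
  obtain ⟨a, b, ha, hab⟩ := hy.bounds τ hτ
  obtain ⟨a', b', ha', hab'⟩ := hz.bounds τ hτ
  have hsub : Icc 0 τ ⊆ Ico 0 T := Icc_subset_Ico_right hτ.2
  have cy := hy.continuousOn.mono hsub
  have cz := hz.continuousOn.mono hsub
  obtain ⟨M, hM⟩ := isCompact_Icc.exists_bound_of_continuousOn cy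
  obtain ⟨M', hM'⟩ := isCompact_Icc.exists_bound_of_continuousOn cz
  have ha0 : 0 < min a a' := lt_min ha ha'
  have h0 : (0 : ℝ) ∈ Icc 0 τ := ⟨le_rfl, hτ.1⟩
  have hN : 0 ≤ max M M' := (norm_nonneg (y 0)).trans ((hM 0 h0).trans (le_max_left _ _))
  -- The field is Lipschitz only on bounded sets of uniformly admissible states. On [0,τ] both
  -- curves stay in one such set, with diameter at most 2 max M M'.
  set s : Set State := {x | Admissible (min a a') (max b b') x ∧ ‖x‖ ≤ max M M'} with hs
  have hys : ∀ t ∈ Icc 0 τ, y t ∈ s := fun t ht =>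
    ⟨(hab t ht).mono (min_le_left _ _) (le_max_left _ _), (hM t ht).trans (le_max_left _ _)⟩
  have hzs : ∀ t ∈ Icc 0 τ, z t ∈ s := fun t ht =>
    ⟨(hab' t ht).mono (min_le_right _ _) (le_max_right _ _), (hM' t ht).trans (le_max_right _ _)⟩
  have hK := fieldLip_nonneg (n := n) (E := 2 * max M M') hω ha0 (hys 0 h0).1 (by positivity)
  have hlip : LipschitzOnWith ⟨fieldLip n F (min a a') (max b b') (2 * max M M'), hK⟩
      (field n ω) s := by
    refine LipschitzOnWith.of_dist_le_mul fun u hu v hv => ?_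
    rw [dist_eq_norm, dist_eq_norm]
    refine field_lipschitz hn hω ha0 hu.1 hv.1 ?_
    have h1 := hu.2
    have h2 := hv.2
    have h3 : ‖u - v‖ ≤ ‖u‖ + ‖v‖ := norm_sub_le u v
    linarith
  exact ODE_solution_unique_of_mem_Icc_right (v := fun _ => field n ω) (s := fun _ => s)
    (fun t _ => hlip) cy
    (fun t ht => hy.hasDerivWithinAt_Ici (hsub (Ico_subset_Icc_self ht)))
    (fun t ht => hys t (Ico_subset_Icc_self ht)) cz
    (fun t ht => hz.hasDerivWithinAt_Ici (hsub (Ico_subset_Icc_self ht)))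
    (fun t ht => hzs t (Ico_subset_Icc_self ht)) (hy.init.trans hz.init.symm) ⟨hτ.1, le_rfl⟩

/-- A solution with uniform bounds on `[0,T)` can be continued beyond `T`. -/
lemma IsFlow.exists_extension (hn : 1 ≤ n) (hω : IsMomentum F ω) {T : ℝ} (hT : 0 < T)
    {y : ℝ → State} (hy : IsFlow n ω T y) {a b : ℝ} (ha : 0 < a)
    (hab : ∀ t ∈ Ico 0 T, Admissible a b (y t)) : ∃ T' : ℝ, T < T' ∧ ∃ z, IsFlow n ω T' z := by
  have h00 : (0 : ℝ) ∈ Ico 0 T := ⟨le_rfl, hT⟩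
  have hle : a ≤ b := ((hab 0 h00).isProfile ha).le
  obtain ⟨ε, hε, hloc⟩ := exists_local_solution hn hω ha hle
  -- The uniform bounds give an existence time ε independent of the starting time, so a restart
  -- within ε/2 of T passes beyond T.
  set t₀ := max 0 (T - ε / 2) with ht₀
  have ht0 : t₀ ∈ Ico 0 T := ⟨le_max_left _ _, max_lt hT (by linarith)⟩
  obtain ⟨z, hz0, hz⟩ := hloc t₀ (y t₀) (hab t₀ ht0)
  have hsub : Icc 0 t₀ ⊆ Ico 0 T := Icc_subset_Ico_right ht0.2
  refine ⟨t₀ + ε, by have := le_max_right 0 (T - ε / 2)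
                     linarith, fun t => if t ≤ t₀ then y t else z t, ?_, ?_, ?_⟩
  · simp [ht0.1, hy.init]
  · intro τ hτ
    refine ⟨a / 2, b + a / 2, by positivity, fun t ht => ?_⟩
    by_cases h : t ≤ t₀
    · simp only [if_pos h]
      exact (hab t (hsub ⟨ht.1, h⟩)).mono (by linarith) (by linarith)
    · simp only [if_neg h]
      exact (hz t ⟨(not_le.1 h).le, ht.2.trans hτ.2.le⟩).1
  · intro t ht
    exact hasDerivWithinAt_glue (V := field n ω)
      (fun s hs => (hy.equation s (hsub hs)).mono hsub)
      (fun s hs => (hz s ⟨hs.1, hs.2.le⟩).2.mono Ico_subset_Icc_self) hz0 ht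

/-- If the lifetimes of solutions are bounded, there is a maximal solution. -/
lemma exists_maximal_isFlow (hn : 1 ≤ n) (hω : IsMomentum F ω) {T₁ : ℝ}
    (hT₁ : ∀ T y, 0 < T → IsFlow n ω T y → T ≤ T₁) :
    ∃ T : ℝ, 0 < T ∧ (∃ y, IsFlow n ω T y) ∧ ∀ T' y, 0 < T' → IsFlow n ω T' y → T' ≤ T := by
  set A : Set ℝ := {T | 0 < T ∧ ∃ y, IsFlow n ω T y} with hA
  have hne : A.Nonempty := exists_isFlow hn hω
  have hbdd : BddAbove A := ⟨T₁, fun T hT => by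
    obtain ⟨h0, y, hy⟩ := hT
    exact hT₁ T y h0 hy⟩
  obtain ⟨T₂, hT₂⟩ := hne
  have hTpos : 0 < sSup A := hT₂.1.trans_le (le_csSup hbdd hT₂)
  refine ⟨sSup A, hTpos, ?_, fun T' y h0 hy => le_csSup hbdd ⟨h0, y, hy⟩⟩
  -- For every t pick a solution Y t that lives beyond t. By uniqueness these agree, and the
  -- diagonal t ↦ Y t t is a solution up to the supremum.
  have hch : ∀ t : ℝ, ∃ (T : ℝ) (y : ℝ → State), t < sSup A → t < T ∧ IsFlow n ω T y := by
    intro t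
    by_cases h : t < sSup A
    · obtain ⟨T, ⟨_, y, hy⟩, htT⟩ := exists_lt_of_lt_csSup ⟨T₂, hT₂⟩ h
      exact ⟨T, y, fun _ => ⟨htT, hy⟩⟩
    · exact ⟨0, 0, fun h' => absurd h' h⟩
  choose τ Y hY using hch
  have hagree : ∀ t ∈ Ico 0 (sSup A), ∀ s, 0 ≤ s → s < τ t → s < sSup A → Y s s = Y t s := by
    intro t ht s hs hst hsS
    have h1 := (hY s hsS)
    have h2 := (hY t ht.2)
    exact (h1.2.mono (min_le_left (τ s) (τ t))).eqOn hn hω (h2.2.mono (min_le_right _ _))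
      ⟨hs, lt_min h1.1 hst⟩
  refine ⟨fun t => Y t t, (hY 0 hTpos).2.init, fun t ht => ?_, fun t ht => ?_⟩
  · obtain ⟨a, b, ha, hab⟩ := (hY t ht.2).2.bounds t ⟨ht.1, (hY t ht.2).1⟩
    refine ⟨a, b, ha, fun s hs => ?_⟩
    rw [hagree t ht s hs.1 (hs.2.trans_lt (hY t ht.2).1) (hs.2.trans_lt ht.2)]
    exact hab s hs
  · have h := (hY t ht.2).2.equation t ⟨ht.1, (hY t ht.2).1⟩
    have h1 : HasDerivWithinAt (Y t) (field n ω (Y t t)) (Ico 0 (sSup A)) t := by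
      refine h.mono_of_mem_nhdsWithin ?_
      filter_upwards [self_mem_nhdsWithin,
        mem_nhdsWithin_of_mem_nhds (Iio_mem_nhds (hY t ht.2).1)] with s h1 h2
      exact ⟨h1.1, h2⟩
    refine h1.congr_of_eventuallyEq ?_ rfl
    filter_upwards [self_mem_nhdsWithin,
      mem_nhdsWithin_of_mem_nhds (Iio_mem_nhds (hY t ht.2).1)] with s h1 h2
    exact hagree t ht s h1.1 h2 h1.2

end RadialEPDiff
end

/-! ### Pointwise Lagrangian solutions are curves in the state space. -/

noncomputable section

namespace RadialEPDiff

open scoped NNReal BoundedContinuousFunction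

variable {n : ℕ} {F T : ℝ} {ω : ℝ → ℝ}

/-- Evaluation of states at a point. -/
def evalState (r : ℝ≥0) : State →L[ℝ] ℝ × ℝ :=
  LinearMap.mkContinuous ⟨⟨fun y => y.fn r, fun _ _ => rfl⟩, fun _ _ => rfl⟩ 1
    fun y => by
      rw [one_mul]
      exact y.fn.norm_coe_le_norm r

lemma State.norm_le {x : State} {C : ℝ} (hC : 0 ≤ C) (h : ∀ r, ‖x.fn r‖ ≤ C) : ‖x‖ ≤ C :=
  (BoundedContinuousFunction.norm_le hC).2 h

lemma IsFlow.hasDerivWithinAt_fn {y : ℝ → State} (hy : IsFlow n ω T y) {t : ℝ} (ht : t ∈ Ico 0 T)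
    (r : ℝ≥0) :
    HasDerivWithinAt (fun τ => (y τ).fn r) ((field n ω (y t)).fn r) (Ico 0 T) t :=
  (evalState r).hasFDerivAt.comp_hasDerivWithinAt t (hy.equation t ht)

lemma IsFlow.exists_admissible {y : ℝ → State} (hy : IsFlow n ω T y) {t : ℝ} (ht : t ∈ Ico 0 T) :
    ∃ a b : ℝ, 0 < a ∧ Admissible a b (y t) := by
  obtain ⟨a, b, ha, h⟩ := hy.bounds t ht
  exact ⟨a, b, ha, h t ⟨ht.1, le_rfl⟩⟩

lemma IsFlow.hasDerivWithinAt_pos (hn : 1 ≤ n) (hω : IsMomentum F ω) {y : ℝ → State}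
    (hy : IsFlow n ω T y) {t r : ℝ} (ht : t ∈ Ico 0 T) (hr : 0 ≤ r) :
    HasDerivWithinAt (fun τ => pos (y τ) r) (velocity n ω (pos (y t)) (jac (y t)) r)
      (Ico 0 T) t := by
  obtain ⟨a, b, ha, h⟩ := hy.exists_admissible ht
  have h1 := hy.hasDerivWithinAt_fn ht r.toNNReal
  rw [field_apply hn hω ha h, Real.coe_toNNReal r hr] at h1
  exact ((hasFDerivAt_fst (𝕜 := ℝ)).comp_hasDerivWithinAt t h1).const_add r

lemma IsFlow.hasDerivWithinAt_jac (hn : 1 ≤ n) (hω : IsMomentum F ω) {y : ℝ → State}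
    (hy : IsFlow n ω T y) {t r : ℝ} (ht : t ∈ Ico 0 T) (hr : 0 ≤ r) :
    HasDerivWithinAt (fun τ => jac (y τ) r) (jac (y t) r * strain n ω (pos (y t)) (jac (y t)) r)
      (Ico 0 T) t := by
  obtain ⟨a, b, ha, h⟩ := hy.exists_admissible ht
  have h1 := hy.hasDerivWithinAt_fn ht r.toNNReal
  rw [field_apply hn hω ha h, Real.coe_toNNReal r hr] at h1
  exact ((hasFDerivAt_snd (𝕜 := ℝ)).comp_hasDerivWithinAt t h1).const_add 1

lemma pos_zero_state (r : ℝ) : pos 0 r = r := add_zero r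

lemma jac_zero_state (r : ℝ) : jac 0 r = 1 := add_zero 1

/-- A curve in the state space solves the Lagrangian equations. -/
lemma IsFlow.isLagrangianSolution (hn : 1 ≤ n) (hω : IsMomentum F ω) {y : ℝ → State}
    (hy : IsFlow n ω T y) :
    IsLagrangianSolution n ω T (fun t => pos (y t)) (fun t => jac (y t)) where
  gamma_init := fun r _ => by rw [hy.init, pos_zero_state]
  rho_init := fun r _ => by rw [hy.init, jac_zero_state]
  gamma_zero := fun t ht => by
    obtain ⟨a, b, ha, h⟩ := hy.exists_admissible ht
    exact (h.isProfile ha).zero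
  gamma_deriv := fun t ht => by
    obtain ⟨a, b, ha, h⟩ := hy.exists_admissible ht
    exact (h.isProfile ha).deriv
  rho_continuous := fun t _ => (continuous_jac (y t)).continuousOn
  rho_bounds := fun τ hτ => hy.bounds τ hτ
  gamma_equation := fun t ht r hr => by
    rw [gammaField_eq]
    exact hy.hasDerivWithinAt_pos hn hω ht hr
  rho_equation := fun t ht r hr => by
    obtain ⟨a, b, ha, h⟩ := hy.exists_admissible ht
    rw [rhoField_eq (h.isProfile ha) ω hr]
    exact hy.hasDerivWithinAt_jac hn hω ht hr

section Congr

variable {γ ρ γ' ρ' : ℝ → ℝ}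

lemma lagP_congr (hγ : ∀ s, 0 ≤ s → γ s = γ' s) (hρ : ∀ s, 0 ≤ s → ρ s = ρ' s) (r : ℝ) :
    lagP n ω γ ρ r = lagP n ω γ' ρ' r :=
  setIntegral_congr_fun measurableSet_Ioc fun s hs => by
    simp only [hγ s hs.1.le, hρ s hs.1.le]

lemma lagQ_congr (hγ : ∀ s, 0 ≤ s → γ s = γ' s) (hρ : ∀ s, 0 ≤ s → ρ s = ρ' s) {r : ℝ}
    (hr : 0 ≤ r) : lagQ n ω γ ρ r = lagQ n ω γ' ρ' r :=
  setIntegral_congr_fun measurableSet_Ioi fun s hs => by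
    have hs : 0 ≤ s := hr.trans (le_of_lt hs)
    simp only [hγ s hs, hρ s hs]

lemma velocity_congr (hγ : ∀ s, 0 ≤ s → γ s = γ' s) (hρ : ∀ s, 0 ≤ s → ρ s = ρ' s) {r : ℝ}
    (hr : 0 ≤ r) : velocity n ω γ ρ r = velocity n ω γ' ρ' r := by
  rw [velocity, velocity, lagP_congr hγ hρ, lagQ_congr hγ hρ hr, hγ r hr]

lemma strain_congr (hγ : ∀ s, 0 ≤ s → γ s = γ' s) (hρ : ∀ s, 0 ≤ s → ρ s = ρ' s) {r : ℝ}
    (hr : 0 ≤ r) : strain n ω γ ρ r = strain n ω γ' ρ' r := by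
  rw [strain, strain, lagP_congr hγ hρ, lagQ_congr hγ hρ hr, hγ r hr]

end Congr

section Pointwise

variable {y w : ℝ → State} {I : Set ℝ}

/-- The mean value inequality for each particle separately, with a constant independent of the
particle, followed by the supremum. -/
lemma norm_sub_sub_smul_le (hI : Convex ℝ I)
    (h : ∀ r, ∀ t ∈ I, HasDerivWithinAt (fun τ => (y τ).fn r) ((w t).fn r) I t) {v : State} {C : ℝ}
    (hC : 0 ≤ C) {s t : ℝ} (hs : s ∈ I) (ht : t ∈ I) (hv : ∀ x ∈ uIcc t s, ‖w x - v‖ ≤ C) :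
    ‖y s - y t - (s - t) • v‖ ≤ C * |s - t| := by
  refine State.norm_le (by positivity) fun r => ?_
  have hsub : uIcc t s ⊆ I := by
    rw [← segment_eq_uIcc]
    exact hI.segment_subset ht hs
  have hd : ∀ x ∈ uIcc t s, HasDerivWithinAt (fun τ => (y τ).fn r - τ • v.fn r)
      ((w x).fn r - v.fn r) (uIcc t s) x := fun x hx => by
    have h2 := (hasDerivWithinAt_id x (uIcc t s)).smul_const (v.fn r)
    rw [one_smul] at h2
    exact ((h r x (hsub hx)).mono hsub).sub h2
  have hmv := (convex_uIcc t s).norm_image_sub_le_of_norm_hasDerivWithin_le hd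
    (fun x hx => ((w x - v).fn.norm_coe_le_norm r).trans (hv x hx)) left_mem_uIcc right_mem_uIcc
  have e : (y s - y t - (s - t) • v).fn r =
      (y s).fn r - s • v.fn r - ((y t).fn r - t • v.fn r) := by
    change (y s).fn r - (y t).fn r - (s - t) • v.fn r = _
    rw [sub_smul]
    abel
  rw [e]
  exact hmv

/-- A curve with pointwise derivatives that depend continuously on time is differentiable. -/
lemma hasDerivWithinAt_of_pointwise (hI : Convex ℝ I)
    (h : ∀ r, ∀ t ∈ I, HasDerivWithinAt (fun τ => (y τ).fn r) ((w t).fn r) I t) {t : ℝ}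
    (ht : t ∈ I) (hw : ContinuousWithinAt w I t) : HasDerivWithinAt y (w t) I t := by
  rw [hasDerivWithinAt_iff_isLittleO, Asymptotics.isLittleO_iff]
  intro c hc
  obtain ⟨ε, hε, hb⟩ := Metric.continuousWithinAt_iff.1 hw c hc
  filter_upwards [self_mem_nhdsWithin, mem_nhdsWithin_of_mem_nhds (Metric.ball_mem_nhds t hε)]
    with s hs hst
  refine norm_sub_sub_smul_le hI h hc.le hs ht fun x hx => ?_
  rw [← dist_eq_norm]
  have hsub : uIcc t s ⊆ I := by
    rw [← segment_eq_uIcc]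
    exact hI.segment_subset ht hs
  refine (hb (hsub hx) ?_).le
  rw [Metric.mem_ball, Real.dist_eq] at hst
  rw [Real.dist_eq]
  exact (abs_sub_left_of_mem_uIcc hx).trans_lt hst

end Pointwise

lemma IsLagrangianSolution.isProfile {γ ρ : ℝ → ℝ → ℝ} (h : IsLagrangianSolution n ω T γ ρ)
    {a b t : ℝ} (ha : 0 < a) (ht : t ∈ Ico 0 T) (hab : ∀ r, 0 ≤ r → a ≤ ρ t r ∧ ρ t r ≤ b) :
    IsProfile a b (γ t) (ρ t) :=
  ⟨ha, h.gamma_zero t ht, h.gamma_deriv t ht, h.rho_continuous t ht, fun r hr => (hab r hr).1,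
    fun r hr => (hab r hr).2⟩

/-- The displacement γ - id is bounded in r, though no hypothesis says so: the velocity is bounded
by `sizeConst` and the time is finite. -/
lemma IsLagrangianSolution.exists_state (hn : 1 ≤ n) (hω : IsMomentum F ω) {γ ρ : ℝ → ℝ → ℝ}
    (h : IsLagrangianSolution n ω T γ ρ) {t : ℝ} (ht : t ∈ Ico 0 T) :
    ∃ y : State, ∀ r, 0 ≤ r → pos y r = γ t r ∧ jac y r = ρ t r := by
  obtain ⟨a, b, ha, hab⟩ := h.rho_bounds t ht
  have hsub : Icc 0 t ⊆ Ico 0 T := Icc_subset_Ico_right ht.2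
  have hp : ∀ s ∈ Icc 0 t, IsProfile a b (γ s) (ρ s) := fun s hs =>
    h.isProfile ha (hsub hs) (hab s hs)
  have htt : t ∈ Icc 0 t := ⟨ht.1, le_rfl⟩
  have hpt := hp t htt
  have hb : 0 < b := ha.trans_le hpt.le
  have hbound : ∀ r, 0 ≤ r → |γ t r - r| ≤ max (sizeConst n F a * t) (b + 1) := fun r hr => by
    have hmv := (convex_Icc 0 t).norm_image_sub_le_of_norm_hasDerivWithin_le
      (fun s hs => (h.gamma_equation s (hsub hs) r hr).mono hsub)
      (C := sizeConst n F a) (fun s hs => by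
        rw [gammaField_eq]
        exact (hp s hs).abs_velocity_le hn hω hr) (left_mem_Icc.2 ht.1) htt
    rw [h.gamma_init r hr, sub_zero, Real.norm_eq_abs, Real.norm_eq_abs, abs_of_nonneg ht.1] at hmv
    exact hmv.trans (le_max_left _ _)
  have hcont : ContinuousOn (fun r => ρ t r - 1) (Ici 0) := hpt.continuousOn.sub continuousOn_const
  obtain ⟨y, hy⟩ := RadialEPDiff.exists_state (g := fun r => γ t r - r) (h := fun r => ρ t r - 1)
    (hpt.gamma_continuousOn.sub continuousOn_id) hcont hbound
    (fun r hr => by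
      refine le_trans ?_ (le_max_right _ _)
      rw [abs_le]
      have h1 := hab t htt r hr
      constructor <;> linarith [h1.1, h1.2]) fun r hr => by
      rw [intervalIntegral.integral_eq_sub_of_hasDerivAt_of_le hr (f := fun r => γ t r - r)
        ((hpt.gamma_continuousOn.sub continuousOn_id).mono Icc_subset_Ici_self)
        (fun s hs => (hpt.hasDerivAt hs.1).sub (hasDerivAt_id s)), hpt.zero]
      · ring
      · rw [intervalIntegrable_iff_integrableOn_Ioc_of_le hr]
        exact integrableOn_Ioc_of_continuousOn hcont r
  refine ⟨y, fun r hr => ?_⟩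
  have h1 := hy r.toNNReal
  rw [Real.coe_toNNReal r hr] at h1
  simp only [pos, jac, h1]
  constructor <;> ring

/-- Every Lagrangian solution comes from a curve in the state space. -/
lemma IsLagrangianSolution.exists_isFlow (hn : 1 ≤ n) (hω : IsMomentum F ω) (hT : 0 < T)
    {γ ρ : ℝ → ℝ → ℝ} (h : IsLagrangianSolution n ω T γ ρ) :
    ∃ y : ℝ → State, IsFlow n ω T y ∧
      ∀ t ∈ Ico 0 T, ∀ r, 0 ≤ r → pos (y t) r = γ t r ∧ jac (y t) r = ρ t r := by
  have hex : ∀ t, ∃ y : State, t ∈ Ico 0 T → ∀ r, 0 ≤ r → pos y r = γ t r ∧ jac y r = ρ t r := by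
    intro t
    by_cases ht : t ∈ Ico 0 T
    · obtain ⟨y, hy⟩ := h.exists_state hn hω ht
      exact ⟨y, fun _ => hy⟩
    · exact ⟨0, fun h => absurd h ht⟩
  choose y hy using hex
  have hbd : ∀ τ ∈ Ico 0 T, ∃ a b : ℝ, 0 < a ∧ ∀ t ∈ Icc 0 τ, Admissible a b (y t) := by
    intro τ hτ
    obtain ⟨a, b, ha, hab⟩ := h.rho_bounds τ hτ
    refine ⟨a, b, ha, fun t ht r hr => ?_⟩
    rw [(hy t ⟨ht.1, ht.2.trans_lt hτ.2⟩ r hr).2]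
    exact hab t ht r hr
  have hpt : ∀ r : ℝ≥0, ∀ t ∈ Ico 0 T,
      HasDerivWithinAt (fun τ => (y τ).fn r) ((field n ω (y t)).fn r) (Ico 0 T) t := by
    intro r t ht
    obtain ⟨a, b, ha, hab⟩ := hbd t ht
    have hA := hab t ⟨ht.1, le_rfl⟩
    have e1 : ∀ s, 0 ≤ s → pos (y t) s = γ t s := fun s hs => (hy t ht s hs).1
    have e2 : ∀ s, 0 ≤ s → jac (y t) s = ρ t s := fun s hs => (hy t ht s hs).2
    have hprof : IsProfile a b (γ t) (ρ t) := h.isProfile ha ht fun s hs => by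
      rw [← e2 s hs]; exact hA s hs
    rw [field_apply hn hω ha hA, velocity_congr e1 e2 r.coe_nonneg, strain_congr e1 e2 r.coe_nonneg,
      e2 r r.coe_nonneg]
    have d1 := h.gamma_equation t ht r r.coe_nonneg
    have d2 := h.rho_equation t ht r r.coe_nonneg
    rw [gammaField_eq] at d1
    rw [rhoField_eq hprof ω r.coe_nonneg] at d2
    have e : ∀ s ∈ Ico 0 T, (y s).fn r = (γ s r - r, ρ s r - 1) := fun s hs => by
      have e3 := hy s hs r r.coe_nonneg
      simp only [pos, jac, Real.toNNReal_coe] at e3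
      rw [← e3.1, ← e3.2]
      ext <;> simp
    exact ((d1.sub_const _).prodMk (d2.sub_const _)).congr e (e t ht)
  refine ⟨y, ⟨?_, hbd, fun t ht => ?_⟩, hy⟩
  · have h0 : (0 : ℝ) ∈ Ico 0 T := ⟨le_rfl, hT⟩
    refine State.ext (fun r hr => ?_) fun r hr => ?_
    · rw [(hy 0 h0 r hr).1, pos_zero_state, h.gamma_init r hr]
    · rw [(hy 0 h0 r hr).2, jac_zero_state, h.rho_init r hr]
  · obtain ⟨τ, htτ, hτT⟩ := exists_between ht.2
    have hsub : Icc 0 τ ⊆ Ico 0 T := Icc_subset_Ico_right hτT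
    obtain ⟨a, b, ha, hab⟩ := hbd τ ⟨ht.1.trans htτ.le, hτT⟩
    have htI : t ∈ Icc 0 τ := ⟨ht.1, htτ.le⟩
    have hpt' : ∀ r : ℝ≥0, ∀ s ∈ Icc 0 τ,
      HasDerivWithinAt (fun τ => (y τ).fn r) ((field n ω (y s)).fn r) (Icc 0 τ) s :=
      fun r s hs => (hpt r s (hsub hs)).mono hsub
    set L := max (sizeConst n F a) (b * (n * (sizeConst n F a * massConst n)))
    have hL : ∀ s ∈ Icc 0 τ, ‖field n ω (y s)‖ ≤ L := fun s hs => field_norm_le hn hω ha (hab s hs)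
    have hL0 : 0 ≤ L := (norm_nonneg _).trans (hL t htI)
    -- From pointwise to norm differentiability: boundedness of the field makes the curve Lipschitz
    -- in norm, hence the field is continuous along it, and then `hasDerivWithinAt_of_pointwise`
    -- applies.
    have hlip : ∀ s ∈ Icc 0 τ, ‖y s - y t‖ ≤ L * |s - t| := fun s hs => by
      have := norm_sub_sub_smul_le (convex_Icc 0 τ) hpt' (v := 0) hL0 hs htI fun x hx => by
        rw [sub_zero]
        refine hL x ?_
        have hss : uIcc t s ⊆ Icc 0 τ := by
          rw [← segment_eq_uIcc]
          exact (convex_Icc 0 τ).segment_subset htI hs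
        exact hss hx
      rwa [smul_zero, sub_zero] at this
    have hτ0 : 0 ≤ τ := ht.1.trans htτ.le
    have hcont : ContinuousWithinAt (fun s => field n ω (y s)) (Icc 0 τ) t := by
      rw [ContinuousWithinAt, tendsto_iff_norm_sub_tendsto_zero]
      have hlim : Tendsto (fun s => fieldLip n F a b (L * τ) * (L * |s - t|)) (𝓝[Icc 0 τ] t)
          (𝓝 0) := by
        have : Continuous fun s => fieldLip n F a b (L * τ) * (L * |s - t|) := by fun_prop
        have h2 := this.tendsto t
        simp only [sub_self, abs_zero, mul_zero] at h2
        exact h2.mono_left nhdsWithin_le_nhds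
      refine squeeze_zero' (Eventually.of_forall fun s => norm_nonneg _) ?_ hlim
      filter_upwards [self_mem_nhdsWithin] with s hs
      have hE : ‖y s - y t‖ ≤ L * τ := by
        refine (hlip s hs).trans ?_
        gcongr
        rw [abs_le]
        constructor <;> linarith [hs.1, hs.2, ht.1]
      refine (field_lipschitz hn hω ha (hab s hs) (hab t htI) hE).trans ?_
      have := fieldLip_nonneg (n := n) (E := L * τ) hω ha (hab t htI) (by positivity)
      gcongr
      exact hlip s hs
    refine (hasDerivWithinAt_of_pointwise (convex_Icc 0 τ) hpt' htI hcont).mono_of_mem_nhdsWithin ?_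
    filter_upwards [self_mem_nhdsWithin, mem_nhdsWithin_of_mem_nhds (Iio_mem_nhds htτ)] with s h1 h2
    exact ⟨h1.1, le_of_lt h2⟩

end RadialEPDiff
end

/-! ### Monotone quantities and finite lifetime. -/

noncomputable section

namespace RadialEPDiff

open scoped NNReal BoundedContinuousFunction

section MeanValue

variable {f f' : ℝ → ℝ} {c t₁ t₂ : ℝ}

lemma mul_sub_le_image_sub (h12 : t₁ ≤ t₂)
    (h : ∀ t ∈ Icc t₁ t₂, HasDerivWithinAt f (f' t) (Icc t₁ t₂) t)
    (hc : ∀ t ∈ Icc t₁ t₂, c ≤ f' t) : c * (t₂ - t₁) ≤ f t₂ - f t₁ := by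
  have hm : MonotoneOn (fun t => f t - c * t) (Icc t₁ t₂) := by
    have hd : ∀ t ∈ Icc t₁ t₂,
        HasDerivWithinAt (fun t => f t - c * t) (f' t - c * 1) (Icc t₁ t₂) t := fun t ht =>
      (h t ht).sub ((hasDerivWithinAt_id t _).const_mul c)
    exact monotoneOn_of_hasDerivWithinAt_nonneg (convex_Icc _ _)
      (fun t ht => (hd t ht).continuousWithinAt)
      (fun t ht => (hd t (interior_subset ht)).mono interior_subset)
      fun t ht => by linarith [hc t (interior_subset ht)]
  have := hm (left_mem_Icc.2 h12) (right_mem_Icc.2 h12) h12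
  simp only at this
  linarith

lemma image_sub_le_mul_sub (h12 : t₁ ≤ t₂)
    (h : ∀ t ∈ Icc t₁ t₂, HasDerivWithinAt f (f' t) (Icc t₁ t₂) t)
    (hc : ∀ t ∈ Icc t₁ t₂, f' t ≤ c) : f t₂ - f t₁ ≤ c * (t₂ - t₁) := by
  have := mul_sub_le_image_sub (c := -c) h12 (fun t ht => (h t ht).neg)
    fun t ht => neg_le_neg (hc t ht)
  simp only [Pi.neg_apply] at this
  linarith

end MeanValue

/-- A discrete Riccati argument, which needs no regularity of f in time. -/
lemma lifetime_le_of_growth {f : ℝ → ℝ} {c T : ℝ} (hc : 0 < c) (h0 : 0 < f 0)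
    (h : ∀ t₁ t₂, 0 ≤ t₁ → t₁ ≤ t₂ → t₂ < T → f t₁ + c * (t₂ - t₁) * f t₁ ^ 2 ≤ f t₂) :
    T ≤ 2 / (c * f 0) := by
  by_contra! hT
  set d := 1 / (c * f 0) with hd
  have hd0 : 0 < d := by positivity
  have hT' : 2 * d < T := by rwa [hd, mul_one_div]
  -- The step from 2d(1 - 2^(-k)) has length d 2^(-k) and gains at least c d 2^(-k) (2^k f(0))² =
  -- 2^k f(0), since c d f(0) = 1; so the lower bound doubles. The times accumulate at 2d < T, where
  -- f would be infinite.
  have hk : ∀ k : ℕ, 2 ^ k * f 0 ≤ f (2 * d * (1 - (1 / 2) ^ k)) := by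
    intro k
    induction k with
    | zero => simp
    | succ k ih =>
      have hp : (0 : ℝ) < (1 / 2) ^ k := by positivity
      have hp1 : (1 / 2 : ℝ) ^ k ≤ 1 := pow_le_one₀ (by norm_num) (by norm_num)
      have h1 := h (2 * d * (1 - (1 / 2) ^ k)) (2 * d * (1 - (1 / 2) ^ (k + 1)))
        (by have : (0 : ℝ) ≤ 1 - (1 / 2) ^ k := by linarith
            positivity)
        (by gcongr 2 * d * (1 - ?_); exact pow_le_pow_of_le_one (by norm_num) (by norm_num)
              (Nat.le_succ k))
        (by have : (0 : ℝ) < (1 / 2) ^ (k + 1) := by positivity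
            nlinarith)
      refine le_trans ?_ h1
      have e : 2 * d * (1 - (1 / 2) ^ (k + 1)) - 2 * d * (1 - (1 / 2) ^ k) = d * (1 / 2) ^ k := by
        rw [pow_succ]; ring
      rw [e]
      set g := f (2 * d * (1 - (1 / 2) ^ k))
      have hsq : (2 ^ k * f 0) ^ 2 ≤ g ^ 2 := by gcongr
      have hcd : c * d * f 0 = 1 := by rw [hd]; field_simp
      have h22 : (1 / 2 : ℝ) ^ k * 2 ^ k = 1 := by rw [← mul_pow]; norm_num
      have : 2 ^ k * f 0 ≤ c * (d * (1 / 2) ^ k) * g ^ 2 := by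
        calc 2 ^ k * f 0 = c * (d * (1 / 2) ^ k) * (2 ^ k * f 0) ^ 2 := by
              linear_combination (-(2 ^ k * f 0)) * hcd -
                (c * d * f 0) * (2 ^ k * f 0) * h22
          _ ≤ _ := by gcongr
      rw [pow_succ]
      linarith
  have hbound : ∀ k : ℕ, 2 ^ k * f 0 ≤ f (2 * d) := fun k => by
    have hp : (0 : ℝ) < (1 / 2) ^ k := by positivity
    have hp1 : (1 / 2 : ℝ) ^ k ≤ 1 := pow_le_one₀ (by norm_num) (by norm_num)
    have h1 := h (2 * d * (1 - (1 / 2) ^ k)) (2 * d)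
      (by have : (0 : ℝ) ≤ 1 - (1 / 2) ^ k := by linarith
          positivity) (by nlinarith) hT'
    have h2 : 0 ≤ c * (2 * d - 2 * d * (1 - (1 / 2) ^ k)) * f (2 * d * (1 - (1 / 2) ^ k)) ^ 2 := by
      have : 2 * d - 2 * d * (1 - (1 / 2) ^ k) = 2 * d * (1 / 2) ^ k := by ring
      rw [this]
      positivity
    linarith [hk k]
  have hlim : Tendsto (fun k : ℕ => (2 : ℝ) ^ k * f 0) atTop atTop :=
    (tendsto_pow_atTop_atTop_of_one_lt (by norm_num)).atTop_mul_const h0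
  obtain ⟨k, hk⟩ := (hlim.eventually_gt_atTop (f (2 * d))).exists
  linarith [hbound k]

variable {n : ℕ} {F T a b : ℝ} {ω : ℝ → ℝ}

/-- `q(γ)/ρ`. -/
def weightQ (n : ℕ) (y : State) (s : ℝ) : ℝ := kerQ n (pos y s) / jac y s

/-- `p(γ)/ρ`. -/
def weightP (n : ℕ) (y : State) (s : ℝ) : ℝ := kerP n (pos y s) / jac y s

/-- `∫₀^r p(γ)/ρ |z₀| ds` for `z₀ ≤ 0`. -/
def momentP (n : ℕ) (ω : ℝ → ℝ) (y : State) (r : ℝ) : ℝ := -lagP n ω (pos y) (jac y) r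

/-- `∫_r^∞ q(γ)/ρ |z₀| ds` for `z₀ ≤ 0`. -/
def momentQ (n : ℕ) (ω : ℝ → ℝ) (y : State) (r : ℝ) : ℝ := -lagQ n ω (pos y) (jac y) r

lemma velocity_eq_moment (y : State) (r : ℝ) : velocity n ω (pos y) (jac y) r =
    -(kerQ n (pos y r) * momentP n ω y r + kerP n (pos y r) * momentQ n ω y r) := by
  rw [velocity, momentP, momentQ]; ring

lemma strain_eq_moment (y : State) (r : ℝ) : strain n ω (pos y) (jac y) r =
    -(kerQ' n (pos y r) * momentP n ω y r + kerP' n (pos y r) * momentQ n ω y r) := by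
  rw [strain, momentP, momentQ]; ring

section Signs

variable {y z : State}

lemma momentP_nonneg (hneg : ∀ s, 0 ≤ s → ω s ≤ 0) (ha : 0 < a) (hy : Admissible a b y)
    (r : ℝ) : 0 ≤ momentP n ω y r := by
  refine neg_nonneg.2 (setIntegral_nonpos measurableSet_Ioc fun s hs => ?_)
  have h := hy.isProfile ha
  have h1 := kerP_pos (n := n) (h.gamma_pos hs.1)
  have h2 := h.rho_pos hs.1.le
  have h3 := hs.1
  exact mul_nonpos_of_nonneg_of_nonpos (by positivity)
    (mul_nonpos_of_nonneg_of_nonpos (by positivity) (hneg s hs.1.le))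

lemma momentQ_nonneg (hneg : ∀ s, 0 ≤ s → ω s ≤ 0) (ha : 0 < a) (hy : Admissible a b y) {r : ℝ}
    (hr : 0 ≤ r) :
    0 ≤ momentQ n ω y r := by
  refine neg_nonneg.2 (setIntegral_nonpos measurableSet_Ioi fun s hs => ?_)
  have h := hy.isProfile ha
  have hs : 0 < s := lt_of_le_of_lt hr hs
  have h1 := kerQ_pos (n := n) (h.gamma_pos hs)
  have h2 := h.rho_pos hs.le
  exact mul_nonpos_of_nonneg_of_nonpos (by positivity)
    (mul_nonpos_of_nonneg_of_nonpos (by positivity) (hneg s hs.le))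

lemma momentP_le_momentP (hneg : ∀ s, 0 ≤ s → ω s ≤ 0) (hω : IsMomentum F ω) (ha : 0 < a)
    (hy : Admissible a b y)
    (hz : Admissible a b z) {r : ℝ} (h : ∀ s, 0 < s → weightP n y s ≤ weightP n z s) :
    momentP n ω y r ≤ momentP n ω z r := by
  refine neg_le_neg (setIntegral_mono_on ((hz.isProfile ha).integrableOn_lagP hω r)
    ((hy.isProfile ha).integrableOn_lagP hω r) measurableSet_Ioc fun s hs => ?_)
  have hs := hs.1
  exact mul_le_mul_of_nonpos_right (h s hs)
    (mul_nonpos_of_nonneg_of_nonpos (by positivity) (hneg s hs.le))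

lemma momentQ_le_momentQ (hneg : ∀ s, 0 ≤ s → ω s ≤ 0) (hn : 1 ≤ n) (hω : IsMomentum F ω)
    (ha : 0 < a) (hy : Admissible a b y)
    (hz : Admissible a b z) {r : ℝ} (hr : 0 ≤ r)
    (h : ∀ s, 0 < s → weightQ n y s ≤ weightQ n z s) : momentQ n ω y r ≤ momentQ n ω z r := by
  refine neg_le_neg (setIntegral_mono_on
    (((hz.isProfile ha).integrableOn_lagQ hn hω).mono_set (Ioi_subset_Ioi hr))
    (((hy.isProfile ha).integrableOn_lagQ hn hω).mono_set (Ioi_subset_Ioi hr))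
    measurableSet_Ioi fun s hs => ?_)
  have hs : 0 < s := lt_of_le_of_lt hr hs
  exact mul_le_mul_of_nonpos_right (h s hs)
    (mul_nonpos_of_nonneg_of_nonpos (by positivity) (hneg s hs.le))

lemma momentQ_antitoneOn (hneg : ∀ s, 0 ≤ s → ω s ≤ 0) (hn : 1 ≤ n) (hω : IsMomentum F ω)
    (ha : 0 < a)
    (hy : Admissible a b y) : AntitoneOn (momentQ n ω y) (Ici 0) := by
  have h := hy.isProfile ha
  refine antitoneOn_of_hasDerivWithinAt_nonpos (convex_Ici 0) (h.continuousOn_lagQ hn hω).neg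
    (f' := fun r => weightQ n y r * (r ^ (n - 1) * ω r)) ?_ ?_
  · rw [interior_Ici]
    exact fun r hr => ((h.hasDerivAt_lagQ hn hω hr).neg.congr_deriv
      (by rw [neg_neg, weightQ])).hasDerivWithinAt
  · rw [interior_Ici]
    intro r hr
    have hr : 0 < r := hr
    have h1 := kerQ_pos (n := n) (h.gamma_pos hr)
    have h2 := h.rho_pos hr.le
    exact mul_nonpos_of_nonneg_of_nonpos (by unfold weightQ; positivity)
      (mul_nonpos_of_nonneg_of_nonpos (by positivity) (hneg r hr.le))

/-- The moment at the origin is positive unless the momentum vanishes. -/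
lemma momentQ_zero_pos (hneg : ∀ s, 0 ≤ s → ω s ≤ 0) (hn : 1 ≤ n) (hω : IsMomentum F ω)
    (hne : ∃ r, 0 ≤ r ∧ ω r ≠ 0)
    (ha : 0 < a) (hy : Admissible a b y) : 0 < momentQ n ω y 0 := by
  have h := hy.isProfile ha
  by_contra hcon
  have hz : ∀ r, 0 ≤ r → momentQ n ω y r = 0 := fun r hr =>
    le_antisymm ((momentQ_antitoneOn hneg hn hω ha hy self_mem_Ici hr hr).trans (not_lt.1 hcon))
      (momentQ_nonneg hneg ha hy hr)
  -- Differentiating Q ≡ 0 in r gives z₀ q(γ)/ρ = 0.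
  have hpos : ∀ r, 0 < r → ω r = 0 := fun r hr => by
    have h1 := (h.hasDerivAt_lagQ hn hω hr).neg
    have h2 : HasDerivAt (fun _ : ℝ => (0 : ℝ)) 0 r := hasDerivAt_const r 0
    have h3 := h1.unique (h2.congr_of_eventuallyEq (by
      filter_upwards [lt_mem_nhds hr] with x hx using hz x hx.le))
    have h4 := kerQ_pos (n := n) (h.gamma_pos hr)
    have h5 := h.rho_pos hr.le
    rw [neg_neg] at h3
    have h6 : 0 < kerQ n (pos y r) / jac y r := by positivity
    have h7 : 0 < r ^ (n - 1) := by positivity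
    rcases mul_eq_zero.1 h3 with h8 | h8
    · exact absurd h8 h6.ne'
    · exact (mul_eq_zero.1 h8).resolve_left h7.ne'
  obtain ⟨r, hr, hr0⟩ := hne
  refine hr0 ?_
  rcases hr.eq_or_lt with rfl | hr
  · have h1 := ((hω.continuousOn 0 self_mem_Ici).mono Ioi_subset_Ici_self).tendsto
    refine tendsto_nhds_unique (h1.congr' ?_) tendsto_const_nhds
    filter_upwards [self_mem_nhdsWithin] with x hx using hpos x hx
  · exact hpos r hr

/-- Since Q' = z₀ q(γ)/ρ, the integrand is the derivative of Q²/2, and Q vanishes at infinity. -/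
lemma integral_weightQ_mul_momentQ (hneg : ∀ s, 0 ≤ s → ω s ≤ 0) (hn : 1 ≤ n) (hω : IsMomentum F ω)
    (ha : 0 < a)
    (hy : Admissible a b y) :
    IntegrableOn (fun s => momentQ n ω y s * (weightQ n y s * (s ^ (n - 1) * ω s))) (Ioi 0) ∧
    ∫ s in Ioi 0, momentQ n ω y s * (weightQ n y s * (s ^ (n - 1) * ω s)) =
      -(momentQ n ω y 0 ^ 2 / 2) := by
  have h := hy.isProfile ha
  have hc : ContinuousOn (momentQ n ω y) (Ici 0) := (h.continuousOn_lagQ hn hω).neg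
  have hint : IntegrableOn (fun s => momentQ n ω y s * (weightQ n y s * (s ^ (n - 1) * ω s)))
      (Ioi 0) := by
    refine Integrable.bdd_mul (c := momentQ n ω y 0) (h.integrableOn_lagQ hn hω)
      ((hc.mono Ioi_subset_Ici_self).aestronglyMeasurable measurableSet_Ioi) ?_
    refine (ae_restrict_iff' measurableSet_Ioi).2 (Eventually.of_forall fun s hs => ?_)
    have hs : 0 ≤ s := le_of_lt hs
    rw [Real.norm_eq_abs, abs_of_nonneg (momentQ_nonneg hneg ha hy hs)]
    exact momentQ_antitoneOn hneg hn hω ha hy self_mem_Ici hs hs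
  refine ⟨hint, ?_⟩
  have hlim : Tendsto (fun s => momentQ n ω y s ^ 2 / 2) atTop (𝓝 0) := by
    have h1 : Tendsto (momentQ n ω y) atTop (𝓝 0) := by
      have := (tendsto_integral_Ioi_atTop (h.integrableOn_lagQ hn hω)).neg
      rwa [neg_zero] at this
    simpa using (h1.pow 2).div_const 2
  rw [integral_Ioi_of_hasDerivAt_of_tendsto (f := fun s => momentQ n ω y s ^ 2 / 2)
    (((hc.pow 2).div_const 2) 0 self_mem_Ici) (fun s hs => ?_) hint hlim, zero_sub]
  have h1 := (h.hasDerivAt_lagQ hn hω hs).neg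
  rw [neg_neg] at h1
  refine ((h1.pow 2).div_const 2).congr_deriv ?_
  simp only [momentQ, weightQ, Pi.neg_apply]
  push_cast
  ring

end Signs

namespace IsFlow

variable {y : ℝ → State}

/-- The key cancellation: in q'(γ) γ_t - q(γ) · strain the P terms drop out and Q is multiplied by
p' q - p q' = γ^(1-n). -/
lemma hasDerivWithinAt_weightQ (hy : IsFlow n ω T y) (hn : 1 ≤ n) (hω : IsMomentum F ω) {t s : ℝ}
    (ht : t ∈ Ico 0 T)
    (hs : 0 < s) : HasDerivWithinAt (fun t => weightQ n (y t) s)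
      (momentQ n ω (y t) s / (pos (y t) s ^ (n - 1) * jac (y t) s)) (Ico 0 T) t := by
  obtain ⟨a, b, ha, hA⟩ := hy.exists_admissible ht
  have h := hA.isProfile ha
  have hg := h.gamma_pos hs
  have hj := h.rho_pos hs.le
  have h1 := (hasDerivAt_kerQ (n := n) hg).comp_hasDerivWithinAt t
    (hy.hasDerivWithinAt_pos hn hω ht hs.le)
  refine (h1.div (hy.hasDerivWithinAt_jac hn hω ht hs.le) hj.ne').congr_deriv ?_
  have hW := kernel_wronskian hn hg
  rw [velocity_eq_moment, strain_eq_moment]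
  simp only [Function.comp]
  field_simp
  linear_combination (momentQ n ω (y t) s) * hW

/-- Dually, the Q terms cancel and P appears with the opposite sign. Hence for nonpositive momentum
q(γ)/ρ increases and p(γ)/ρ decreases in time. -/
lemma hasDerivWithinAt_weightP (hy : IsFlow n ω T y) (hn : 1 ≤ n) (hω : IsMomentum F ω) {t s : ℝ}
    (ht : t ∈ Ico 0 T)
    (hs : 0 < s) : HasDerivWithinAt (fun t => weightP n (y t) s)
      (-(momentP n ω (y t) s / (pos (y t) s ^ (n - 1) * jac (y t) s))) (Ico 0 T) t := by
  obtain ⟨a, b, ha, hA⟩ := hy.exists_admissible ht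
  have h := hA.isProfile ha
  have hg := h.gamma_pos hs
  have hj := h.rho_pos hs.le
  have h1 := (hasDerivAt_kerP (n := n) hg).comp_hasDerivWithinAt t
    (hy.hasDerivWithinAt_pos hn hω ht hs.le)
  refine (h1.div (hy.hasDerivWithinAt_jac hn hω ht hs.le) hj.ne').congr_deriv ?_
  have hW := kernel_wronskian hn hg
  rw [velocity_eq_moment, strain_eq_moment]
  simp only [Function.comp]
  field_simp
  linear_combination (-momentP n ω (y t) s) * hW

variable {t₁ t₂ : ℝ}

lemma weightQ_mono (hy : IsFlow n ω T y) (hneg : ∀ s, 0 ≤ s → ω s ≤ 0) (hn : 1 ≤ n)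
    (hω : IsMomentum F ω) (h1 : 0 ≤ t₁) (h12 : t₁ ≤ t₂) (h2 : t₂ < T)
    {s : ℝ} (hs : 0 < s) : weightQ n (y t₁) s ≤ weightQ n (y t₂) s := by
  have hsub : Icc t₁ t₂ ⊆ Ico 0 T := fun t ht => ⟨h1.trans ht.1, ht.2.trans_lt h2⟩
  have := mul_sub_le_image_sub (c := 0) h12
    (fun t ht => (hy.hasDerivWithinAt_weightQ hn hω (hsub ht) hs).mono hsub) fun t ht => by
      obtain ⟨a, b, ha, hA⟩ := hy.exists_admissible (hsub ht)
      have h := hA.isProfile ha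
      have hg := h.gamma_pos hs
      have hj := h.rho_pos hs.le
      have := momentQ_nonneg (n := n) hneg ha hA hs.le
      positivity
  linarith

lemma weightP_anti (hy : IsFlow n ω T y) (hneg : ∀ s, 0 ≤ s → ω s ≤ 0) (hn : 1 ≤ n)
    (hω : IsMomentum F ω) (h1 : 0 ≤ t₁) (h12 : t₁ ≤ t₂) (h2 : t₂ < T)
    {s : ℝ} (hs : 0 < s) : weightP n (y t₂) s ≤ weightP n (y t₁) s := by
  have hsub : Icc t₁ t₂ ⊆ Ico 0 T := fun t ht => ⟨h1.trans ht.1, ht.2.trans_lt h2⟩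
  have := image_sub_le_mul_sub (c := 0) h12
    (fun t ht => (hy.hasDerivWithinAt_weightP hn hω (hsub ht) hs).mono hsub) fun t ht => by
      obtain ⟨a, b, ha, hA⟩ := hy.exists_admissible (hsub ht)
      have h := hA.isProfile ha
      have hg := h.gamma_pos hs
      have hj := h.rho_pos hs.le
      have := momentP_nonneg (n := n) hneg ha hA s
      rw [neg_nonpos]
      positivity
  linarith

lemma momentQ_mono (hy : IsFlow n ω T y) (hneg : ∀ s, 0 ≤ s → ω s ≤ 0) (hn : 1 ≤ n)
    (hω : IsMomentum F ω) (h1 : 0 ≤ t₁) (h12 : t₁ ≤ t₂) (h2 : t₂ < T)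
    {r : ℝ} (hr : 0 ≤ r) : momentQ n ω (y t₁) r ≤ momentQ n ω (y t₂) r := by
  obtain ⟨a, b, ha, hA⟩ := hy.bounds t₂ ⟨h1.trans h12, h2⟩
  exact momentQ_le_momentQ hneg hn hω ha (hA t₁ ⟨h1, h12⟩) (hA t₂ ⟨h1.trans h12, le_rfl⟩) hr
    fun s hs => hy.weightQ_mono hneg hn hω h1 h12 h2 hs

lemma momentP_anti (hy : IsFlow n ω T y) (hneg : ∀ s, 0 ≤ s → ω s ≤ 0) (hn : 1 ≤ n)
    (hω : IsMomentum F ω) (h1 : 0 ≤ t₁) (h12 : t₁ ≤ t₂) (h2 : t₂ < T)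
    {r : ℝ} : momentP n ω (y t₂) r ≤ momentP n ω (y t₁) r := by
  obtain ⟨a, b, ha, hA⟩ := hy.bounds t₂ ⟨h1.trans h12, h2⟩
  exact momentP_le_momentP hneg hω ha (hA t₂ ⟨h1.trans h12, le_rfl⟩) (hA t₁ ⟨h1, h12⟩)
    fun s hs => hy.weightP_anti hneg hn hω h1 h12 h2 hs

lemma pos_anti (hy : IsFlow n ω T y) (hneg : ∀ s, 0 ≤ s → ω s ≤ 0) (hn : 1 ≤ n)
    (hω : IsMomentum F ω) (h1 : 0 ≤ t₁) (h12 : t₁ ≤ t₂) (h2 : t₂ < T)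
    {r : ℝ} (hr : 0 < r) : pos (y t₂) r ≤ pos (y t₁) r := by
  have hsub : Icc t₁ t₂ ⊆ Ico 0 T := fun t ht => ⟨h1.trans ht.1, ht.2.trans_lt h2⟩
  have := image_sub_le_mul_sub (c := 0) h12
    (fun t ht => (hy.hasDerivWithinAt_pos hn hω (hsub ht) hr.le).mono hsub) fun t ht => by
      obtain ⟨a, b, ha, hA⟩ := hy.exists_admissible (hsub ht)
      have hg := (hA.isProfile ha).gamma_pos hr
      have := momentP_nonneg (n := n) hneg ha hA r
      have := momentQ_nonneg (n := n) hneg ha hA hr.le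
      have := kerP_pos (n := n) hg
      have := kerQ_pos (n := n) hg
      rw [velocity_eq_moment, neg_nonpos]
      positivity
  linarith

lemma pos_le (hy : IsFlow n ω T y) (hneg : ∀ s, 0 ≤ s → ω s ≤ 0) (hn : 1 ≤ n) (hω : IsMomentum F ω)
    {t r : ℝ} (ht : t ∈ Ico 0 T) (hr : 0 < r) :
    pos (y t) r ≤ r := by
  have := hy.pos_anti hneg hn hω le_rfl ht.1 ht.2 hr
  rwa [hy.init, pos_zero_state] at this

/-- The Riccati-type inequality for the moment at the origin. -/
lemma momentQ_zero_growth (hy : IsFlow n ω T y) (hneg : ∀ s, 0 ≤ s → ω s ≤ 0) (hn : 1 ≤ n)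
    (hω : IsMomentum F ω) (h1 : 0 ≤ t₁) (h12 : t₁ ≤ t₂)
    (h2 : t₂ < T) : momentQ n ω (y t₁) 0 + n / 2 * (t₂ - t₁) * momentQ n ω (y t₁) 0 ^ 2 ≤
      momentQ n ω (y t₂) 0 := by
  have hsub : Icc t₁ t₂ ⊆ Ico 0 T := fun t ht => ⟨h1.trans ht.1, ht.2.trans_lt h2⟩
  obtain ⟨a, b, ha, hA⟩ := hy.bounds t₂ ⟨h1.trans h12, h2⟩
  have hA1 := hA t₁ ⟨h1, h12⟩
  have hA2 := hA t₂ ⟨h1.trans h12, le_rfl⟩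
  -- A difference inequality replaces differentiation under the integral: by monotonicity q(γ)/ρ and
  -- Q are at least their values at t₁.
  have hgrow : ∀ s, 0 < s → n * (weightQ n (y t₁) s * momentQ n ω (y t₁) s) * (t₂ - t₁) ≤
      weightQ n (y t₂) s - weightQ n (y t₁) s := by
    intro s hs
    refine mul_sub_le_image_sub h12
      (fun t ht => (hy.hasDerivWithinAt_weightQ hn hω (hsub ht) hs).mono hsub) fun t ht => ?_
    have h := (hA t ⟨h1.trans ht.1, ht.2⟩).isProfile ha
    have hg := h.gamma_pos hs
    have hj := h.rho_pos hs.le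
    have hq := kerQ_pos (n := n) hg
    have e1 := hy.weightQ_mono hneg hn hω h1 ht.1 (hsub ht).2 hs
    have e2 := hy.momentQ_mono hneg hn hω h1 ht.1 (hsub ht).2 hs.le
    have e3 := momentQ_nonneg (n := n) hneg ha hA1 hs.le
    have e4 : 0 ≤ weightQ n (y t) s := by unfold weightQ; positivity
    calc n * (weightQ n (y t₁) s * momentQ n ω (y t₁) s)
        ≤ n * (weightQ n (y t) s * momentQ n ω (y t) s) := by gcongr
      _ = (n * kerQ n (pos (y t) s)) * (momentQ n ω (y t) s / jac (y t) s) := by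
          rw [weightQ]; ring
      -- This is S(γ) ≥ n, in the form γ^(n-1) q(γ) = γ^n β_n(γ) ≤ 1/n.
      _ ≤ 1 / (pos (y t) s) ^ (n - 1) * (momentQ n ω (y t) s / jac (y t) s) := by
          have e5 : 0 ≤ momentQ n ω (y t) s := e3.trans e2
          have hn0 : (0 : ℝ) < n := by exact_mod_cast hn
          gcongr
          have := pow_mul_beta_le hn hg
          rw [← pow_mul_kerQ hn, le_div_iff₀ hn0] at this
          rw [le_div_iff₀ (by positivity)]
          linarith
      _ = _ := by field_simp
  have hp1 := hA1.isProfile ha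
  have hp2 := hA2.isProfile ha
  obtain ⟨hint, hval⟩ := integral_weightQ_mul_momentQ hneg hn hω ha hA1
  -- Integrating `hgrow` against z₀ ≤ 0 reverses it; the extra term is integrated exactly by `hval`.
  have hle : lagQ n ω (pos (y t₂)) (jac (y t₂)) 0 ≤ lagQ n ω (pos (y t₁)) (jac (y t₁)) 0 +
      n * (t₂ - t₁) * -(momentQ n ω (y t₁) 0 ^ 2 / 2) := by
    rw [← hval, ← integral_const_mul]
    unfold lagQ
    rw [← integral_add (hp1.integrableOn_lagQ hn hω) (hint.const_mul _)]
    refine setIntegral_mono_on (hp2.integrableOn_lagQ hn hω)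
      ((hp1.integrableOn_lagQ hn hω).add (hint.const_mul _)) measurableSet_Ioi fun s hs => ?_
    have hs : 0 < s := hs
    have hz : s ^ (n - 1) * ω s ≤ 0 :=
      mul_nonpos_of_nonneg_of_nonpos (by positivity) (hneg s hs.le)
    have := mul_le_mul_of_nonpos_right (hgrow s hs) hz
    change weightQ n (y t₂) s * (s ^ (n - 1) * ω s) ≤ weightQ n (y t₁) s * (s ^ (n - 1) * ω s) +
      n * (t₂ - t₁) * (momentQ n ω (y t₁) s * (weightQ n (y t₁) s * (s ^ (n - 1) * ω s)))
    linarith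
  have e : ∀ z, lagQ n ω (pos z) (jac z) 0 = -momentQ n ω z 0 := fun z => by rw [momentQ, neg_neg]
  rw [e, e] at hle
  linarith

/-- Solutions with nonpositive momentum have a bounded lifetime. -/
lemma lifetime_le (hy : IsFlow n ω T y) (hneg : ∀ s, 0 ≤ s → ω s ≤ 0) (hn : 1 ≤ n)
    (hω : IsMomentum F ω) (hne : ∃ r, 0 ≤ r ∧ ω r ≠ 0) :
    T ≤ 2 / (n / 2 * momentQ n ω 0 0) := by
  have hn0 : (0 : ℝ) < n := by exact_mod_cast hn
  have h0 := momentQ_zero_pos (n := n) hneg hn hω hne one_pos admissible_zero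
  have := lifetime_le_of_growth (T := T) (f := fun t => momentQ n ω (y t) 0) (c := n / 2)
    (by positivity) (by simp only [hy.init]; exact h0)
    fun t₁ t₂ h1 h12 h2 => hy.momentQ_zero_growth hneg hn hω h1 h12 h2
  simpa only [hy.init] using this

end IsFlow

end RadialEPDiff
end

/-! ### Control of the solution by ρ at the origin, and breakdown there. -/

noncomputable section

namespace RadialEPDiff

variable {n : ℕ} {F T a b c : ℝ} {ω : ℝ → ℝ}

lemma velocity_zero_state (s : ℝ) :
    velocity n ω (pos 0) (jac 0) s = greenPotential n ω s := by
  rw [← gammaField_eq]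
  simp only [gammaField, greenPotential, pos_zero_state, jac_zero_state, div_one]

lemma weightP_zero_state (s : ℝ) : weightP n 0 s = kerP n s := by
  rw [weightP, pos_zero_state, jac_zero_state, div_one]

lemma weightQ_zero_state (s : ℝ) : weightQ n 0 s = kerQ n s := by
  rw [weightQ, pos_zero_state, jac_zero_state, div_one]

lemma weightQ_pos {y : State} (ha : 0 < a) (hy : Admissible a b y) {s : ℝ} (hs : 0 < s) :
    0 < weightQ n y s := by
  have h := hy.isProfile ha
  exact div_pos (kerQ_pos (h.gamma_pos hs)) (h.rho_pos hs.le)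

/-- The Wronskian identity combined with p' ≤ (1 + 1/x) p and -q' ≤ (1 + n/x) q. -/
lemma one_div_pow_mul_kerQ_le (hn : 1 ≤ n) {x : ℝ} (hx : 0 < x) :
    1 / (x ^ (n - 1) * kerQ n x) ≤ (2 + (n + 1) / x) * kerP n x := by
  have hq := kerQ_pos (n := n) hx
  have hp := kerP_pos (n := n) hx
  rw [div_le_iff₀ (by positivity)]
  have h1 := kerP'_le (n := n) hx
  have h2 := neg_kerQ'_le hn hx
  have h3 : kerP' n x * kerQ n x - kerP n x * kerQ' n x ≤
      (1 + 1 / x) * kerP n x * kerQ n x + kerP n x * ((1 + n / x) * kerQ n x) := by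
    have := mul_le_mul_of_nonneg_right h1 hq.le
    have := mul_le_mul_of_nonneg_left h2 hp.le
    linarith
  calc 1 = x ^ (n - 1) * (kerP' n x * kerQ n x - kerP n x * kerQ' n x) :=
        (kernel_wronskian hn hx).symm
    _ ≤ x ^ (n - 1) * ((1 + 1 / x) * kerP n x * kerQ n x +
        kerP n x * ((1 + n / x) * kerQ n x)) := by gcongr
    _ = _ := by field_simp; ring

/-- Near the origin the inner moment is controlled by the outer one. -/
lemma beta_mul_momentP_le (hneg : ∀ s, 0 ≤ s → ω s ≤ 0) (hn : 1 ≤ n) (hω : IsMomentum F ω)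
    {y : State} (ha : 0 < a) (hy : Admissible a b y) {r R : ℝ} (hr : 0 < r) (hR : pos y r ≤ R) :
    beta n (pos y r) * momentP n ω y r ≤
      alpha n R * (momentQ n ω y 0 - momentQ n ω y r) := by
  have h := hy.isProfile ha
  have hQ : momentQ n ω y 0 - momentQ n ω y r =
      -∫ s in Ioc 0 r, kerQ n (pos y s) / jac y s * (s ^ (n - 1) * ω s) := by
    have := integral_Ioi_eq_sub (h.integrableOn_lagQ hn hω) hr.le
    simp only [momentQ, lagQ]
    rw [this]
    ring
  rw [hQ, momentP, lagP, mul_neg, mul_neg, ← integral_const_mul, ← integral_const_mul]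
  refine neg_le_neg (setIntegral_mono_on
    (((h.integrableOn_lagQ hn hω).mono_set Ioc_subset_Ioi_self).const_mul _)
    ((h.integrableOn_lagP hω r).const_mul _) measurableSet_Ioc fun s hs => ?_)
  have hs0 := hs.1
  have hg := h.gamma_pos hs0
  have hgr := h.gamma_pos hr
  have hj := h.rho_pos hs0.le
  have hsr := h.gamma_mono hs0.le hs.2
  have hz : s ^ (n - 1) * ω s ≤ 0 :=
    mul_nonpos_of_nonneg_of_nonpos (by positivity) (hneg s hs0.le)
  rw [← mul_assoc (alpha n R), ← mul_assoc (beta n (pos y r))]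
  refine mul_le_mul_of_nonpos_right ?_ hz
  -- For s ≤ r, β decreasing and α increasing give β(γ(r)) p(γ(s)) ≤ α(R) q(γ(s)).
  rw [mul_div_assoc', mul_div_assoc', kerP, kerQ]
  refine div_le_div_of_nonneg_right ?_ hj.le
  have h1 := beta_antitoneOn (n := n) (mem_Ioi.2 hg) (mem_Ioi.2 hgr) hsr
  have h2 := alpha_monotoneOn (n := n) (mem_Ici.2 hg.le)
    (mem_Ici.2 (hg.le.trans (hsr.trans hR))) (hsr.trans hR)
  have h3 := one_le_alpha (Nat.cast_nonneg n) hg.le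
  have h4 := beta_pos (Nat.cast_nonneg n) hgr
  have h5 := beta_pos (Nat.cast_nonneg n) hg
  calc beta n (pos y r) * (pos y s * alpha n (pos y s))
      = pos y s * (beta n (pos y r) * alpha n (pos y s)) := by ring
    _ ≤ pos y s * (beta n (pos y s) * alpha n R) := by gcongr
    _ = _ := by ring

/-- Logarithmic growth of `q(γ)/ρ` plus the displacement of a particle. -/
def deviation (n : ℕ) (y : State) (s : ℝ) : ℝ :=
  Real.log (weightQ n y s / kerQ n s) + (s - pos y s)

lemma deviation_zero_state {s : ℝ} (hs : 0 < s) : deviation n 0 s = 0 := by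
  rw [deviation, weightQ_zero_state, div_self (kerQ_pos hs).ne', pos_zero_state]
  simp

/-- The rate of growth of the deviation. -/
def deviationRate (n : ℕ) (ω : ℝ → ℝ) (y : State) (s : ℝ) : ℝ :=
  momentQ n ω y s * (1 / (pos y s ^ (n - 1) * kerQ n (pos y s))) +
    (kerQ n (pos y s) * momentP n ω y s + kerP n (pos y s) * momentQ n ω y s)

/-- A crude bound for the growth of the deviation, locally uniform in time. -/
lemma deviationRate_le_of_admissible (hneg : ∀ s, 0 ≤ s → ω s ≤ 0) (hn : 1 ≤ n)
    (hω : IsMomentum F ω) {y : State}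
    {s R : ℝ} (ha : 0 < a) (hA : Admissible a b y) (hR : 0 < R) (hs : R ≤ s) :
    deviationRate n ω y s ≤ (3 + (n + 1) / (a * R)) * sizeConst n F a := by
  have h := hA.isProfile ha
  have hs0 : 0 < s := hR.trans_le hs
  have hg := h.gamma_pos hs0
  have hv := h.abs_velocity_le hn hω hs0.le
  have hp := kerP_pos (n := n) hg
  have hq := kerQ_pos (n := n) hg
  have h1 := momentP_nonneg (n := n) hneg ha hA s
  have h2 := momentQ_nonneg (n := n) hneg ha hA hs0.le
  rw [velocity_eq_moment, abs_neg] at hv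
  have h3 := (le_abs_self _).trans hv
  have h4 : kerP n (pos y s) * momentQ n ω y s ≤ sizeConst n F a := by
    have : 0 ≤ kerQ n (pos y s) * momentP n ω y s := by positivity
    linarith
  have h5 : a * R ≤ pos y s := le_trans (by gcongr) (h.mul_le hs0.le)
  rw [deviationRate]
  have h6 : momentQ n ω y s * (1 / (pos y s ^ (n - 1) * kerQ n (pos y s))) ≤
      (2 + (n + 1) / (a * R)) * sizeConst n F a := by
    calc _ ≤ momentQ n ω y s * ((2 + (n + 1) / pos y s) * kerP n (pos y s)) := by
          gcongr
          exact one_div_pow_mul_kerQ_le hn hg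
      _ = (2 + (n + 1) / pos y s) * (kerP n (pos y s) * momentQ n ω y s) := by ring
      _ ≤ _ := by gcongr
  linarith

namespace IsFlow

variable {y : ℝ → State}

lemma hasDerivWithinAt_log_jac (hy : IsFlow n ω T y) (hn : 1 ≤ n) (hω : IsMomentum F ω) {t r : ℝ}
    (ht : t ∈ Ico 0 T)
    (hr : 0 ≤ r) : HasDerivWithinAt (fun t => Real.log (jac (y t) r))
      (strain n ω (pos (y t)) (jac (y t)) r) (Ico 0 T) t := by
  obtain ⟨a, b, ha, hA⟩ := hy.exists_admissible ht
  have hj := (hA.isProfile ha).rho_pos hr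
  refine ((hy.hasDerivWithinAt_jac hn hω ht hr).log hj.ne').congr_deriv ?_
  field_simp

lemma hasDerivWithinAt_deviation (hy : IsFlow n ω T y) (hn : 1 ≤ n) (hω : IsMomentum F ω) {t s : ℝ}
    (ht : t ∈ Ico 0 T) (hs : 0 < s) :
    HasDerivWithinAt (fun t => deviation n (y t) s) (deviationRate n ω (y t) s) (Ico 0 T) t := by
  obtain ⟨a, b, ha, hA⟩ := hy.exists_admissible ht
  have h := hA.isProfile ha
  have hj := h.rho_pos hs.le
  have hg := h.gamma_pos hs
  have hq := kerQ_pos (n := n) hs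
  have hqg := kerQ_pos (n := n) hg
  have hw := weightQ_pos (n := n) ha hA hs
  have h1 := ((hy.hasDerivWithinAt_weightQ hn hω ht hs).div_const (kerQ n s)).log
    (div_pos hw hq).ne'
  refine (h1.add ((hy.hasDerivWithinAt_pos hn hω ht hs.le).const_sub s)).congr_deriv ?_
  rw [velocity_eq_moment, deviationRate, weightQ]
  field_simp

lemma jac_zero_anti (hy : IsFlow n ω T y) (hneg : ∀ s, 0 ≤ s → ω s ≤ 0) (hn : 1 ≤ n)
    (hω : IsMomentum F ω) :
    AntitoneOn (fun t => jac (y t) 0) (Ico 0 T) := by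
  have hd := fun t (ht : t ∈ Ico 0 T) => hy.hasDerivWithinAt_jac hn hω ht le_rfl
  refine antitoneOn_of_hasDerivWithinAt_nonpos (convex_Ico 0 T)
    (fun t ht => (hd t ht).continuousWithinAt)
    (fun t ht => (hd t (interior_subset ht)).mono interior_subset) fun t ht => ?_
  obtain ⟨a, b, ha, hA⟩ := hy.exists_admissible (interior_subset ht)
  have h := hA.isProfile ha
  rw [h.strain_zero]
  exact mul_nonpos_of_nonneg_of_nonpos (h.rho_pos le_rfl).le
    (neg_nonneg.1 (momentQ_nonneg hneg ha hA le_rfl))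

/-- If `γ_r` stays away from zero at the origin, so does `γ/r` locally. -/
lemma mul_exp_le_pos (hy : IsFlow n ω T y) (hneg : ∀ s, 0 ≤ s → ω s ≤ 0) (hn : 1 ≤ n)
    (hω : IsMomentum F ω) (hc : 0 < c)
    (hjac : ∀ t ∈ Ico 0 T, c ≤ jac (y t) 0) {t r R : ℝ} (ht : t ∈ Ico 0 T) (hr : 0 < r)
    (hR : r ≤ R) : r * Real.exp (alpha n R * Real.log c) ≤ pos (y t) r := by
  have hsub : Icc 0 t ⊆ Ico 0 T := Icc_subset_Ico_right ht.2
  have hαR := one_le_alpha (Nat.cast_nonneg n) (hr.le.trans hR)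
  have hpos : ∀ s ∈ Ico 0 T, 0 < pos (y s) r := fun s hs => by
    obtain ⟨a, b, ha, hA⟩ := hy.exists_admissible hs
    exact (hA.isProfile ha).gamma_pos hr
  have hd : ∀ s ∈ Icc 0 t, HasDerivWithinAt
      (fun s => Real.log (pos (y s) r) - alpha n R * Real.log (jac (y s) 0))
      (velocity n ω (pos (y s)) (jac (y s)) r / pos (y s) r -
        alpha n R * strain n ω (pos (y s)) (jac (y s)) 0) (Icc 0 t) s := fun s hs =>
    (((hy.hasDerivWithinAt_pos hn hω (hsub hs) hr.le).log (hpos s (hsub hs)).ne').sub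
      ((hy.hasDerivWithinAt_log_jac hn hω (hsub hs) le_rfl).const_mul _)).mono hsub
  -- The rate of log γ(r) is -(βP + αQ(r)) ≥ -α(R) Q(0), and -Q(0) is the rate of log ρ(t,0). So log
  -- γ(r) - α(R) log ρ(t,0) does not decrease.
  have hmv := mul_sub_le_image_sub (c := 0) ht.1 hd fun s hs => by
    obtain ⟨a, b, ha, hA⟩ := hy.exists_admissible (hsub hs)
    have h := hA.isProfile ha
    have hg := h.gamma_pos hr
    have hgR : pos (y s) r ≤ R := (hy.pos_le hneg hn hω (hsub hs) hr).trans hR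
    have h1 := beta_mul_momentP_le hneg hn hω ha hA hr hgR
    have h2 := alpha_monotoneOn (n := n) (mem_Ici.2 hg.le) (mem_Ici.2 (hg.le.trans hgR)) hgR
    have h3 := momentQ_nonneg (n := n) hneg ha hA hr.le
    have h4 := mul_le_mul_of_nonneg_right h2 h3
    have e : velocity n ω (pos (y s)) (jac (y s)) r / pos (y s) r =
        -(beta n (pos (y s) r) * momentP n ω (y s) r +
          alpha n (pos (y s) r) * momentQ n ω (y s) r) := by
      rw [velocity_eq_moment, kerQ, kerP]
      field_simp
    have e2 : lagQ n ω (pos (y s)) (jac (y s)) 0 = -momentQ n ω (y s) 0 := by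
      rw [momentQ, neg_neg]
    rw [e, h.strain_zero, e2]
    linarith
  have hpt := hpos t ht
  simp only [hy.init, pos_zero_state, jac_zero_state, Real.log_one, mul_zero, sub_zero,
    zero_mul] at hmv
  have hlog : Real.log c ≤ Real.log (jac (y t) 0) := Real.log_le_log hc (hjac t ht)
  have h5 : Real.log r + alpha n R * Real.log c ≤ Real.log (pos (y t) r) := by
    have := mul_le_mul_of_nonneg_left hlog (zero_le_one.trans hαR)
    linarith
  have h6 := Real.exp_le_exp.2 h5
  rwa [Real.exp_add, Real.exp_log hr, Real.exp_log hpt] at h6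

lemma sub_pos_le_deviation (hy : IsFlow n ω T y) (hneg : ∀ s, 0 ≤ s → ω s ≤ 0) (hn : 1 ≤ n)
    (hω : IsMomentum F ω) {t s : ℝ} (ht : t ∈ Ico 0 T)
    (hs : 0 < s) : s - pos (y t) s ≤ deviation n (y t) s := by
  have h1 := hy.weightQ_mono hneg hn hω le_rfl ht.1 ht.2 hs
  rw [hy.init, weightQ_zero_state] at h1
  have := Real.log_nonneg ((one_le_div (kerQ_pos hs)).2 h1)
  rw [deviation]
  linarith

lemma weightQ_le_deviation (hy : IsFlow n ω T y) (hneg : ∀ s, 0 ≤ s → ω s ≤ 0) (hn : 1 ≤ n)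
    (hω : IsMomentum F ω) {t s : ℝ} (ht : t ∈ Ico 0 T)
    (hs : 0 < s) : weightQ n (y t) s ≤ Real.exp (deviation n (y t) s) * kerQ n s := by
  obtain ⟨a, b, ha, hA⟩ := hy.exists_admissible ht
  have hq := kerQ_pos (n := n) hs
  have h1 := hy.pos_le hneg hn hω ht hs
  rw [← div_le_iff₀ hq, ← Real.exp_log (div_pos (weightQ_pos (n := n) ha hA hs) hq),
    Real.exp_le_exp, deviation]
  linarith

/-- A bound for the growth of the deviation by the initial velocity. -/
lemma deviationRate_le (hy : IsFlow n ω T y) (hneg : ∀ s, 0 ≤ s → ω s ≤ 0) (hn : 1 ≤ n)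
    (hω : IsMomentum F ω) {t s R : ℝ} (ht : t ∈ Ico 0 T)
    (hR : 2 ≤ R) (hdev : ∀ σ, R ≤ σ → deviation n (y t) σ ≤ 1) (hs : R ≤ s) :
    deviationRate n ω (y t) s ≤ (n + 4 + 2 ^ n) * Real.exp 1 * -greenPotential n ω s := by
  obtain ⟨a, b, ha, hA⟩ := hy.exists_admissible ht
  have h := hA.isProfile ha
  have hs0 : 0 < s := by linarith
  have hg := h.gamma_pos hs0
  have hgs := hy.pos_le hneg hn hω ht hs0
  have hdisp := (hy.sub_pos_le_deviation hneg hn hω ht hs0).trans (hdev s hs)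
  have hg1 : 1 ≤ pos (y t) s := by linarith
  have hps := kerP_monotoneOn (n := n) (mem_Ici.2 hg.le) (mem_Ici.2 hs0.le) hgs
  have hp := kerP_pos (n := n) hg
  have hp0 := kerP_pos (n := n) hs0
  have hq := kerQ_pos (n := n) hs0
  have hP0 := momentP_nonneg (n := n) hneg one_pos admissible_zero s
  have hQ0 := momentQ_nonneg (n := n) hneg one_pos admissible_zero hs0.le
  have hP := momentP_nonneg (n := n) hneg ha hA s
  have hPle : momentP n ω (y t) s ≤ momentP n ω 0 s := by
    have := hy.momentP_anti hneg hn hω le_rfl ht.1 ht.2 (r := s)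
    rwa [hy.init] at this
  -- Beyond s the weight q(γ)/ρ has grown by at most the factor e, because the deviation is at most
  -- 1 there.
  have hQle : momentQ n ω (y t) s ≤ Real.exp 1 * momentQ n ω 0 s := by
    rw [momentQ, momentQ, mul_neg]
    refine neg_le_neg ?_
    unfold lagQ
    rw [← integral_const_mul]
    refine setIntegral_mono_on
      ((((admissible_zero.isProfile one_pos).integrableOn_lagQ hn hω).mono_set
        (Ioi_subset_Ioi hs0.le)).const_mul _)
      ((h.integrableOn_lagQ hn hω).mono_set (Ioi_subset_Ioi hs0.le)) measurableSet_Ioi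
      fun σ hσ => ?_
    have hσ0 : 0 < σ := hs0.trans hσ
    rw [← mul_assoc]
    refine mul_le_mul_of_nonpos_right ?_
      (mul_nonpos_of_nonneg_of_nonpos (by positivity) (hneg σ hσ0.le))
    change weightQ n (y t) σ ≤ Real.exp 1 * weightQ n 0 σ
    have hqσ := kerQ_pos (n := n) hσ0
    rw [weightQ_zero_state]
    refine (hy.weightQ_le_deviation hneg hn hω ht hσ0).trans ?_
    gcongr
    exact hdev σ (hs.trans (le_of_lt hσ))
  have hQ := momentQ_nonneg (n := n) hneg ha hA hs0.le
  -- As s ≤ γ + 1 and γ ≥ 1, the ratio s/γ is at most 2 and the difference at most 1.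
  have hqg : kerQ n (pos (y t) s) ≤ 2 ^ n * Real.exp 1 * kerQ n s := by
    refine (kerQ_le_mul_exp hn hg hgs).trans ?_
    rw [mul_comm]
    gcongr
    rw [div_le_iff₀ hg]
    linarith
  -- With γ ≥ 1 the factor 2 + (n+1)/γ is at most n + 3; p is nondecreasing and γ(s) ≤ s.
  have hw : 1 / (pos (y t) s ^ (n - 1) * kerQ n (pos (y t) s)) ≤ (n + 3) * kerP n s := by
    refine (one_div_pow_mul_kerQ_le hn hg).trans ?_
    have : ((n : ℝ) + 1) / pos (y t) s ≤ n + 1 := div_le_self (by positivity) hg1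
    exact mul_le_mul (by linarith) hps hp.le (by positivity)
  have hqg0 := kerQ_pos (n := n) hg
  have hV : -greenPotential n ω s =
      kerQ n s * momentP n ω 0 s + kerP n s * momentQ n ω 0 s := by
    rw [← velocity_zero_state, velocity_eq_moment, pos_zero_state, neg_neg]
  rw [hV, deviationRate]
  have he := Real.exp_pos 1
  -- The two terms acquire the constants 2^n e and (n+3)e + e. Adding the missing cross terms lets
  -- the initial speed factor out.
  calc _ ≤ Real.exp 1 * momentQ n ω 0 s * ((n + 3) * kerP n s) +
        (2 ^ n * Real.exp 1 * kerQ n s * momentP n ω 0 s +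
          kerP n s * (Real.exp 1 * momentQ n ω 0 s)) := by gcongr
    _ = 2 ^ n * Real.exp 1 * (kerQ n s * momentP n ω 0 s) +
        (n + 4) * Real.exp 1 * (kerP n s * momentQ n ω 0 s) := by ring
    _ ≤ 2 ^ n * Real.exp 1 * (kerQ n s * momentP n ω 0 s) +
        (n + 4) * Real.exp 1 * (kerP n s * momentQ n ω 0 s) +
        ((n + 4) * Real.exp 1 * (kerQ n s * momentP n ω 0 s) +
          2 ^ n * Real.exp 1 * (kerP n s * momentQ n ω 0 s)) := by
        refine le_add_of_nonneg_right ?_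
        positivity
    _ = _ := by ring

/-- Particles far from the origin move by at most one unit during the lifetime. -/
lemma exists_deviation_le (hy : IsFlow n ω T y) (hneg : ∀ s, 0 ≤ s → ω s ≤ 0) (hn : 1 ≤ n)
    (hω : IsMomentum F ω) (hT : 0 < T)
    (h0 : Tendsto ω atTop (𝓝 0)) :
    ∃ R : ℝ, 2 ≤ R ∧ ∀ t ∈ Ico 0 T, ∀ s, R ≤ s → s - pos (y t) s ≤ 1 := by
  set C : ℝ := (n + 4 + 2 ^ n) * Real.exp 1 with hC
  have hC0 : 0 < C := by positivity
  have hlim : Tendsto (fun s => C * -greenPotential n ω s) atTop (𝓝 0) := by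
    have := ((isInverse_greenPotential hn hω.continuousOn h0).tendsto_atTop.neg).const_mul C
    simpa using this
  have hT2 : 0 < 1 / (2 * T) := by positivity
  obtain ⟨R₀, hR₀⟩ := eventually_atTop.1 (hlim.eventually_lt_const hT2)
  set R := max 2 R₀ with hRdef
  have hR2 : 2 ≤ R := le_max_left _ _
  have hR0 : 0 < R := by linarith
  have hsmall : ∀ s, R ≤ s → C * -greenPotential n ω s ≤ 1 / (2 * T) := fun s hs =>
    (hR₀ s ((le_max_right _ _).trans hs)).le
  refine ⟨R, hR2, ?_⟩
  -- Bootstrap: deviation at most 1 up to time t makes its rate at most 1/(2T), hence the deviation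
  -- itself at most 1/2.
  have himp : ∀ t ∈ Ico 0 T, (∀ τ ∈ Icc 0 t, ∀ s, R ≤ s → deviation n (y τ) s ≤ 1) →
      ∀ s, R ≤ s → deviation n (y t) s ≤ 1 / 2 := by
    intro t ht hd s hs
    have hs0 : 0 < s := hR0.trans_le hs
    have hsub : Icc 0 t ⊆ Ico 0 T := Icc_subset_Ico_right ht.2
    have hmv := image_sub_le_mul_sub (c := 1 / (2 * T)) ht.1
      (fun τ hτ => (hy.hasDerivWithinAt_deviation hn hω (hsub hτ) hs0).mono hsub) fun τ hτ =>
        (hy.deviationRate_le hneg hn hω (hsub hτ) hR2 (hd τ hτ) hs).trans (hsmall s hs)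
    rw [hy.init, deviation_zero_state hs0, sub_zero, sub_zero] at hmv
    refine hmv.trans ?_
    rw [one_div_mul_eq_div, div_le_div_iff₀ (by positivity) (by norm_num)]
    linarith [ht.2]
  have hall : ∀ τ ∈ Ico 0 T, ∀ s, R ≤ s → deviation n (y τ) s ≤ 1 := by
    intro τ hτ
    obtain ⟨a, b, ha, hA⟩ := hy.bounds τ hτ
    have hsz := ((hA 0 ⟨le_rfl, hτ.1⟩).isProfile ha).sizeConst_pos (n := n) hω
    set K := (3 + (n + 1) / (a * R)) * sizeConst n F a with hK
    have hK0 : 0 < K := by positivity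
    -- On [0,τ] the crude rate bound K holds for all s ≥ R at once, so a deviation of at most 1/2
    -- stays at most 1 for a further time 1/(2K). Alternating with `himp` covers [0,τ].
    have hstep : ∀ k : ℕ, ∀ t ∈ Icc 0 τ, t ≤ k * (1 / (2 * K)) → ∀ s, R ≤ s →
        deviation n (y t) s ≤ 1 := by
      intro k
      induction k with
      | zero =>
        intro t ht htk s hs
        have : t = 0 := le_antisymm (by simpa using htk) ht.1
        rw [this, hy.init, deviation_zero_state (hR0.trans_le hs)]
        norm_num
      | succ k ih =>
        intro t ht htk s hs
        by_cases hcase : t ≤ k * (1 / (2 * K))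
        · exact ih t ht hcase s hs
        · push Not at hcase
          set t₀ := (k : ℝ) * (1 / (2 * K)) with ht₀
          have ht00 : 0 ≤ t₀ := by positivity
          have ht0 : t₀ ∈ Icc 0 τ := ⟨ht00, hcase.le.trans ht.2⟩
          have ht₀T : t₀ ∈ Ico 0 T := ⟨ht00, ht0.2.trans_lt hτ.2⟩
          have hhalf := himp t₀ ht₀T
            (fun σ hσ => ih σ ⟨hσ.1, hσ.2.trans ht0.2⟩ hσ.2) s hs
          have hsub : Icc t₀ t ⊆ Ico 0 T := fun σ hσ =>
            ⟨ht00.trans hσ.1, (hσ.2.trans ht.2).trans_lt hτ.2⟩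
          have hmv := image_sub_le_mul_sub (c := K) hcase.le
            (fun σ hσ => (hy.hasDerivWithinAt_deviation hn hω (hsub hσ)
              (hR0.trans_le hs)).mono hsub) fun σ hσ =>
            deviationRate_le_of_admissible hneg hn hω ha
              (hA σ ⟨ht00.trans hσ.1, hσ.2.trans ht.2⟩) hR0 hs
          have : K * (t - t₀) ≤ 1 / 2 := by
            have h1 : t - t₀ ≤ 1 / (2 * K) := by
              push_cast at htk
              rw [add_mul, one_mul] at htk
              linarith
            calc K * (t - t₀) ≤ K * (1 / (2 * K)) := by gcongr
              _ = 1 / 2 := by field_simp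
          linarith
    obtain ⟨k, hk⟩ := exists_nat_ge (τ * (2 * K))
    refine hstep k τ ⟨hτ.1, le_rfl⟩ ?_
    rw [mul_one_div, le_div_iff₀ (by positivity)]
    exact hk
  exact fun t ht s hs =>
    (hy.sub_pos_le_deviation hneg hn hω ht (hR0.trans_le hs)).trans (hall t ht s hs)

/-- If `γ_r` stays away from zero at the origin, the solution stays uniformly bounded. -/
lemma exists_admissible_of_le_jac_zero (hy : IsFlow n ω T y) (hneg : ∀ s, 0 ≤ s → ω s ≤ 0)
    (hn : 1 ≤ n) (hω : IsMomentum F ω) (hT : 0 < T)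
    (h0 : Tendsto ω atTop (𝓝 0)) (hc : 0 < c) (hjac : ∀ t ∈ Ico 0 T, c ≤ jac (y t) 0) :
    ∃ a b : ℝ, 0 < a ∧ ∀ t ∈ Ico 0 T, Admissible a b (y t) := by
  obtain ⟨R, hR2, hfar⟩ := hy.exists_deviation_le hneg hn hω hT h0
  -- The exponential serves r ≤ R, through `mul_exp_le_pos`; the 2 serves r ≥ R ≥ 2, where r ≤ γ + 1
  -- ≤ 2γ.
  set κ := max 2 (Real.exp (-(alpha n R * Real.log c))) with hκ
  have hκ1 : 1 ≤ κ := le_trans (by norm_num) (le_max_left _ _)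
  have hκ0 : 0 < κ := by linarith
  have hcomp : ∀ t ∈ Ico 0 T, ∀ r, 0 < r → r ≤ κ * pos (y t) r ∧ |r - pos (y t) r| ≤ R := by
    intro t ht r hr
    obtain ⟨a, b, ha, hA⟩ := hy.exists_admissible ht
    have hg := (hA.isProfile ha).gamma_pos hr
    have hle := hy.pos_le hneg hn hω ht hr
    rw [abs_of_nonneg (by linarith)]
    rcases le_total r R with hrR | hrR
    · refine ⟨?_, by linarith⟩
      have h1 := hy.mul_exp_le_pos hneg hn hω hc hjac ht hr hrR
      calc r = Real.exp (-(alpha n R * Real.log c)) *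
            (r * Real.exp (alpha n R * Real.log c)) := by
            rw [mul_left_comm, ← Real.exp_add, neg_add_cancel, Real.exp_zero, mul_one]
        _ ≤ κ * pos (y t) r := by
            gcongr
            exact le_max_right _ _
    · have h1 := hfar t ht r hrR
      refine ⟨?_, by linarith⟩
      have : 2 * pos (y t) r ≤ κ * pos (y t) r := by gcongr; exact le_max_left _ _
      linarith
  set L := κ ^ n * Real.exp R with hL
  have hL0 : 0 < L := by positivity
  have hF := hω.pos
  have hM := massConst_pos (n := n)
  set M := n * κ * L * F * massConst n with hMdef
  refine ⟨min c L⁻¹, max 1 (Real.exp (M * T)), lt_min hc (by positivity), fun t ht r hr => ?_⟩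
  rcases hr.eq_or_lt with rfl | hr
  · refine ⟨(min_le_left _ _).trans (hjac t ht), le_trans ?_ (le_max_left _ _)⟩
    have := hy.jac_zero_anti hneg hn hω ⟨le_rfl, hT⟩ ht ht.1
    simpa only [hy.init, jac_zero_state] using this
  have hadm : ∀ τ ∈ Ico 0 T, 0 < pos (y τ) r ∧ 0 < jac (y τ) r := fun τ hτ => by
    obtain ⟨a, b, ha, hA⟩ := hy.exists_admissible hτ
    exact ⟨(hA.isProfile ha).gamma_pos hr, (hA.isProfile ha).rho_pos hr.le⟩
  obtain ⟨hg, hj⟩ := hadm t ht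
  constructor
  -- Lower bound for ρ: as p(γ)/ρ does not increase, p(γ) ≤ ρ p(r) ≤ ρ L p(γ).
  · refine (min_le_right _ _).trans ?_
    obtain ⟨h1, h2⟩ := hcomp t ht r hr
    have h3 := kerP_comparable hn hr hg hκ1 h1 h2
    have h4 := hy.weightP_anti hneg hn hω le_rfl ht.1 ht.2 hr
    rw [hy.init, weightP_zero_state, weightP, div_le_iff₀ hj] at h4
    have hp := kerP_pos (n := n) hg
    have h5 : kerP n (pos (y t) r) * 1 ≤ kerP n (pos (y t) r) * (L * jac (y t) r) := by
      calc _ ≤ kerP n r * jac (y t) r := by linarith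
        _ ≤ L * kerP n (pos (y t) r) * jac (y t) r := by gcongr
        _ = _ := by ring
    have h6 := le_of_mul_le_mul_left h5 hp
    rw [inv_eq_one_div, div_le_iff₀ hL0]
    linarith
  -- Upper bound for ρ: only -q'(γ) P can make the strain positive. P is at most its initial value
  -- and q(γ) is comparable to q(r), so the strain is at most M and log ρ ≤ M T.
  · refine le_trans ?_ (le_max_right _ _)
    have hsub : Icc 0 t ⊆ Ico 0 T := Icc_subset_Ico_right ht.2
    have hM0 : 0 ≤ M := by positivity
    have hmv := image_sub_le_mul_sub (c := M) ht.1
      (fun τ hτ => (hy.hasDerivWithinAt_log_jac hn hω (hsub hτ) hr.le).mono hsub) fun τ hτ => by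
        obtain ⟨a, b, ha, hA⟩ := hy.exists_admissible (hsub hτ)
        obtain ⟨h1, h2⟩ := hcomp τ (hsub hτ) r hr
        have hgτ := (hadm τ (hsub hτ)).1
        rw [abs_sub_comm] at h2
        have h3 := kerQ_comparable hn hgτ hr hκ1 h1 h2
        have h4 := abs_kerQ'_le hn hgτ
        have h5 := one_le_kerP' (n := n) hgτ.le
        have h6 := momentQ_nonneg (n := n) hneg ha hA hr.le
        have h7 := momentP_nonneg (n := n) hneg ha hA r
        have h8 : momentP n ω (y τ) r ≤ F * massP n r := by
          have e1 := hy.momentP_anti hneg hn hω le_rfl (hsub hτ).1 (hsub hτ).2 (r := r)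
          have e2 := (admissible_zero.isProfile one_pos).abs_lagP_le hn hω hr.le
          rw [hy.init] at e1
          simp only [inv_one, one_pow, mul_one, pos_zero_state] at e2
          exact e1.trans ((neg_le_abs _).trans e2)
        have hmass := massP_nonneg (n := n) r
        have hq := kerQ_pos (n := n) hr
        have hqτ := kerQ_pos (n := n) hgτ
        rw [strain_eq_moment]
        have h9 : 0 ≤ kerP' n (pos (y τ) r) * momentQ n ω (y τ) r := by positivity
        have h10 : 1 + 1 / pos (y τ) r ≤ κ * (1 + 1 / r) := by
          have : 1 / pos (y τ) r ≤ κ * (1 / r) := by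
            rw [mul_one_div, div_le_div_iff₀ hgτ hr, one_mul]
            exact h1
          linarith
        have h11 := kernel_mass_le hn hr
        have hmQ := massQ_nonneg (n := n) hr.le
        have hpr := kerP_pos (n := n) hr
        have h12 : (1 + 1 / r) * (kerQ n r * massP n r) ≤ massConst n := by
          refine le_trans ?_ h11
          gcongr
          exact le_add_of_nonneg_right (by positivity)
        calc _ ≤ |kerQ' n (pos (y τ) r)| * momentP n ω (y τ) r := by
              have := mul_le_mul_of_nonneg_right (neg_le_abs (kerQ' n (pos (y τ) r))) h7
              linarith
          _ ≤ n * ((κ * (1 + 1 / r)) * (L * kerQ n r)) * (F * massP n r) := by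
              refine mul_le_mul (h4.trans ?_) h8 h7 (by positivity)
              gcongr
          _ = n * κ * L * F * ((1 + 1 / r) * (kerQ n r * massP n r)) := by ring
          _ ≤ M := by rw [hMdef]; gcongr
    simp only [hy.init, jac_zero_state, Real.log_one, sub_zero] at hmv
    rw [← Real.exp_log hj, Real.exp_le_exp]
    refine hmv.trans ?_
    gcongr
    exact ht.2.le

/-- At the end of a maximal lifetime `γ_r` vanishes at the origin. -/
lemma tendsto_jac_zero (hy : IsFlow n ω T y) (hneg : ∀ s, 0 ≤ s → ω s ≤ 0) (hn : 1 ≤ n)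
    (hω : IsMomentum F ω) (hT : 0 < T)
    (h0 : Tendsto ω atTop (𝓝 0))
    (hmax : ∀ T' z, 0 < T' → IsFlow n ω T' z → T' ≤ T) :
    Tendsto (fun t => jac (y t) 0) (𝓝[<] T) (𝓝 0) := by
  rw [Metric.tendsto_nhds]
  intro c hc
  -- One such time suffices because ρ(t,0) is nonincreasing. If there were none, the uniform bounds
  -- would give a continuation beyond the maximal time.
  have hex : ∃ t ∈ Ico 0 T, jac (y t) 0 < c := by
    by_contra! hcon
    obtain ⟨a, b, ha, hA⟩ := hy.exists_admissible_of_le_jac_zero hneg hn hω hT h0 hc hcon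
    obtain ⟨T', hT', z, hz⟩ := hy.exists_extension hn hω hT ha hA
    exact absurd (hmax T' z (hT.trans hT') hz) (not_le.2 hT')
  obtain ⟨t₀, ht₀, hlt⟩ := hex
  filter_upwards [Ioo_mem_nhdsLT ht₀.2] with t ht
  have htI : t ∈ Ico 0 T := ⟨ht₀.1.trans ht.1.le, ht.2⟩
  obtain ⟨a, b, ha, hA⟩ := hy.exists_admissible htI
  have hj := (hA.isProfile ha).rho_pos le_rfl
  rw [Real.dist_eq, sub_zero, abs_of_pos hj]
  exact (hy.jac_zero_anti hneg hn hω ht₀ htI ht.1.le).trans_lt hlt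

end IsFlow

end RadialEPDiff
end

/-! ### Assembly of the theorem. -/

theorem theorem5p2 (n : ℕ) (hn : 1 ≤ n) :
    -- `δ` is the kernel of the inverse of `1 - Δ` on radial vector fields
    (∀ f : ℝ → ℝ, ContinuousOn f (Ici 0) → Tendsto f atTop (𝓝 0) →
      RadialEPDiff.IsInverse n f (RadialEPDiff.greenPotential n f) ∧
      ∀ u : ℝ → ℝ, RadialEPDiff.IsInverse n f u →
        ∀ r, 0 ≤ r → u r = RadialEPDiff.greenPotential n f r) ∧
    -- the function `S`
    (∀ r, 0 < r → RadialEPDiff.S n r = 1 / (r ^ n * RadialEPDiff.beta n r)) ∧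
    (∃ C : ℝ, 0 < C ∧ ∀ r, 0 < r → C ≤ RadialEPDiff.S n r) ∧
    -- finite-time breakdown
    (∀ ω₀ : ℝ → ℝ, ContinuousOn ω₀ (Ici 0) → Tendsto ω₀ atTop (𝓝 0) →
      (∀ r, 0 ≤ r → ω₀ r ≤ 0) → (∃ r, 0 ≤ r ∧ ω₀ r ≠ 0) →
      ∃ (T : ℝ) (γ ρ : ℝ → ℝ → ℝ), 0 < T ∧
        RadialEPDiff.IsLagrangianSolution n ω₀ T γ ρ ∧
        (∀ (T' : ℝ) (γ' ρ' : ℝ → ℝ → ℝ), 0 < T' →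
          RadialEPDiff.IsLagrangianSolution n ω₀ T' γ' ρ' →
          T' ≤ T ∧ ∀ t ∈ Ico 0 T', ∀ r, 0 ≤ r → γ' t r = γ t r ∧ ρ' t r = ρ t r) ∧
        ∃ r₀, 0 ≤ r₀ ∧ Tendsto (fun t => ρ t r₀) (𝓝[<] T) (𝓝 0)) := by
  refine ⟨fun f hf h0 => ⟨RadialEPDiff.isInverse_greenPotential hn hf h0, fun u hu r hr =>
    hu.eq_greenPotential hn hf h0 hr⟩, fun r hr => RadialEPDiff.S_eq hn hr,
    ⟨n, by exact_mod_cast hn, fun r hr => RadialEPDiff.le_S hn hr⟩, fun ω₀ hc h0 hneg hne => ?_⟩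
  obtain ⟨F, hF0, hF⟩ := RadialEPDiff.exists_bound_of_tendsto hc h0
  have hω : RadialEPDiff.IsMomentum F ω₀ := ⟨hF0, hc, hF⟩
  obtain ⟨T, hT, ⟨y, hy⟩, hmax⟩ := RadialEPDiff.exists_maximal_isFlow hn hω
    fun T y _ hy => hy.lifetime_le hneg hn hω hne
  refine ⟨T, fun t => RadialEPDiff.pos (y t), fun t => RadialEPDiff.jac (y t), hT,
    hy.isLagrangianSolution hn hω, fun T' γ' ρ' hT' h' => ?_, 0, le_rfl,
    hy.tendsto_jac_zero hneg hn hω hT h0 hmax⟩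
  -- Any competing pair is lifted to a curve of states, so that maximality of T and uniqueness of
  -- flows apply to it.
  obtain ⟨z, hz, hzeq⟩ := h'.exists_isFlow hn hω hT'
  have hle := hmax T' z hT' hz
  refine ⟨hle, fun t ht r hr => ?_⟩
  have he := hz.eqOn hn hω (hy.mono hle) ht
  rw [← (hzeq t ht r hr).1, ← (hzeq t ht r hr).2, he]
  exact ⟨rfl, rfl⟩
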